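/- Setting. A vocabulary $V$ has types, typed predicates and typed function symbols. The types have finite, pairwise disjoint interpretations, whose elements are integers or symbolic constants (totally ordered, integers first). Formulas are well-typed first-order formulas with comparisons $=,\neq,\le,\ge,<,>$ and cardinality terms $\#\{\vec x:\varphi\}$. A definition $\Delta$ is a finite set of rules $\forall\vec x: P(\vec x)\leftarrow\varphi$. It is *valid* if, for every interpretation of its open symbols (those that head no rule), its well-founded model is two-valued; a structure satisfies $\Delta$ if it is the two-valued well-founded model of $\Delta$ given its own interpretation of the open symbols. (The well-founded model is the limit of the iteration that starts from the open symbols with all defined atoms unknown, and repeatedly adds as true the heads of rule instances whose body, in normal form, is certain, and as false the greatest unfounded set, i.e. the greatest set $U$ of defined atoms that are not true such that every body of a rule instance for an atom of $U$ is not possible once the positive occurrences of atoms of $U$ are denied. Certainty and possibility are Kleene evaluations in the current three-valued interpretation; the cardinality of a set ranges from the number of its certain elements to the number of its possible elements.) A model expansion problem $M=MX(V,S,Th)$ consists of $V$, a structure $S$ interpreting the types and some of the predicates and function symbols, and a theory $Th$; its solutions are the $V$-structures that expand $S$ and satisfy $Th$. Translation. Formulas are first put in negation normal form, with each function symbol $F$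 replaced by a predicate $P_F$ for its graph (together with the constraint $\forall\vec x:\#\{y:P_F(\vec x,y)\}=1$) and cardinality terms compared with simple terms only. Let $Th'$ be the normalized theory without $\Delta$, let $\Delta'$ be $\Delta$ with each defined predicate $P$ renamed to a fresh $P_\Delta$, and let $Eq$ be the set of all sentences $\forall\vec x: P(\vec x)\Leftrightarrow P_\Delta(\vec x)$ for defined $P$. The answer set program $\alpha(M)$ is the union of - $\alpha_1$: a choice rule $\{P(\vec X)\}\leftarrow \vec T(\vec X)$ for each predicate $P:\vec T$ of $V$ (the $P_F$ included) that $S$ does not interpret; - $\alpha_2$: all facts of $S$, types being treated as unary predicates; - $\alpha_3$: for each $\varphi\in Th'\cup Eq$, a rule $\delta_\varphi\leftarrow\alpha_3(\varphi)$ and the constraint $\leftarrow not\ \delta_\varphi$. Here $\alpha_3(\varphi)$ is a conjunction of body elements: literals and comparisons are translated as themselves with the type atoms of their arguments, conjunctions as conjunctions, $\exists x[T]:\varphi$ as $\alpha_3(\varphi),T(x)$, a disjunction as a fresh atom $\delta$ with one rule per disjunct, $\#\{\vec x[\vec T]:\varphi\}\bowtie z$ as $\#count\{\vec x:\delta(\vec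 x,\vec y),\vec T(\vec x)\}\bowtie z$ with type atoms, where a fresh $\delta$ is defined by the rule $\delta(\vec x,\vec y)\leftarrow\alpha_3(\varphi)$ with type atoms, and $\forall x[T]:\varphi$ as $\#\{x[T]:\varphi\}=|T^S|$; - $\alpha_4$: for each rule $P_\Delta(\vec x)\leftarrow\varphi$ of $\Delta'$, the rule $P_\Delta(\vec x)\leftarrow\alpha_3(\varphi),\vec T(\vec x)$; together with all rules for the auxiliary predicates $\delta$. An answer set is a set $I$ of ground atoms that is a minimal model of the reduct of the program with respect to $I$. (In the reduct, negated atoms are decided by $I$; $\{H\}\leftarrow B$ becomes $H\leftarrow B$ if $H\in I$ and disappears otherwise; rule instances with an aggregate that is false in $I$ are deleted, other aggregates stay.) Theorem. Let $M=MX(V,S,Th)$ be a model expansion problem whose theory $Th$ consists of a set of sentences and a single, valid definition $\Delta$. Then the solutions of $M$ coincide with the answer sets of $\alpha(M)$, in the following sense. Map a $V$-structure $S'$ to the set $f(S')$ of all atoms $P(\vec d)$ with $\vec d\in P^{S'}$, for all types, predicates and graphs of functions. Then $f$ is injective, and deleting the atoms of the auxiliary predicates $\delta$ and $P_\Delta$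 is a bijection from the answer sets of $\alpha(M)$ onto $\{f(S') : S' \text{ a solution of } M\}$. -/

import Mathlib

universe u

/-! ### Domain elements, comparisons, vocabularies -/

/-- Domain elements (identified with the ground terms that name them): the integers and a linearly
ordered set `C` of symbolic constants.  As usual in answer set programming, integers precede
symbolic constants. -/
abbrev Elem (C : Type) := Lex (ℤ ⊕ C)

/-- The domain element that is the integer `k`. -/
def Elem.int {C : Type} (k : ℤ) : Elem C := toLex (Sum.inl k)

/-- The comparison symbols `=, ≠, ≤, ≥, <, >`. -/
inductive CmpOp
  | eq | ne | le | ge | lt | gt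
  deriving DecidableEq

def CmpOp.holds {D : Type*} [LinearOrder D] : CmpOp → D → D → Prop
  | .eq, a, b => a = b
  | .ne, a, b => a ≠ b
  | .le, a, b => a ≤ b
  | .ge, a, b => b ≤ a
  | .lt, a, b => a < b
  | .gt, a, b => b < a

/-- The complementary comparison. -/
def CmpOp.neg : CmpOp → CmpOp
  | .eq => .ne
  | .ne => .eq
  | .le => .gt
  | .ge => .lt
  | .lt => .ge
  | .gt => .le

/-- `op` itself for a positive occurrence, its complement for a negated one. -/
def CmpOp.signed (op : CmpOp) (b : Bool) : CmpOp := if b then op else op.neg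

/-- A typed vocabulary together with the interpretation of its types.  (In a model expansion
problem the types are always interpreted by the given structure.)  Types have finite, pairwise
disjoint interpretations; the domain is their union. -/
structure Vocabulary (C : Type) where
  Ty : Type u
  Pred : Type u
  Func : Type u
  predTy : Pred → List Ty
  funcArgs : Func → List Ty
  funcRes : Func → Ty
  dom : Ty → Finset (Elem C)
  disjoint_dom : ∀ T T' : Ty, T ≠ T' → Disjoint (dom T) (dom T')

section FO

variable {C : Type}

/-- `l` belongs to the product of the interpretations of the types `Ts`. -/
def Vocabulary.Typed (V : Vocabulary.{u} C) (Ts : List V.Ty) (l : List (Elem C)) : Prop :=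
  List.Forall₂ (fun d T => d ∈ V.dom T) l Ts

/-- The tuples of type `Ts`. -/
def Vocabulary.Tuple (V : Vocabulary.{u} C) (Ts : List V.Ty) : Type :=
  {l : List (Elem C) // V.Typed Ts l}

/-! ### Terms and formulas

A context `Γ` lists the types of the free variables (innermost binder first); variables are
positions in the context.  The syntax is intrinsically well typed: an integer is a term of type `T`
only if it belongs to the interpretation of `T`, and a cardinality expression is a term of type `T`
only if all its possible values do.  Equations `F(t⃗) = u`, which the normal form keeps, have their
own constructor.  A comparison may also have an integer or a cardinality
expression as a side without reference to a type of the vocabulary.  (A comparison with such a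
side on the other hand is written with the converse comparison symbol.) -/

mutual
/-- Terms of type `T` with free variables in `Γ`. -/
inductive Term (V : Vocabulary.{u} C) : List V.Ty → V.Ty → Type u
  | var {Γ : List V.Ty} {T : V.Ty} (i : ℕ) (h : Γ[i]? = some T) : Term V Γ T
  | int {Γ : List V.Ty} {T : V.Ty} (k : ℤ) (h : Elem.int k ∈ V.dom T) : Term V Γ T
  | app {Γ : List V.Ty} (F : V.Func)
      (args : ∀ i : Fin (V.funcArgs F).length, Term V Γ ((V.funcArgs F).get i)) :
      Term V Γ (V.funcRes F)
  | card {Γ : List V.Ty} {T : V.Ty} (Ts : List V.Ty) (φ : Formula V (Ts ++ Γ))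
      (h : ∀ k : ℕ, k ≤ (Ts.map (fun T' => (V.dom T').card)).prod →
        Elem.int (k : ℤ) ∈ V.dom T) : Term V Γ T

/-- Formulas with free variables in `Γ`. -/
inductive Formula (V : Vocabulary.{u} C) : List V.Ty → Type u
  | pred {Γ : List V.Ty} (P : V.Pred)
      (args : ∀ i : Fin (V.predTy P).length, Term V Γ ((V.predTy P).get i)) : Formula V Γ
  | funEq {Γ : List V.Ty} (F : V.Func)
      (args : ∀ i : Fin (V.funcArgs F).length, Term V Γ ((V.funcArgs F).get i))
      (u : Term V Γ (V.funcRes F)) : Formula V Γ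
  | cmp {Γ : List V.Ty} {T T' : V.Ty} (t : Term V Γ T) (op : CmpOp) (u : Term V Γ T') :
      Formula V Γ
  | cmpInt {Γ : List V.Ty} {T : V.Ty} (t : Term V Γ T) (op : CmpOp) (k : ℤ) : Formula V Γ
  | intInt {Γ : List V.Ty} (k : ℤ) (op : CmpOp) (k' : ℤ) : Formula V Γ
  | count {Γ : List V.Ty} {T : V.Ty} (Ts : List V.Ty) (φ : Formula V (Ts ++ Γ)) (op : CmpOp)
      (u : Term V Γ T) : Formula V Γ
  | countInt {Γ : List V.Ty} (Ts : List V.Ty) (φ : Formula V (Ts ++ Γ)) (op : CmpOp) (k : ℤ) :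
      Formula V Γ
  | not {Γ : List V.Ty} (φ : Formula V Γ) : Formula V Γ
  | and {Γ : List V.Ty} (φ ψ : Formula V Γ) : Formula V Γ
  | or {Γ : List V.Ty} (φ ψ : Formula V Γ) : Formula V Γ
  | imp {Γ : List V.Ty} (φ ψ : Formula V Γ) : Formula V Γ
  | iff {Γ : List V.Ty} (φ ψ : Formula V Γ) : Formula V Γ
  | ex {Γ : List V.Ty} (T : V.Ty) (φ : Formula V (T :: Γ)) : Formula V Γ
  | all {Γ : List V.Ty} (T : V.Ty) (φ : Formula V (T :: Γ)) : Formula V Γ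
end

/-! ### Structures and satisfaction of formulas -/

/-- Structures for the vocabulary (the types are already interpreted). -/
@[ext]
structure Struc (V : Vocabulary.{u} C) where
  pred : ∀ P : V.Pred, Set (V.Tuple (V.predTy P))
  func : ∀ F : V.Func, V.Tuple (V.funcArgs F) → {d : Elem C // d ∈ V.dom (V.funcRes F)}

/-- `l` is in the relation interpreting `P`. -/
def Struc.Rel {V : Vocabulary.{u} C} (S : Struc V) (P : V.Pred) (l : List (Elem C)) : Prop :=
  ∃ h : V.Typed (V.predTy P) l, (⟨l, h⟩ : V.Tuple (V.predTy P)) ∈ S.pred P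

open Classical in
/-- The value of a function; well-typed terms only ever apply it to tuples in its domain. -/
noncomputable def Struc.app {V : Vocabulary.{u} C} (S : Struc V) (F : V.Func)
    (l : List (Elem C)) : Elem C :=
  if h : V.Typed (V.funcArgs F) l then (S.func F ⟨l, h⟩ : Elem C) else Elem.int 0

variable [LinearOrder C]

mutual
/-- The value of a term; `ρ` lists the values of the free variables. -/
noncomputable def Term.val {V : Vocabulary.{u} C} (S : Struc V) :
    {Γ : List V.Ty} → {T : V.Ty} → Term V Γ T → List (Elem C) → Elem C
  | _, _, .var i _, ρ => ρ.getD i (Elem.int 0)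
  | _, _, .int k _, _ => Elem.int k
  | _, _, .app F args, ρ => S.app F (List.ofFn fun i => (args i).val S ρ)
  | _, _, .card Ts φ _, ρ =>
      Elem.int (({l : List (Elem C) | V.Typed Ts l ∧ φ.sat S (l ++ ρ)}.ncard : ℕ) : ℤ)

/-- Satisfaction of a formula. -/
noncomputable def Formula.sat {V : Vocabulary.{u} C} (S : Struc V) :
    {Γ : List V.Ty} → Formula V Γ → List (Elem C) → Prop
  | _, .pred P args, ρ => S.Rel P (List.ofFn fun i => (args i).val S ρ)
  | _, .funEq F args u, ρ => S.app F (List.ofFn fun i => (args i).val S ρ) = u.val S ρ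
  | _, .cmp t op u, ρ => op.holds (t.val S ρ) (u.val S ρ)
  | _, .cmpInt t op k, ρ => op.holds (t.val S ρ) (Elem.int k)
  | _, .intInt k op k', _ => op.holds (Elem.int k : Elem C) (Elem.int k')
  | _, .count Ts φ op u, ρ =>
      op.holds
        (Elem.int (({l : List (Elem C) | V.Typed Ts l ∧ φ.sat S (l ++ ρ)}.ncard : ℕ) : ℤ))
        (u.val S ρ)
  | _, .countInt Ts φ op k, ρ =>
      op.holds
        (Elem.int (({l : List (Elem C) | V.Typed Ts l ∧ φ.sat S (l ++ ρ)}.ncard : ℕ) : ℤ) : Elem C)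
        (Elem.int k)
  | _, .not φ, ρ => ¬ φ.sat S ρ
  | _, .and φ ψ, ρ => φ.sat S ρ ∧ ψ.sat S ρ
  | _, .or φ ψ, ρ => φ.sat S ρ ∨ ψ.sat S ρ
  | _, .imp φ ψ, ρ => φ.sat S ρ → ψ.sat S ρ
  | _, .iff φ ψ, ρ => (φ.sat S ρ ↔ ψ.sat S ρ)
  | _, .ex T φ, ρ => ∃ d ∈ V.dom T, φ.sat S (d :: ρ)
  | _, .all T φ, ρ => ∀ d ∈ V.dom T, φ.sat S (d :: ρ)
end


/-! ### Normal form

Negation normal form without function symbols: a function symbol `F` has become a predicate `P_F`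
(`NF.fn`), cardinality expressions are compared with simple terms only, and negation is applied to
predicate atoms only. -/

/-- Simple terms: variables and integers, at a type of the vocabulary (`some T`), or integers
that stand on their own in a comparison (`none`). -/
inductive Simple (V : Vocabulary.{u} C) (Γ : List V.Ty) : Option V.Ty → Type u
  | var {T : V.Ty} (i : ℕ) (h : Γ[i]? = some T) : Simple V Γ (some T)
  | int {T : V.Ty} (k : ℤ) (h : Elem.int k ∈ V.dom T) : Simple V Γ (some T)
  | num (k : ℤ) : Simple V Γ none

/-- Normalized formulas.  In `lit b r P args` and `fn b F args y` the literal is positive iff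
`b = true`; `r = true` marks the fresh copy `P_Δ` of the predicate `P`. -/
inductive NF (V : Vocabulary.{u} C) : List V.Ty → Type u
  | lit {Γ : List V.Ty} (b r : Bool) (P : V.Pred)
      (args : ∀ i : Fin (V.predTy P).length, Simple V Γ (some ((V.predTy P).get i))) : NF V Γ
  | fn {Γ : List V.Ty} (b : Bool) (F : V.Func)
      (args : ∀ i : Fin (V.funcArgs F).length, Simple V Γ (some ((V.funcArgs F).get i)))
      (y : Simple V Γ (some (V.funcRes F))) : NF V Γ
  | cmp {Γ : List V.Ty} {s s' : Option V.Ty} (x : Simple V Γ s) (op : CmpOp) (y : Simple V Γ s') :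
      NF V Γ
  | count {Γ : List V.Ty} {s : Option V.Ty} (Ts : List V.Ty) (φ : NF V (Ts ++ Γ)) (op : CmpOp)
      (z : Simple V Γ s) : NF V Γ
  | and {Γ : List V.Ty} (φ ψ : NF V Γ) : NF V Γ
  | or {Γ : List V.Ty} (φ ψ : NF V Γ) : NF V Γ
  | ex {Γ : List V.Ty} (T : V.Ty) (φ : NF V (T :: Γ)) : NF V Γ
  | all {Γ : List V.Ty} (T : V.Ty) (φ : NF V (T :: Γ)) : NF V Γ

/-! ### Normalization -/

/-- Type preserving renamings of variables. -/
def Ren {V : Vocabulary.{u} C} (Γ Γ' : List V.Ty) : Type :=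
  {f : ℕ → ℕ // ∀ (i : ℕ) (T : V.Ty), Γ[i]? = some T → Γ'[f i]? = some T}

def Ren.id {V : Vocabulary.{u} C} (Γ : List V.Ty) : Ren (V := V) Γ Γ := ⟨fun i => i, fun _ _ h => h⟩

def Ren.comp {V : Vocabulary.{u} C} {Γ Γ' Γ'' : List V.Ty} (σ : Ren (V := V) Γ' Γ'')
    (ρ : Ren (V := V) Γ Γ') : Ren (V := V) Γ Γ'' :=
  ⟨fun i => σ.1 (ρ.1 i), fun i T h => σ.2 _ T (ρ.2 i T h)⟩

/-- Weakening by one new innermost variable. -/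
def Ren.shift {V : Vocabulary.{u} C} (T : V.Ty) (Γ : List V.Ty) : Ren (V := V) Γ (T :: Γ) :=
  ⟨fun i => i + 1, fun i T' h => by simpa using h⟩

/-- Extension of a renaming under a block of binders. -/
def Ren.lift {V : Vocabulary.{u} C} {Γ Γ' : List V.Ty} (Ts : List V.Ty) (ρ : Ren (V := V) Γ Γ') :
    Ren (V := V) (Ts ++ Γ) (Ts ++ Γ') :=
  ⟨fun i => if i < Ts.length then i else Ts.length + ρ.1 (i - Ts.length), fun i T h => by
    by_cases hi : i < Ts.length
    · simp only [hi, if_true]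
      rw [List.getElem?_append_left hi] at h ⊢
      exact h
    · simp only [hi, if_false]
      rw [List.getElem?_append_right (by omega)] at h
      rw [List.getElem?_append_right (by omega)]
      simpa using ρ.2 _ T h⟩

def Simple.ren {V : Vocabulary.{u} C} {Γ Γ' : List V.Ty} (ρ : Ren (V := V) Γ Γ') :
    {s : Option V.Ty} → Simple V Γ s → Simple V Γ' s
  | _, .var i h => .var (ρ.1 i) (ρ.2 i _ h)
  | _, .int k h => .int k h
  | _, .num k => .num k

/-- What is done with a term in context `Γ` once it has been replaced by a simple term: given a
simple term in an extended context, build a formula in that context. -/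
def FlatCont (V : Vocabulary.{u} C) (Γ : List V.Ty) (T : V.Ty) : Type u :=
  ∀ Γ' : List V.Ty, Ren (V := V) Γ Γ' → Simple V Γ' (some T) → NF V Γ'

/-- Replace the terms of a tuple by simple terms, one after the other. -/
def flatTuple {V : Vocabulary.{u} C} {Γ : List V.Ty} :
    (n : ℕ) → (τ : Fin n → V.Ty) →
    (∀ i : Fin n, ∀ Γ₁ : List V.Ty, Ren (V := V) Γ Γ₁ → FlatCont V Γ₁ (τ i) → NF V Γ₁) →
    (Γ₁ : List V.Ty) → Ren (V := V) Γ Γ₁ →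
    (∀ Γ₂ : List V.Ty, Ren (V := V) Γ₁ Γ₂ → (∀ i : Fin n, Simple V Γ₂ (some (τ i))) → NF V Γ₂) →
    NF V Γ₁
  | 0, _, _, Γ₁, _, k => k Γ₁ (Ren.id Γ₁) (fun i => i.elim0)
  | n + 1, τ, fl, Γ₁, ρ, k =>
      fl 0 Γ₁ ρ fun Γ₂ σ a =>
        flatTuple n (fun i => τ i.succ) (fun i => fl i.succ) Γ₂ (σ.comp ρ) fun Γ₃ σ' as =>
          k Γ₃ (σ'.comp σ) (Fin.cons (a.ren σ') as)

/-- The variable just bound. -/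
def Simple.top {V : Vocabulary.{u} C} (T : V.Ty) (Γ : List V.Ty) : Simple V (T :: Γ) (some T) :=
  .var 0 rfl

mutual
/-- Replacement of a (sub)term `t` of a (negated) atom `A`: simple terms stay; otherwise `A` becomes
`∀ x : t = x ⇒ A[t/x]`, where `t = x` is written in normal form. -/
def Term.flat {V : Vocabulary.{u} C} :
    {Γ : List V.Ty} → {T : V.Ty} → Term V Γ T →
    (Γ' : List V.Ty) → Ren (V := V) Γ Γ' → FlatCont V Γ' T → NF V Γ'
  | _, _, .var i h, Γ', ρ, k => k Γ' (Ren.id Γ') (.var (ρ.1 i) (ρ.2 i _ h))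
  | _, _, .int n h, Γ', _, k => k Γ' (Ren.id Γ') (.int n h)
  | _, _, .app F args, Γ', ρ, k =>
      flatTuple _ _ (fun i => (args i).flat) Γ' ρ fun Γ₂ σ as =>
        .all (V.funcRes F) (.or
          (.fn false F (fun i => (as i).ren (Ren.shift _ Γ₂)) (Simple.top _ Γ₂))
          (k _ ((Ren.shift _ Γ₂).comp σ) (Simple.top _ Γ₂)))
  | _, T, .card Ts φ _, Γ', ρ, k =>
      .all T (.or
        (.count Ts (φ.norm true _ (((Ren.shift T Γ').comp ρ).lift Ts)) .ne (Simple.top T Γ'))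
        (k _ (Ren.shift T Γ') (Simple.top T Γ')))

/-- The normal form of a formula (`b = true`) or of its negation (`b = false`). -/
def Formula.norm {V : Vocabulary.{u} C} :
    {Γ : List V.Ty} → Formula V Γ → Bool → (Γ' : List V.Ty) → Ren (V := V) Γ Γ' → NF V Γ'
  | _, .pred P args, b, Γ', ρ =>
      flatTuple _ _ (fun i => (args i).flat) Γ' ρ fun _ _ as => .lit b false P as
  | _, .funEq F args u, b, Γ', ρ =>
      flatTuple _ _ (fun i => (args i).flat) Γ' ρ fun Γ₁ σ as =>
        u.flat Γ₁ (σ.comp ρ) fun _ σ' y => .fn b F (fun i => (as i).ren σ') y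
  | _, .cmp t op u, b, Γ', ρ =>
      t.flat Γ' ρ fun Γ₁ σ x =>
        u.flat Γ₁ (σ.comp ρ) fun _ σ' y => .cmp (x.ren σ') (op.signed b) y
  | _, .cmpInt t op k, b, Γ', ρ =>
      t.flat Γ' ρ fun _ _ x => .cmp x (op.signed b) (.num k)
  | _, .intInt k op k', b, _, _ => .cmp (.num k) (op.signed b) (.num k')
  | _, .count Ts φ op u, b, Γ', ρ =>
      u.flat Γ' ρ fun _ σ z =>
        .count Ts (φ.norm true _ ((σ.comp ρ).lift Ts)) (op.signed b) z
  | _, .countInt Ts φ op k, b, _, ρ =>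
      .count Ts (φ.norm true _ (ρ.lift Ts)) (op.signed b) (.num k)
  | _, .not φ, b, Γ', ρ => φ.norm (!b) Γ' ρ
  | _, .and φ ψ, true, Γ', ρ => .and (φ.norm true Γ' ρ) (ψ.norm true Γ' ρ)
  | _, .and φ ψ, false, Γ', ρ => .or (φ.norm false Γ' ρ) (ψ.norm false Γ' ρ)
  | _, .or φ ψ, true, Γ', ρ => .or (φ.norm true Γ' ρ) (ψ.norm true Γ' ρ)
  | _, .or φ ψ, false, Γ', ρ => .and (φ.norm false Γ' ρ) (ψ.norm false Γ' ρ)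
  | _, .imp φ ψ, true, Γ', ρ => .or (φ.norm false Γ' ρ) (ψ.norm true Γ' ρ)
  | _, .imp φ ψ, false, Γ', ρ => .and (φ.norm true Γ' ρ) (ψ.norm false Γ' ρ)
  | _, .iff φ ψ, true, Γ', ρ =>
      .and (.or (φ.norm false Γ' ρ) (ψ.norm true Γ' ρ))
        (.or (φ.norm true Γ' ρ) (ψ.norm false Γ' ρ))
  | _, .iff φ ψ, false, Γ', ρ =>
      .and (.or (φ.norm true Γ' ρ) (ψ.norm true Γ' ρ))
        (.or (φ.norm false Γ' ρ) (ψ.norm false Γ' ρ))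
  | _, .ex T φ, true, Γ', ρ => .ex T (φ.norm true (T :: Γ') (ρ.lift [T]))
  | _, .ex T φ, false, Γ', ρ => .all T (φ.norm false (T :: Γ') (ρ.lift [T]))
  | _, .all T φ, true, Γ', ρ => .all T (φ.norm true (T :: Γ') (ρ.lift [T]))
  | _, .all T φ, false, Γ', ρ => .ex T (φ.norm false (T :: Γ') (ρ.lift [T]))
end

/-- The normal form of a formula. -/
def Formula.normalize {V : Vocabulary.{u} C} {Γ : List V.Ty} (φ : Formula V Γ) : NF V Γ :=
  φ.norm true Γ (Ren.id Γ)

/-! ### Ground facts and well-founded semantics of definitions -/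

/-- The predicate symbols of normalized formulas: predicates `P`, their fresh copies `P_Δ`, and
the predicates `P_F` of the function symbols. -/
inductive RelSym (V : Vocabulary.{u} C) : Type u
  | pred (P : V.Pred)
  | copy (P : V.Pred)
  | graph (F : V.Func)

/-- The predicate symbol of a literal: `P_Δ` if marked, `P` otherwise. -/
def RelSym.of {V : Vocabulary.{u} C} (r : Bool) (P : V.Pred) : RelSym V :=
  if r then .copy P else .pred P

/-- Ground atoms over the predicate symbols of normalized formulas. -/
abbrev GFact (V : Vocabulary.{u} C) := RelSym V × List (Elem C)

/-- The facts true in a structure, with functions represented by their graphs. -/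
def Struc.facts {V : Vocabulary.{u} C} (S : Struc V) : Set (GFact V) :=
  {x | (∃ (P : V.Pred) (l : V.Tuple (V.predTy P)), l ∈ S.pred P ∧ x = (.pred P, l.1)) ∨
    (∃ (F : V.Func) (l : V.Tuple (V.funcArgs F)), x = (.graph F, l.1 ++ [(S.func F l).1]))}

/-- Value of a simple term. -/
def Simple.val {V : Vocabulary.{u} C} {Γ : List V.Ty} (ρ : List (Elem C)) :
    {s : Option V.Ty} → Simple V Γ s → Elem C
  | _, .var i _ => ρ.getD i (Elem.int 0)
  | _, .int k _ => Elem.int k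
  | _, .num k => Elem.int k

/-- Three-valued interpretations: the facts that are (already known to be) true and false. -/
@[ext]
structure Approx (V : Vocabulary.{u} C) where
  tr : Set (GFact V)
  fa : Set (GFact V)

/-- What is asked about a formula in a three-valued interpretation: is it certain (true), or is it
possible (not false) even if the facts in `U` are not available to support it? -/
inductive Mode (V : Vocabulary.{u} C)
  | certain
  | possible (U : Set (GFact V))

/-- Truth of a literal.  As in the well-founded semantics of normal programs, an unfounded set `U`
blocks positive literals; negative literals are evaluated in the interpretation itself. -/
def Approx.lit {V : Vocabulary.{u} C} (I : Approx V) : Mode V → Bool → GFact V → Prop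
  | .certain, true, x => x ∈ I.tr
  | .certain, false, x => x ∈ I.fa
  | .possible U, true, x => x ∉ I.fa ∧ x ∉ U
  | .possible _, false, x => x ∉ I.tr

/-- Kleene evaluation of normalized formulas.  The possible cardinalities of a set range from the
number of certain elements to the number of possible elements; a comparison is certain if it holds
for all of them and possible if it holds for one of them. -/
def NF.ev {V : Vocabulary.{u} C} (I : Approx V) :
    {Γ : List V.Ty} → NF V Γ → Mode V → List (Elem C) → Prop
  | _, .lit b r P args, m, ρ => I.lit m b (.of r P, List.ofFn fun i => (args i).val ρ)
  | _, .fn b F args y, m, ρ =>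
      I.lit m b (.graph F, (List.ofFn fun i => (args i).val ρ) ++ [y.val ρ])
  | _, .cmp x op y, _, ρ => op.holds (x.val ρ) (y.val ρ)
  | _, .count Ts φ op z, .certain, ρ =>
      ∀ k : ℕ, {l : List (Elem C) | V.Typed Ts l ∧ φ.ev I .certain (l ++ ρ)}.ncard ≤ k →
        k ≤ {l : List (Elem C) | V.Typed Ts l ∧ φ.ev I (.possible ∅) (l ++ ρ)}.ncard →
        op.holds (Elem.int (k : ℤ)) (z.val ρ)
  | _, .count Ts φ op z, .possible U, ρ =>
      ∃ k : ℕ, {l : List (Elem C) | V.Typed Ts l ∧ φ.ev I .certain (l ++ ρ)}.ncard ≤ k ∧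
        k ≤ {l : List (Elem C) | V.Typed Ts l ∧ φ.ev I (.possible U) (l ++ ρ)}.ncard ∧
        op.holds (Elem.int (k : ℤ)) (z.val ρ)
  | _, .and φ ψ, m, ρ => φ.ev I m ρ ∧ ψ.ev I m ρ
  | _, .or φ ψ, m, ρ => φ.ev I m ρ ∨ ψ.ev I m ρ
  | _, .ex T φ, m, ρ => ∃ d ∈ V.dom T, φ.ev I m (d :: ρ)
  | _, .all T φ, m, ρ => ∀ d ∈ V.dom T, φ.ev I m (d :: ρ)

/-- A rule `∀ x₁[T₁] … xₙ[Tₙ] : P(x₁,…,xₙ) ← φ`. -/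
structure DefRule (V : Vocabulary.{u} C) where
  head : V.Pred
  body : Formula V (V.predTy head)

/-- A definition is a (finite) set of rules. -/
abbrev Defn (V : Vocabulary.{u} C) := List (DefRule V)

/-- The defined predicates. -/
def Defn.Defines {V : Vocabulary.{u} C} (Δ : Defn V) (P : V.Pred) : Prop :=
  ∃ r ∈ Δ, r.head = P

/-- Facts about defined predicates. -/
def Defn.definedFacts {V : Vocabulary.{u} C} (Δ : Defn V) : Set (GFact V) :=
  {x | ∃ P, Δ.Defines P ∧ x.1 = .pred P}

/-- The initial interpretation: open symbols as in `S`, defined facts unknown. -/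
def Defn.start {V : Vocabulary.{u} C} (Δ : Defn V) (S : Struc V) : Approx V where
  tr := {x | x ∉ Δ.definedFacts ∧ x ∈ S.facts}
  fa := {x | x ∉ Δ.definedFacts ∧ x ∉ S.facts}

/-- Immediate consequences: heads of rule instances whose body is certain. -/
def Defn.consequences {V : Vocabulary.{u} C} (Δ : Defn V) (I : Approx V) : Set (GFact V) :=
  {x | ∃ r ∈ Δ, ∃ l, V.Typed (V.predTy r.head) l ∧ x = (.pred r.head, l) ∧
    r.body.normalize.ev I .certain l}

/-- Unfounded sets: sets of defined facts, none of them true, such that no rule instance for one of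
them has a possible body without support from the set itself. -/
def Defn.Unfounded {V : Vocabulary.{u} C} (Δ : Defn V) (I : Approx V) (U : Set (GFact V)) : Prop :=
  ∀ x ∈ U, x ∈ Δ.definedFacts ∧ x ∉ I.tr ∧
    ∀ r ∈ Δ, ∀ l, V.Typed (V.predTy r.head) l → x = (.pred r.head, l) →
      ¬ r.body.normalize.ev I (.possible U) l

/-- One step of the well-founded iteration: add the immediate consequences as true and the greatest
unfounded set as false. -/
def Defn.step {V : Vocabulary.{u} C} (Δ : Defn V) (I : Approx V) : Approx V where
  tr := I.tr ∪ Δ.consequences I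
  fa := I.fa ∪ ⋃₀ {U | Δ.Unfounded I U}

/-- The well-founded model given the open symbols of `S`: the limit of the iteration (there are only
finitely many well-typed defined facts, so it is reached after finitely many steps). -/
def Defn.wfm {V : Vocabulary.{u} C} (Δ : Defn V) (S : Struc V) : Approx V where
  tr := ⋃ n : ℕ, (Δ.step^[n] (Δ.start S)).tr
  fa := ⋃ n : ℕ, (Δ.step^[n] (Δ.start S)).fa

/-- A definition is valid if its well-founded model is two-valued, no matter what the interpretation
of the open symbols. -/
def Defn.Valid {V : Vocabulary.{u} C} (Δ : Defn V) : Prop :=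
  ∀ S : Struc V, ∀ x : GFact V, x ∈ (Δ.wfm S).tr ∨ x ∈ (Δ.wfm S).fa

/-- `S ⊨ Δ`: the structure is the (two-valued) well-founded model given its open symbols. -/
def Defn.sat {V : Vocabulary.{u} C} (Δ : Defn V) (S : Struc V) : Prop :=
  (Δ.wfm S).tr = S.facts ∧ (Δ.wfm S).fa = S.factsᶜ

/-! ### Model expansion problems -/

/-- A model expansion problem whose theory contains a single definition: a vocabulary, a structure
for a subvocabulary (`none` for the symbols that are not interpreted), a set of sentences and a
definition. -/
structure Problem (C : Type) [LinearOrder C] where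
  voc : Vocabulary.{u} C
  predI : ∀ P : voc.Pred, Option (Set (voc.Tuple (voc.predTy P)))
  funcI : ∀ F : voc.Func,
    Option (voc.Tuple (voc.funcArgs F) → {d : Elem C // d ∈ voc.dom (voc.funcRes F)})
  sentences : Set (Formula voc [])
  defn : Defn voc

/-- `S'` expands the given structure. -/
def Problem.Expands (M : Problem.{u} C) (S' : Struc M.voc) : Prop :=
  (∀ P X, M.predI P = some X → S'.pred P = X) ∧ (∀ F f, M.funcI F = some f → S'.func F = f)

/-- The solutions: the expansions of the given structure that satisfy the theory. -/
def Problem.solutions (M : Problem.{u} C) : Set (Struc M.voc) :=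
  {S' | M.Expands S' ∧ (∀ φ ∈ M.sentences, φ.sat S' []) ∧ M.defn.sat S'}

/-! ### Answer set programs -/

/-- Terms over variables `X`. -/
inductive ATerm (C : Type) (X : Type)
  | var (x : X)
  | const (d : Elem C)

def ATerm.ground {X : Type} (θ : X → Elem C) : ATerm C X → Elem C
  | .var x => θ x
  | .const d => d

/-- Atoms over predicate symbols `Q` and variables `X`. -/
structure AAtom (C : Type) (Q : Type u) (X : Type) where
  sym : Q
  args : List (ATerm C X)

/-- Ground atoms. -/
abbrev GAtom (C : Type) (Q : Type u) := Q × List (Elem C)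

def AAtom.ground {Q : Type u} {X : Type} (θ : X → Elem C) (a : AAtom C Q X) : GAtom C Q :=
  (a.sym, a.args.map (ATerm.ground θ))

/-- Body elements: atoms, negated atoms, comparisons, and cardinality aggregates
`#count{x₁,…,xₘ : L₁,…,Lₖ} op t` with local variables `x₁,…,xₘ`; in the list of conditions `Lᵢ`,
`true` marks a positive and `false` a negated atom. -/
inductive ALit (C : Type) (Q : Type u) (X : Type) : Type u
  | pos (a : AAtom C Q X)
  | naf (a : AAtom C Q X)
  | cmp (s : ATerm C X) (op : CmpOp) (t : ATerm C X)
  | count (m : ℕ) (conds : List (Bool × AAtom C Q (X ⊕ Fin m))) (op : CmpOp) (t : ATerm C X)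

/-- Rule heads: empty (constraint), an atom, or a choice `{H}`. -/
inductive AHead (C : Type) (Q : Type u) (X : Type) : Type u
  | none
  | atom (a : AAtom C Q X)
  | choice (a : AAtom C Q X)

/-- A rule, with its own set of variables. -/
structure ARule (C : Type) (Q : Type u) : Type (max u 1) where
  Var : Type
  head : AHead C Q Var
  body : List (ALit C Q Var)

/-- Truth of the ground instance of a body element in a set of ground atoms. -/
def ALit.holds {Q : Type u} {X : Type} (I : Set (GAtom C Q)) (θ : X → Elem C) :
    ALit C Q X → Prop
  | .pos a => a.ground θ ∈ I
  | .naf a => a.ground θ ∉ I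
  | .cmp s op t => op.holds (s.ground θ) (t.ground θ)
  | .count m conds op t =>
      {d : Fin m → Elem C | ∀ c ∈ conds,
        (c.1 = true ↔ c.2.ground (Sum.elim θ d) ∈ I)}.Finite ∧
      op.holds (Elem.int (({d : Fin m → Elem C | ∀ c ∈ conds,
        (c.1 = true ↔ c.2.ground (Sum.elim θ d) ∈ I)}.ncard : ℕ) : ℤ)) (t.ground θ)

/-- Truth in `J` of what the reduct w.r.t. `I` leaves of a body element: a negated atom is decided
by `I`; an aggregate (which deletes the rule if it is false in `I`) has to hold in `J` too. -/
def ALit.holdsReduct {Q : Type u} {X : Type} (I J : Set (GAtom C Q)) (θ : X → Elem C) :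
    ALit C Q X → Prop
  | .pos a => a.ground θ ∈ J
  | .naf a => a.ground θ ∉ I
  | .cmp s op t => op.holds (s.ground θ) (t.ground θ)
  | .count m conds op t =>
      (ALit.count m conds op t).holds I θ ∧ (ALit.count m conds op t).holds J θ

/-- Satisfaction of a head in `J` in the reduct w.r.t. `I`: a choice `{H}` becomes `H` if `H ∈ I`
and imposes nothing otherwise. -/
def AHead.holdsReduct {Q : Type u} {X : Type} (I J : Set (GAtom C Q)) (θ : X → Elem C) :
    AHead C Q X → Prop
  | .none => False
  | .atom a => a.ground θ ∈ J
  | .choice a => a.ground θ ∈ I → a.ground θ ∈ J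

/-- `J` is a model of the reduct of the grounding of `Pg` w.r.t. `I`. -/
def IsReductModel {Q : Type u} (Pg : Set (ARule C Q)) (I J : Set (GAtom C Q)) : Prop :=
  ∀ r ∈ Pg, ∀ θ : r.Var → Elem C,
    (∀ L ∈ r.body, L.holdsReduct I J θ) → r.head.holdsReduct I J θ

/-- The answer sets of a program: the sets of ground atoms that are minimal models of their own
reduct. -/
def answerSets {Q : Type u} (Pg : Set (ARule C Q)) : Set (Set (GAtom C Q)) :=
  {I | IsReductModel Pg I I ∧ ∀ J ⊆ I, IsReductModel Pg I J → J = I}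

/-! ### The translation -/

/-- The predicate symbols of the translation: types (as unary predicates), the predicate symbols of
normalized formulas, and the fresh auxiliary symbols `δ` for disjunctions, for the conditions of
cardinality atoms, and for reified sentences. -/
inductive ASym (V : Vocabulary.{u} C) : Type u
  | ty (T : V.Ty)
  | rel (R : RelSym V)
  | disj {Γ : List V.Ty} (φ ψ : NF V Γ)
  | cond {Γ : List V.Ty} (Ts : List V.Ty) (φ : NF V (Ts ++ Γ))
  | reif (φ : NF V [])

/-- The simple term `t` in an answer set program, where `v` names the variables. -/
def Simple.tr {V : Vocabulary.{u} C} {Γ : List V.Ty} {X : Type} (v : ℕ → X) :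
    {s : Option V.Ty} → Simple V Γ s → ATerm C X
  | _, .var i _ => .var (v i)
  | _, .int k _ => .const (Elem.int k)
  | _, .num k => .const (Elem.int k)

/-- The atom `T(t)`. -/
def tyAtom {V : Vocabulary.{u} C} {X : Type} (T : V.Ty) (t : ATerm C X) : AAtom C (ASym V) X :=
  ⟨.ty T, [t]⟩

/-- The type atom of a typed simple term (none for an integer without a type of the vocabulary). -/
def Simple.guard {V : Vocabulary.{u} C} {Γ : List V.Ty} {X : Type} (v : ℕ → X) :
    {s : Option V.Ty} → Simple V Γ s → List (ALit C (ASym V) X)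
  | some T, t => [.pos (tyAtom T (t.tr v))]
  | none, _ => []

/-- The type atoms of all variables of a context. -/
def guards {V : Vocabulary.{u} C} {X : Type} (v : ℕ → X) (Γ : List V.Ty) :
    List (ALit C (ASym V) X) :=
  Γ.zipIdx.map fun p => .pos (tyAtom p.1 (.var (v p.2)))

/-- The list of all variables of a context. -/
def ctxVars {V : Vocabulary.{u} C} {X : Type} (v : ℕ → X) (Γ : List V.Ty) : List (ATerm C X) :=
  (List.range Γ.length).map fun i => .var (v i)

/-- Extend the naming of variables to one more innermost variable. -/
def consVar {X : Type} (x : X) (v : ℕ → X) : ℕ → X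
  | 0 => x
  | i + 1 => v i

/-- Naming of the variables inside an aggregate: first the `m` local ones, then the others. -/
def localVar {X : Type} (m : ℕ) (v : ℕ → X) (i : ℕ) : X ⊕ Fin m :=
  if h : i < m then .inr ⟨i, h⟩ else .inl (v (i - m))

/-- The variables of the translation of a formula that are implicitly existentially quantified. -/
def NF.ExVar {V : Vocabulary.{u} C} : {Γ : List V.Ty} → NF V Γ → Type
  | _, .and φ ψ => φ.ExVar ⊕ ψ.ExVar
  | _, .ex _ φ => Option φ.ExVar
  | _, .lit _ _ _ _ => Empty
  | _, .fn _ _ _ _ => Empty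
  | _, .cmp _ _ _ => Empty
  | _, .count _ _ _ _ => Empty
  | _, .or _ _ => Empty
  | _, .all _ _ => Empty

/-- The translation of `#{x⃗[Ts] : φ} op z` (with `z` a term and `g` its type atom, if any), where
`φ` is represented by its auxiliary symbol. -/
def countLits {V : Vocabulary.{u} C} {Γ : List V.Ty} {X : Type} (v : ℕ → X) (Ts : List V.Ty)
    (φ : NF V (Ts ++ Γ)) (op : CmpOp) (z : ATerm C X) (g : List (ALit C (ASym V) X)) :
    List (ALit C (ASym V) X) :=
  .count Ts.length
      ((true, ⟨.cond Ts φ, ctxVars (localVar Ts.length v) (Ts ++ Γ)⟩) ::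
        Ts.zipIdx.map fun p => (true, tyAtom p.1 (.var (localVar Ts.length v p.2))))
      op z ::
    (guards v Γ ++ g)

/-- A literal together with the type atoms of its arguments. -/
def litLits {V : Vocabulary.{u} C} {X : Type} (b : Bool) (R : RelSym V) (Ts : List V.Ty)
    (args : List (ATerm C X)) : List (ALit C (ASym V) X) :=
  (if b then .pos ⟨.rel R, args⟩ else .naf ⟨.rel R, args⟩) ::
    (Ts.zip args).map fun p => .pos (tyAtom p.1 p.2)

/-- The translation `α₃(φ)` of a formula to a conjunction; `v` names the free variables and `e` the
implicitly existentially quantified ones. -/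
def NF.conj {V : Vocabulary.{u} C} {X : Type} :
    {Γ : List V.Ty} → (φ : NF V Γ) → (ℕ → X) → (φ.ExVar → X) → List (ALit C (ASym V) X)
  | _, .lit b r P args, v, _ =>
      litLits b (.of r P) (V.predTy P) (List.ofFn fun i => (args i).tr v)
  | _, .fn b F args y, v, _ =>
      litLits b (.graph F) (V.funcArgs F ++ [V.funcRes F])
        ((List.ofFn fun i => (args i).tr v) ++ [y.tr v])
  | _, .cmp x op y, v, _ => .cmp (x.tr v) op (y.tr v) :: (x.guard v ++ y.guard v)
  | _, .count Ts φ op z, v, _ => countLits v Ts φ op (z.tr v) (z.guard v)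
  | _, .and φ ψ, v, e => φ.conj v (fun x => e (.inl x)) ++ ψ.conj v (fun x => e (.inr x))
  | Γ, .or φ ψ, v, _ => [.pos ⟨.disj φ ψ, ctxVars v Γ⟩]
  | _, .ex T φ, v, e =>
      φ.conj (consVar (e none) v) (fun x => e (some x)) ++ [.pos (tyAtom T (.var (e none)))]
  | _, .all T φ, v, _ =>
      countLits v [T] φ .eq (.const (Elem.int ((V.dom T).card : ℤ))) []

/-- The rule `s(x⃗) ← α₃(φ), T⃗(x⃗)`, with `x⃗` all variables of the context. -/
def ruleFor {V : Vocabulary.{u} C} {Γ : List V.Ty} (s : ASym V) (φ : NF V Γ) :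
    ARule C (ASym V) where
  Var := ℕ ⊕ φ.ExVar
  head := .atom ⟨s, ctxVars Sum.inl Γ⟩
  body := φ.conj Sum.inl Sum.inr ++ guards Sum.inl Γ

/-- All additional rules produced by the translation of a formula. -/
def NF.auxRules {V : Vocabulary.{u} C} : {Γ : List V.Ty} → NF V Γ → Set (ARule C (ASym V))
  | _, .lit _ _ _ _ => ∅
  | _, .fn _ _ _ _ => ∅
  | _, .cmp _ _ _ => ∅
  | _, .count Ts φ _ _ => {ruleFor (.cond Ts φ) φ} ∪ φ.auxRules
  | _, .and φ ψ => φ.auxRules ∪ ψ.auxRules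
  | _, .or φ ψ =>
      {ruleFor (.disj φ ψ) φ, ruleFor (.disj φ ψ) ψ} ∪ (φ.auxRules ∪ ψ.auxRules)
  | _, .ex _ φ => φ.auxRules
  | _, .all T φ => {ruleFor (.cond [T] φ) φ} ∪ φ.auxRules

/-- The choice rule `{R(X₁,…,Xₙ)} ← T₁(X₁),…,Tₙ(Xₙ)`. -/
def choiceRule {V : Vocabulary.{u} C} (R : RelSym V) (Ts : List V.Ty) : ARule C (ASym V) where
  Var := ℕ
  head := .choice ⟨.rel R, ctxVars id Ts⟩
  body := guards id Ts

/-- The fact `s(l)`. -/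
def factRule {V : Vocabulary.{u} C} (s : ASym V) (l : List (Elem C)) : ARule C (ASym V) where
  Var := Empty
  head := .atom ⟨s, l.map .const⟩
  body := []

/-- `α₁`: choice rules for the symbols that are not interpreted by the given structure. -/
def Problem.alpha1 (M : Problem.{u} C) : Set (ARule C (ASym M.voc)) :=
  {r | ∃ P, M.predI P = none ∧ r = choiceRule (.pred P) (M.voc.predTy P)} ∪
  {r | ∃ F, M.funcI F = none ∧
    r = choiceRule (.graph F) (M.voc.funcArgs F ++ [M.voc.funcRes F])}

/-- `α₂`: the facts of the given structure. -/
def Problem.alpha2 (M : Problem.{u} C) : Set (ARule C (ASym M.voc)) :=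
  {r | ∃ T, ∃ d ∈ M.voc.dom T, r = factRule (.ty T) [d]} ∪
  {r | ∃ P X, M.predI P = some X ∧ ∃ l ∈ X, r = factRule (.rel (.pred P)) l.1} ∪
  {r | ∃ F f, M.funcI F = some f ∧ ∃ l, r = factRule (.rel (.graph F)) (l.1 ++ [(f l).1])}

/-- `α₃` for a set of normalized sentences: reification rules, additional rules, constraints. -/
def alpha3 {V : Vocabulary.{u} C} (Th : Set (NF V [])) : Set (ARule C (ASym V)) :=
  {r | ∃ φ ∈ Th, r = ruleFor (.reif φ) φ} ∪
  {r | ∃ φ ∈ Th, r ∈ φ.auxRules} ∪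
  {r | ∃ φ ∈ Th, r = ⟨Empty, .none, [.naf ⟨.reif φ, []⟩]⟩}

open Classical in
/-- Replace each predicate that satisfies `D` by its fresh copy. -/
noncomputable def NF.rename {V : Vocabulary.{u} C} (D : V.Pred → Prop) :
    {Γ : List V.Ty} → NF V Γ → NF V Γ
  | _, .lit b r P args => .lit b (r || decide (D P)) P args
  | _, .fn b F args y => .fn b F args y
  | _, .cmp x op y => .cmp x op y
  | _, .count Ts φ op z => .count Ts (φ.rename D) op z
  | _, .and φ ψ => .and (φ.rename D) (ψ.rename D)
  | _, .or φ ψ => .or (φ.rename D) (ψ.rename D)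
  | _, .ex T φ => .ex T (φ.rename D)
  | _, .all T φ => .all T (φ.rename D)

/-- The normalized body of a rule of `Δ'`, the definition with renamed defined predicates. -/
noncomputable def Defn.renamedBody {V : Vocabulary.{u} C} (Δ : Defn V) (r : DefRule V) :
    NF V (V.predTy r.head) :=
  r.body.normalize.rename Δ.Defines

/-- `α₄(Δ')`, with the additional rules produced by the translation of the bodies. -/
def Defn.alpha4 {V : Vocabulary.{u} C} (Δ : Defn V) : Set (ARule C (ASym V)) :=
  {r | ∃ ρ ∈ Δ, r = ruleFor (.rel (.copy ρ.head)) (Δ.renamedBody ρ)} ∪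
  {r | ∃ ρ ∈ Δ, r ∈ (Δ.renamedBody ρ).auxRules}

/-- Universal closure. -/
def NF.close {V : Vocabulary.{u} C} : (Γ : List V.Ty) → NF V Γ → NF V []
  | [], φ => φ
  | T :: Γ, φ => NF.close Γ (.all T φ)

/-- The literal `P(x₁,…,xₙ)` (or of `P_Δ`, or a negated one) in the context of its variables. -/
def NF.predLit {V : Vocabulary.{u} C} (b r : Bool) (P : V.Pred) : NF V (V.predTy P) :=
  .lit b r P fun i => .var i.1 (by simp)

/-- The normal form of `∀ x⃗ : P(x⃗) ⇔ P_Δ(x⃗)`. -/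
def eqSentence {V : Vocabulary.{u} C} (P : V.Pred) : NF V [] :=
  NF.close _ (.and (.or (NF.predLit false false P) (NF.predLit true true P))
    (.or (NF.predLit true false P) (NF.predLit false true P)))

/-- `∀ x₁ … xₙ : #{y : P_F(x₁,…,xₙ,y)} = 1`. -/
def funcSentence {V : Vocabulary.{u} C} (F : V.Func) : NF V [] :=
  NF.close (V.funcArgs F)
    (.count [V.funcRes F] (.fn true F (fun i => .var (i.1 + 1) (by simp)) (Simple.top _ _)) .eq
      (.num 1))

/-- The normalized theory `Th'` without the definition, including the constraints for the function
symbols. -/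
def Problem.normTheory (M : Problem.{u} C) : Set (NF M.voc []) :=
  {φ | ∃ χ ∈ M.sentences, φ = χ.normalize} ∪ {φ | ∃ F, φ = funcSentence F}

/-- The equivalence constraints `Eq`. -/
def Defn.eqTheory {V : Vocabulary.{u} C} (Δ : Defn V) : Set (NF V []) :=
  {φ | ∃ P, Δ.Defines P ∧ φ = eqSentence P}

/-- The translation of a model expansion problem. -/
def Problem.alpha (M : Problem.{u} C) : Set (ARule C (ASym M.voc)) :=
  M.alpha1 ∪ M.alpha2 ∪ alpha3 (M.normTheory ∪ M.defn.eqTheory) ∪ M.defn.alpha4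

/-! ### Structures as sets of ground atoms -/

/-- The set of all atoms `P(d⃗)` with `d⃗` in the interpretation of `P`, for types, predicates and
(the predicates `P_F` of) function symbols. -/
def Struc.atoms {V : Vocabulary.{u} C} (S : Struc V) : Set (GAtom C (ASym V)) :=
  {a | ∃ T, ∃ d ∈ V.dom T, a = (.ty T, [d])} ∪ {a | ∃ x ∈ S.facts, a = (.rel x.1, x.2)}

/-- The atoms over the original vocabulary: neither auxiliary symbols nor copies `P_Δ`. -/
def baseAtoms (V : Vocabulary.{u} C) : Set (GAtom C (ASym V)) :=
  {a | (∃ T, a.1 = .ty T) ∨ (∃ P, a.1 = .rel (.pred P)) ∨ (∃ F, a.1 = .rel (.graph F))}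

end FO

set_option linter.unusedVariables false
set_option linter.unusedSectionVars false

section Truth

variable {C : Type} {V : Vocabulary.{u} C}

/-! ### Tuples of a given type -/

theorem Vocabulary.typed_cons_iff {T : V.Ty} {Ts : List V.Ty} {l : List (Elem C)} :
    V.Typed (T :: Ts) l ↔ ∃ d ∈ V.dom T, ∃ l', V.Typed Ts l' ∧ l = d :: l' := by
  unfold Vocabulary.Typed
  rw [List.forall₂_cons_right_iff]
  grind

theorem Vocabulary.Typed.cons {T : V.Ty} {Ts : List V.Ty} {d : Elem C} {l : List (Elem C)}
    (hd : d ∈ V.dom T) (hl : V.Typed Ts l) : V.Typed (T :: Ts) (d :: l) :=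
  List.Forall₂.cons hd hl

theorem Vocabulary.typed_nil_iff {l : List (Elem C)} : V.Typed [] l ↔ l = [] := by
  simp [Vocabulary.Typed]

theorem Vocabulary.typed_singleton_iff {T : V.Ty} {l : List (Elem C)} :
    V.Typed [T] l ↔ ∃ d ∈ V.dom T, l = [d] := by
  simp [Vocabulary.typed_cons_iff, Vocabulary.typed_nil_iff]

theorem Vocabulary.Typed.append {Ts Γ : List V.Ty} {l ρ : List (Elem C)}
    (hl : V.Typed Ts l) (hρ : V.Typed Γ ρ) : V.Typed (Ts ++ Γ) (l ++ ρ) :=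
  List.rel_append hl hρ

theorem Vocabulary.Typed.length_eq {Ts : List V.Ty} {l : List (Elem C)} (h : V.Typed Ts l) :
    l.length = Ts.length :=
  List.Forall₂.length_eq h

theorem Vocabulary.typed_iff_get {Ts : List V.Ty} {l : List (Elem C)} :
    V.Typed Ts l ↔ l.length = Ts.length ∧
      ∀ (i : ℕ) (T : V.Ty) (d : Elem C), Ts[i]? = some T → l[i]? = some d → d ∈ V.dom T := by
  unfold Vocabulary.Typed
  rw [List.forall₂_iff_get]
  constructor
  · rintro ⟨h, h'⟩
    refine ⟨h, fun i T d hT hd => ?_⟩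
    rw [List.getElem?_eq_some_iff] at hT hd
    obtain ⟨hi, rfl⟩ := hT
    obtain ⟨hi', rfl⟩ := hd
    exact h' i hi' hi
  · rintro ⟨h, h'⟩
    exact ⟨h, fun i hi hi' => h' i _ _ (List.getElem?_eq_getElem hi') (List.getElem?_eq_getElem hi)⟩

theorem Vocabulary.Typed.getD_mem {Γ : List V.Ty} {ρ : List (Elem C)} (h : V.Typed Γ ρ) {i : ℕ}
    {T : V.Ty} (hi : Γ[i]? = some T) : ρ.getD i (Elem.int 0) ∈ V.dom T := by
  rw [Vocabulary.typed_iff_get] at h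
  have hlt : i < ρ.length := by
    rw [h.1]; exact (List.getElem?_eq_some_iff.1 hi).1
  have := h.2 i T _ hi (List.getElem?_eq_getElem hlt)
  simpa [List.getD_eq_getElem?_getD, hlt] using this

theorem Vocabulary.setOf_typed_cons (T : V.Ty) (Ts : List V.Ty) :
    {l | V.Typed (T :: Ts) l} =
      (fun p : Elem C × List (Elem C) => p.1 :: p.2) ''
        ((V.dom T : Set (Elem C)) ×ˢ {l | V.Typed Ts l}) := by
  ext l
  simp only [Set.mem_ofPred_eq, Vocabulary.typed_cons_iff, Set.mem_image, Set.mem_prod, Prod.exists,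
    Finset.mem_coe]
  grind

theorem Vocabulary.finite_typed (Ts : List V.Ty) : {l | V.Typed Ts l}.Finite := by
  induction Ts with
  | nil => simp [Vocabulary.typed_nil_iff]
  | cons T Ts ih =>
    rw [Vocabulary.setOf_typed_cons]
    exact ((V.dom T).finite_toSet.prod ih).image _

theorem Vocabulary.ncard_typed (Ts : List V.Ty) :
    {l | V.Typed Ts l}.ncard = (Ts.map fun T => (V.dom T).card).prod := by
  induction Ts with
  | nil => simp [Vocabulary.typed_nil_iff]
  | cons T Ts ih =>
    rw [Vocabulary.setOf_typed_cons, Set.ncard_image_of_injective, Set.ncard_prod, ih]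
    · simp
    · rintro ⟨a, b⟩ ⟨c, d⟩ h
      simpa using h

theorem Vocabulary.finite_typed_sep (Ts : List V.Ty) (p : List (Elem C) → Prop) :
    {l | V.Typed Ts l ∧ p l}.Finite :=
  (Vocabulary.finite_typed Ts).subset fun _ h => h.1

theorem Vocabulary.ncard_typed_sep_mono (Ts : List V.Ty) {p q : List (Elem C) → Prop}
    (h : ∀ l, V.Typed Ts l → p l → q l) :
    {l | V.Typed Ts l ∧ p l}.ncard ≤ {l | V.Typed Ts l ∧ q l}.ncard :=
  Set.ncard_le_ncard (fun _ hl => ⟨hl.1, h _ hl.1 hl.2⟩) (Vocabulary.finite_typed_sep _ _)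

theorem Vocabulary.ncard_typed_sep_congr (Ts : List V.Ty) {p q : List (Elem C) → Prop}
    (h : ∀ l, V.Typed Ts l → (p l ↔ q l)) :
    {l | V.Typed Ts l ∧ p l}.ncard = {l | V.Typed Ts l ∧ q l}.ncard := by
  congr 1
  ext l
  exact and_congr_right (h l)

theorem Vocabulary.ncard_typed_sep_le (Ts : List V.Ty) (p : List (Elem C) → Prop) :
    {l | V.Typed Ts l ∧ p l}.ncard ≤ (Ts.map fun T => (V.dom T).card).prod := by
  rw [← Vocabulary.ncard_typed]
  exact Set.ncard_le_ncard (fun _ h => h.1) (Vocabulary.finite_typed _)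

theorem Simple.val_mem {Γ : List V.Ty} {T : V.Ty} {ρ : List (Elem C)} (hρ : V.Typed Γ ρ)
    (x : Simple V Γ (some T)) : x.val ρ ∈ V.dom T := by
  cases x with
  | var i h => exact hρ.getD_mem h
  | int k h => exact h

/-! ### Two-valued truth in the presence of a reduct -/

variable [LinearOrder C]

/-- Truth of a literal in `Y`, where negative literals are decided by `X`. -/
def redLit (X Y : Set (GFact V)) : Bool → GFact V → Prop
  | true, x => x ∈ Y
  | false, x => x ∉ X

/-- Truth in `Y` of what the reduct with respect to `X` leaves of a normalized formula: negative
literals are decided by `X`, and cardinality atoms have to hold both in `X` and in `Y`. -/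
def NF.red (X : Set (GFact V)) :
    {Γ : List V.Ty} → NF V Γ → Set (GFact V) → List (Elem C) → Prop
  | _, .lit b r P args, Y, ρ => redLit X Y b (.of r P, List.ofFn fun i => (args i).val ρ)
  | _, .fn b F args y, Y, ρ =>
      redLit X Y b (.graph F, (List.ofFn fun i => (args i).val ρ) ++ [y.val ρ])
  | _, .cmp x op y, _, ρ => op.holds (x.val ρ) (y.val ρ)
  | _, .count Ts φ op z, Y, ρ =>
      op.holds (Elem.int (({l | V.Typed Ts l ∧ φ.red X X (l ++ ρ)}.ncard : ℕ) : ℤ)) (z.val ρ) ∧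
      op.holds (Elem.int (({l | V.Typed Ts l ∧ φ.red X Y (l ++ ρ)}.ncard : ℕ) : ℤ)) (z.val ρ)
  | _, .and φ ψ, Y, ρ => φ.red X Y ρ ∧ ψ.red X Y ρ
  | _, .or φ ψ, Y, ρ => φ.red X Y ρ ∨ ψ.red X Y ρ
  | _, .ex T φ, Y, ρ => ∃ d ∈ V.dom T, φ.red X Y (d :: ρ)
  | _, .all T φ, Y, ρ => ∀ d ∈ V.dom T, φ.red X Y (d :: ρ)

/-- The three-valued interpretation `A` approximates the reduct given by `X` and `Y`. -/
structure Approx.Compat (A : Approx V) (X Y : Set (GFact V)) : Prop where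
  tr_sub : A.tr ⊆ Y
  fa_disj : ∀ x ∈ A.fa, x ∉ X

theorem Approx.Compat.self {A : Approx V} {X Y : Set (GFact V)} (h : A.Compat X Y) (hYX : Y ⊆ X) :
    A.Compat X X :=
  ⟨h.tr_sub.trans hYX, h.fa_disj⟩

theorem NF.red_between {A : Approx V} {X : Set (GFact V)} {Γ : List V.Ty} (φ : NF V Γ) :
    ∀ {Y : Set (GFact V)}, Y ⊆ X → A.Compat X Y → ∀ (ρ : List (Elem C)),
      (φ.ev A .certain ρ → φ.red X Y ρ) ∧
      ∀ U : Set (GFact V), Disjoint U Y → φ.red X Y ρ → φ.ev A (.possible U) ρ := by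
  have hlit : ∀ {Y : Set (GFact V)}, Y ⊆ X → A.Compat X Y → ∀ b x,
      (A.lit .certain b x → redLit X Y b x) ∧
      ∀ U : Set (GFact V), Disjoint U Y → redLit X Y b x → A.lit (.possible U) b x := by
    intro Y hYX hA b x
    cases b
    · exact ⟨fun h => hA.fa_disj x h, fun U _ h h' => h (hYX (hA.tr_sub h'))⟩
    · exact ⟨fun h => hA.tr_sub h, fun U hU h =>
        ⟨fun h' => hA.fa_disj x h' (hYX h), fun h' => Set.disjoint_left.1 hU h' h⟩⟩
  induction φ with
  | lit b r P args => intro Y hYX hA ρ; exact hlit hYX hA _ _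
  | fn b F args y => intro Y hYX hA ρ; exact hlit hYX hA _ _
  | cmp x op y => intro Y hYX hA ρ; exact ⟨id, fun _ _ => id⟩
  | count Ts φ op z ih =>
    intro Y hYX hA ρ
    have hXX := hA.self hYX
    refine ⟨fun h => ⟨h _ ?_ ?_, h _ ?_ ?_⟩, fun U hU h => ⟨_, ?_, ?_, h.2⟩⟩ <;>
      refine Vocabulary.ncard_typed_sep_mono _ fun l _ => ?_
    · exact (ih subset_rfl hXX _).1
    · exact (ih subset_rfl hXX _).2 _ (by simp)
    · exact (ih hYX hA _).1
    · exact (ih hYX hA _).2 _ (by simp)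
    · exact (ih hYX hA _).1
    · exact (ih hYX hA _).2 _ hU
  | and φ ψ ih ih' =>
    intro Y hYX hA ρ
    exact ⟨fun h => ⟨(ih hYX hA ρ).1 h.1, (ih' hYX hA ρ).1 h.2⟩,
      fun U hU h => ⟨(ih hYX hA ρ).2 U hU h.1, (ih' hYX hA ρ).2 U hU h.2⟩⟩
  | or φ ψ ih ih' =>
    intro Y hYX hA ρ
    exact ⟨fun h => h.imp (ih hYX hA ρ).1 (ih' hYX hA ρ).1,
      fun U hU h => h.imp ((ih hYX hA ρ).2 U hU) ((ih' hYX hA ρ).2 U hU)⟩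
  | ex T φ ih =>
    intro Y hYX hA ρ
    exact ⟨fun ⟨d, hd, h⟩ => ⟨d, hd, (ih hYX hA _).1 h⟩,
      fun U hU ⟨d, hd, h⟩ => ⟨d, hd, (ih hYX hA _).2 U hU h⟩⟩
  | all T φ ih =>
    intro Y hYX hA ρ
    exact ⟨fun h d hd => (ih hYX hA _).1 (h d hd),
      fun U hU h d hd => (ih hYX hA _).2 U hU (h d hd)⟩

/-- The two-valued interpretation given by a set of facts. -/
def Approx.total (X : Set (GFact V)) : Approx V := ⟨X, Xᶜ⟩

theorem NF.ev_total_iff (X : Set (GFact V)) {Γ : List V.Ty} (φ : NF V Γ) :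
    ∀ ρ : List (Elem C), (φ.ev (Approx.total X) .certain ρ ↔ φ.red X X ρ) ∧
      (φ.ev (Approx.total X) (.possible ∅) ρ ↔ φ.red X X ρ) := by
  have hlit : ∀ b x, ((Approx.total X).lit .certain b x ↔ redLit X X b x) ∧
      ((Approx.total X).lit (.possible ∅) b x ↔ redLit X X b x) := by
    intro b x
    cases b <;> simp [Approx.lit, redLit, Approx.total]
  induction φ with
  | lit b r P args => intro ρ; exact hlit _ _
  | fn b F args y => intro ρ; exact hlit _ _
  | cmp x op y => intro ρ; exact ⟨Iff.rfl, Iff.rfl⟩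
  | count Ts φ op z ih =>
    intro ρ
    have h1 : ∀ ρ, φ.ev (Approx.total X) .certain ρ = φ.red X X ρ := fun ρ => propext (ih ρ).1
    have h2 : ∀ ρ, φ.ev (Approx.total X) (.possible ∅) ρ = φ.red X X ρ :=
      fun ρ => propext (ih ρ).2
    simp only [NF.ev, NF.red, h1, h2, and_self]
    refine ⟨⟨fun h => h _ le_rfl le_rfl, fun h k hk hk' => ?_⟩, ⟨?_, fun h => ⟨_, le_rfl, le_rfl, h⟩⟩⟩
    · rwa [le_antisymm hk' hk]
    · rintro ⟨k, hk, hk', h⟩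
      rwa [le_antisymm hk' hk] at h
  | and φ ψ ih ih' =>
    intro ρ
    exact ⟨and_congr (ih ρ).1 (ih' ρ).1, and_congr (ih ρ).2 (ih' ρ).2⟩
  | or φ ψ ih ih' =>
    intro ρ
    exact ⟨or_congr (ih ρ).1 (ih' ρ).1, or_congr (ih ρ).2 (ih' ρ).2⟩
  | ex T φ ih =>
    intro ρ
    simp only [NF.ev, NF.red, ih, and_self]
  | all T φ ih =>
    intro ρ
    simp only [NF.ev, NF.red, ih, and_self]

/-! ### Renaming of the defined predicates -/

/-- All predicate literals use the original predicates, not their copies. -/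
def NF.Plain : {Γ : List V.Ty} → NF V Γ → Prop
  | _, .lit _ r _ _ => r = false
  | _, .fn _ _ _ _ => True
  | _, .cmp _ _ _ => True
  | _, .count _ φ _ _ => φ.Plain
  | _, .and φ ψ => φ.Plain ∧ ψ.Plain
  | _, .or φ ψ => φ.Plain ∧ ψ.Plain
  | _, .ex _ φ => φ.Plain
  | _, .all _ φ => φ.Plain

/-- Being a symbol of the original vocabulary. -/
def RelSym.IsBase : RelSym V → Prop
  | .copy _ => False
  | _ => True

open Classical in
/-- Replace a predicate that satisfies `D` by its copy. -/
noncomputable def RelSym.rename (D : V.Pred → Prop) : RelSym V → RelSym V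
  | .pred P => if D P then .copy P else .pred P
  | R => R

theorem RelSym.rename_injOn (D : V.Pred → Prop) :
    Set.InjOn (RelSym.rename D) {R | R.IsBase} := by
  intro R hR R' hR' h
  cases R <;> cases R' <;> simp only [RelSym.rename, RelSym.IsBase, Set.mem_ofPred_eq] at * <;>
    grind

/-- The image of a set of facts about the original vocabulary under the renaming. -/
def renamedFacts (D : V.Pred → Prop) (Z : Set (GFact V)) : Set (GFact V) :=
  {y | ∃ x ∈ Z, x.1.IsBase ∧ y = (x.1.rename D, x.2)}

theorem mem_renamedFacts {D : V.Pred → Prop} {Z : Set (GFact V)} {R : RelSym V} (hR : R.IsBase)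
    {l : List (Elem C)} : (R.rename D, l) ∈ renamedFacts D Z ↔ (R, l) ∈ Z := by
  constructor
  · rintro ⟨⟨R', l'⟩, hx, hb, h⟩
    rw [Prod.mk.injEq] at h
    obtain rfl := RelSym.rename_injOn D hR hb h.1
    obtain rfl := h.2
    exact hx
  · exact fun h => ⟨_, h, hR, rfl⟩

/-- The image of a three-valued interpretation under the renaming. -/
def Approx.renamed (D : V.Pred → Prop) (A : Approx V) : Approx V :=
  ⟨renamedFacts D A.tr, renamedFacts D A.fa⟩

/-- The image of an evaluation mode under the renaming. -/
def Mode.renamed (D : V.Pred → Prop) : Mode V → Mode V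
  | .certain => .certain
  | .possible U => .possible (renamedFacts D U)

theorem renamedFacts_empty (D : V.Pred → Prop) : renamedFacts D (∅ : Set (GFact V)) = ∅ := by
  simp [renamedFacts]

theorem Approx.lit_renamed (D : V.Pred → Prop) (A : Approx V) (m : Mode V) (b : Bool)
    {R : RelSym V} (hR : R.IsBase) (l : List (Elem C)) :
    (A.renamed D).lit (m.renamed D) b (R.rename D, l) ↔ A.lit m b (R, l) := by
  cases m <;> cases b <;> simp [Approx.lit, Mode.renamed, Approx.renamed, mem_renamedFacts hR]

theorem NF.ev_rename (D : V.Pred → Prop) (A : Approx V) {Γ : List V.Ty} (φ : NF V Γ) :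
    φ.Plain → ∀ (m : Mode V) (ρ : List (Elem C)),
      (φ.rename D).ev (A.renamed D) (m.renamed D) ρ ↔ φ.ev A m ρ := by
  induction φ with
  | lit b r P args =>
    rintro rfl m ρ
    rw [NF.ev, ← Approx.lit_renamed D A m b (R := .of false P) trivial]
    simp only [NF.rename, NF.ev, RelSym.of, RelSym.rename]
    by_cases h : D P <;> simp [h]
  | fn b F args y =>
    intro _ m ρ
    exact Approx.lit_renamed D A m b (R := .graph F) trivial _
  | cmp x op y => intro _ m ρ; exact Iff.rfl
  | count Ts φ op z ih =>
    intro hφ m ρ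
    have h1 := fun ρ => propext (ih hφ .certain ρ)
    have h2 := fun U ρ => propext (ih hφ (.possible U) ρ)
    have h3 := h2 ∅
    simp only [Mode.renamed, renamedFacts_empty] at h1 h2 h3
    cases m <;> simp only [NF.rename, NF.ev, Mode.renamed, h1, h2, h3]
  | and φ ψ ih ih' =>
    intro hφ m ρ
    exact and_congr (ih hφ.1 m ρ) (ih' hφ.2 m ρ)
  | or φ ψ ih ih' =>
    intro hφ m ρ
    exact or_congr (ih hφ.1 m ρ) (ih' hφ.2 m ρ)
  | ex T φ ih =>
    intro hφ m ρ
    simp only [NF.rename, NF.ev, ih hφ]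
  | all T φ ih =>
    intro hφ m ρ
    simp only [NF.rename, NF.ev, ih hφ]

end Truth

section Normalization

variable {C : Type} [LinearOrder C] {V : Vocabulary.{u} C}

/-! ### Normal forms are plain -/

theorem flatTuple_plain {Γ : List V.Ty} (n : ℕ) : ∀ (τ : Fin n → V.Ty)
    (fl : ∀ i : Fin n, ∀ Γ₁ : List V.Ty, Ren (V := V) Γ Γ₁ → FlatCont V Γ₁ (τ i) → NF V Γ₁)
    (_ : ∀ i Γ₁ σ k, (∀ Γ₂ σ' x, (k Γ₂ σ' x).Plain) → (fl i Γ₁ σ k).Plain)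
    (Γ₁ : List V.Ty) (σ : Ren (V := V) Γ Γ₁)
    (k : ∀ Γ₂ : List V.Ty, Ren (V := V) Γ₁ Γ₂ → (∀ i : Fin n, Simple V Γ₂ (some (τ i))) →
      NF V Γ₂)
    (_ : ∀ Γ₂ σ' xs, (k Γ₂ σ' xs).Plain), (flatTuple n τ fl Γ₁ σ k).Plain := by
  induction n with
  | zero => intro τ fl hfl Γ₁ σ k hk; exact hk _ _ _
  | succ n ih =>
    intro τ fl hfl Γ₁ σ k hk
    exact hfl _ _ _ _ fun Γ₂ σ' x => ih _ _ (fun i => hfl i.succ) _ _ _ fun _ _ _ => hk _ _ _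

mutual

theorem Term.flat_plain : {Γ : List V.Ty} → {T : V.Ty} → (t : Term V Γ T) →
    (Γ' : List V.Ty) → (σ : Ren (V := V) Γ Γ') → (k : FlatCont V Γ' T) →
    (∀ Γ₂ σ' x, (k Γ₂ σ' x).Plain) → (t.flat Γ' σ k).Plain
  | _, _, .var i h, Γ', σ, k, hk => hk _ _ _
  | _, _, .int n h, Γ', σ, k, hk => hk _ _ _
  | _, _, .app F args, Γ', σ, k, hk =>
      flatTuple_plain _ _ _ (fun i => (args i).flat_plain) _ _ _ fun _ _ _ =>
        ⟨trivial, hk _ _ _⟩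
  | _, _, .card Ts φ h, Γ', σ, k, hk => ⟨φ.norm_plain true _ _, hk _ _ _⟩

theorem Formula.norm_plain : {Γ : List V.Ty} → (φ : Formula V Γ) → (b : Bool) →
    (Γ' : List V.Ty) → (σ : Ren (V := V) Γ Γ') → (φ.norm b Γ' σ).Plain
  | _, .pred P args, b, Γ', σ =>
      flatTuple_plain _ _ _ (fun i => (args i).flat_plain) _ _ _ fun _ _ _ => rfl
  | _, .funEq F args u, b, Γ', σ =>
      flatTuple_plain _ _ _ (fun i => (args i).flat_plain) _ _ _ fun _ _ _ =>
        u.flat_plain _ _ _ fun _ _ _ => trivial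
  | _, .cmp t op u, b, Γ', σ =>
      t.flat_plain _ _ _ fun _ _ _ => u.flat_plain _ _ _ fun _ _ _ => trivial
  | _, .cmpInt t op k, b, Γ', σ => t.flat_plain _ _ _ fun _ _ _ => trivial
  | _, .intInt k op k', b, _, _ => trivial
  | _, .count Ts φ op u, b, Γ', σ => u.flat_plain _ _ _ fun _ _ _ => φ.norm_plain true _ _
  | _, .countInt Ts φ op k, b, _, σ => φ.norm_plain true _ _
  | _, .not φ, b, Γ', σ => φ.norm_plain (!b) _ _
  | _, .and φ ψ, true, Γ', σ => ⟨φ.norm_plain _ _ _, ψ.norm_plain _ _ _⟩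
  | _, .and φ ψ, false, Γ', σ => ⟨φ.norm_plain _ _ _, ψ.norm_plain _ _ _⟩
  | _, .or φ ψ, true, Γ', σ => ⟨φ.norm_plain _ _ _, ψ.norm_plain _ _ _⟩
  | _, .or φ ψ, false, Γ', σ => ⟨φ.norm_plain _ _ _, ψ.norm_plain _ _ _⟩
  | _, .imp φ ψ, true, Γ', σ => ⟨φ.norm_plain _ _ _, ψ.norm_plain _ _ _⟩
  | _, .imp φ ψ, false, Γ', σ => ⟨φ.norm_plain _ _ _, ψ.norm_plain _ _ _⟩
  | _, .iff φ ψ, true, Γ', σ =>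
      ⟨⟨φ.norm_plain _ _ _, ψ.norm_plain _ _ _⟩, φ.norm_plain _ _ _, ψ.norm_plain _ _ _⟩
  | _, .iff φ ψ, false, Γ', σ =>
      ⟨⟨φ.norm_plain _ _ _, ψ.norm_plain _ _ _⟩, φ.norm_plain _ _ _, ψ.norm_plain _ _ _⟩
  | _, .ex T φ, true, Γ', σ => φ.norm_plain _ _ _
  | _, .ex T φ, false, Γ', σ => φ.norm_plain _ _ _
  | _, .all T φ, true, Γ', σ => φ.norm_plain _ _ _
  | _, .all T φ, false, Γ', σ => φ.norm_plain _ _ _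

end

theorem Formula.normalize_plain {Γ : List V.Ty} (φ : Formula V Γ) : φ.normalize.Plain :=
  φ.norm_plain _ _ _

/-! ### Renamings and valuations -/

/-- The valuation `ε'` gives the renamed variables the values that `ε` gives the original ones. -/
def Ren.Agrees {Γ Γ' : List V.Ty} (σ : Ren (V := V) Γ Γ') (ε ε' : List (Elem C)) : Prop :=
  ∀ (i : ℕ) (T : V.Ty), Γ[i]? = some T →
    ε'.getD (σ.1 i) (Elem.int 0) = ε.getD i (Elem.int 0)

theorem Ren.agrees_id (Γ : List V.Ty) (ε : List (Elem C)) : (Ren.id (V := V) Γ).Agrees ε ε :=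
  fun _ _ _ => rfl

theorem Ren.Agrees.comp {Γ Γ' Γ'' : List V.Ty} {σ : Ren (V := V) Γ' Γ''} {τ : Ren (V := V) Γ Γ'}
    {ε ε' ε'' : List (Elem C)} (hσ : σ.Agrees ε' ε'') (hτ : τ.Agrees ε ε') :
    (σ.comp τ).Agrees ε ε'' :=
  fun i T h => (hσ _ T (τ.2 i T h)).trans (hτ i T h)

theorem Ren.agrees_shift (T : V.Ty) (Γ : List V.Ty) (d : Elem C) (ε : List (Elem C)) :
    (Ren.shift T Γ).Agrees ε (d :: ε) :=
  fun _ _ _ => by simp [Ren.shift]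

theorem Ren.Agrees.lift {Γ Γ' : List V.Ty} {σ : Ren (V := V) Γ Γ'} {ε ε' : List (Elem C)}
    (hσ : σ.Agrees ε ε') {Ts : List V.Ty} {l : List (Elem C)} (hl : V.Typed Ts l) :
    (σ.lift Ts).Agrees (l ++ ε) (l ++ ε') := by
  intro i T h
  have hlen := hl.length_eq
  by_cases hi : i < Ts.length
  · simp only [Ren.lift, hi, if_true]
    rw [List.getD_append _ _ _ _ (by omega), List.getD_append _ _ _ _ (by omega)]
  · rw [List.getElem?_append_right (by omega)] at h
    simp only [Ren.lift, hi, if_false]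
    rw [List.getD_append_right _ _ _ _ (by omega), List.getD_append_right _ _ _ _ (by omega), hlen,
      Nat.add_sub_cancel_left]
    exact hσ _ T h

theorem Simple.val_ren {Γ Γ' : List V.Ty} {σ : Ren (V := V) Γ Γ'} {ε ε' : List (Elem C)}
    (hσ : σ.Agrees ε ε') {s : Option V.Ty} (x : Simple V Γ s) : (x.ren σ).val ε' = x.val ε := by
  cases x with
  | var i h => exact hσ i _ h
  | int k h => rfl
  | num k => rfl

theorem Vocabulary.typed_ofFn {Ts : List V.Ty} {w : Fin Ts.length → Elem C}
    (hw : ∀ i, w i ∈ V.dom (Ts.get i)) : V.Typed Ts (List.ofFn w) := by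
  rw [Vocabulary.typed_iff_get]
  refine ⟨by simp, fun i T d hT hd => ?_⟩
  obtain ⟨hi, rfl⟩ := List.getElem?_eq_some_iff.1 hT
  obtain ⟨hi', rfl⟩ := List.getElem?_eq_some_iff.1 hd
  simpa using hw ⟨i, hi⟩

theorem Struc.app_mem (S : Struc V) (F : V.Func) {l : List (Elem C)}
    (h : V.Typed (V.funcArgs F) l) : S.app F l ∈ V.dom (V.funcRes F) := by
  rw [Struc.app, dif_pos h]
  exact (S.func F ⟨l, h⟩).2

theorem Term.val_mem (S : Struc V) : {Γ : List V.Ty} → {T : V.Ty} → (t : Term V Γ T) →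
    {ε : List (Elem C)} → V.Typed Γ ε → t.val S ε ∈ V.dom T
  | _, _, .var i h, _, hε => by rw [Term.val]; exact hε.getD_mem h
  | _, _, .int k h, _, _ => by rw [Term.val]; exact h
  | _, _, .app F args, _, hε => by
      rw [Term.val]
      exact S.app_mem F (Vocabulary.typed_ofFn fun i => (args i).val_mem S hε)
  | _, _, .card Ts φ h, _, _ => by
      rw [Term.val]
      exact h _ (Vocabulary.ncard_typed_sep_le _ _)

theorem CmpOp.holds_neg {D : Type*} [LinearOrder D] (op : CmpOp) (a b : D) :
    op.neg.holds a b ↔ ¬ op.holds a b := by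
  cases op <;> simp [CmpOp.neg, CmpOp.holds]

theorem CmpOp.holds_signed {D : Type*} [LinearOrder D] (op : CmpOp) (c : Bool) (a b : D) :
    (op.signed c).holds a b ↔ (op.holds a b ↔ c = true) := by
  cases c <;> simp [CmpOp.signed, CmpOp.holds_neg]

/-! ### Correctness of the normal form -/

/-- The facts about the original vocabulary in `X` are those of `S`. -/
structure Struc.Represented (S : Struc V) (X : Set (GFact V)) : Prop where
  pred : ∀ P l, (RelSym.pred P, l) ∈ X ↔ S.Rel P l
  graph : ∀ F l d, V.Typed (V.funcArgs F) l → ((RelSym.graph F, l ++ [d]) ∈ X ↔ S.app F l = d)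

theorem flatTuple_red {X : Set (GFact V)} {Γ : List V.Ty} {ε : List (Elem C)} (n : ℕ) :
    ∀ (τ : Fin n → V.Ty) (w : Fin n → Elem C)
    (fl : ∀ i : Fin n, ∀ Γ₁ : List V.Ty, Ren (V := V) Γ Γ₁ → FlatCont V Γ₁ (τ i) → NF V Γ₁)
    (_ : ∀ i Γ₁ (σ : Ren (V := V) Γ Γ₁) (k : FlatCont V Γ₁ (τ i)) (ε₁ : List (Elem C)) (Q : Prop),
      V.Typed Γ₁ ε₁ → σ.Agrees ε ε₁ →
      (∀ Γ₂ (σ' : Ren (V := V) Γ₁ Γ₂) (x : Simple V Γ₂ (some (τ i))) (ε₂ : List (Elem C)),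
        V.Typed Γ₂ ε₂ → σ'.Agrees ε₁ ε₂ → x.val ε₂ = w i → ((k Γ₂ σ' x).red X X ε₂ ↔ Q)) →
      ((fl i Γ₁ σ k).red X X ε₁ ↔ Q))
    (Γ₁ : List V.Ty) (σ : Ren (V := V) Γ Γ₁)
    (k : ∀ Γ₂ : List V.Ty, Ren (V := V) Γ₁ Γ₂ → (∀ i : Fin n, Simple V Γ₂ (some (τ i))) →
      NF V Γ₂) (ε₁ : List (Elem C)) (Q : Prop), V.Typed Γ₁ ε₁ → σ.Agrees ε ε₁ →
    (∀ Γ₂ (σ' : Ren (V := V) Γ₁ Γ₂) (xs : ∀ i, Simple V Γ₂ (some (τ i))) (ε₂ : List (Elem C)),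
      V.Typed Γ₂ ε₂ → σ'.Agrees ε₁ ε₂ → (fun i => (xs i).val ε₂) = w →
      ((k Γ₂ σ' xs).red X X ε₂ ↔ Q)) →
    ((flatTuple n τ fl Γ₁ σ k).red X X ε₁ ↔ Q) := by
  induction n with
  | zero =>
    intro τ w fl hfl Γ₁ σ k ε₁ Q hε₁ hσ hk
    exact hk _ _ _ _ hε₁ (Ren.agrees_id _ _) (Subsingleton.elim _ _)
  | succ n ih =>
    intro τ w fl hfl Γ₁ σ k ε₁ Q hε₁ hσ hk
    refine hfl _ _ _ _ _ _ hε₁ hσ fun Γ₂ σ₂ x ε₂ hε₂ hσ₂ hx => ?_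
    refine ih _ (fun i => w i.succ) _ (fun i => hfl i.succ) _ _ _ _ _ hε₂ (hσ₂.comp hσ)
      fun Γ₃ σ₃ xs ε₃ hε₃ hσ₃ hxs => ?_
    refine hk _ _ _ _ hε₃ (hσ₃.comp hσ₂) (funext fun i => ?_)
    refine Fin.cases ?_ (fun j => ?_) i
    · simp only [Fin.cons_zero]
      rw [Simple.val_ren hσ₃, hx]
    · simp only [Fin.cons_succ]
      exact congrFun hxs j

theorem redLit_self (X : Set (GFact V)) (b : Bool) (x : GFact V) :
    redLit X X b x ↔ (x ∈ X ↔ b = true) := by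
  cases b <;> simp [redLit]

mutual

theorem Term.flat_red {S : Struc V} {X : Set (GFact V)} (hX : S.Represented X) :
    {Γ : List V.Ty} → {T : V.Ty} → (t : Term V Γ T) → {ε : List (Elem C)} → V.Typed Γ ε →
    (Γ' : List V.Ty) → (σ : Ren (V := V) Γ Γ') → (k : FlatCont V Γ' T) → (ε' : List (Elem C)) →
    (Q : Prop) → V.Typed Γ' ε' → σ.Agrees ε ε' →
    (∀ Γ₂ (σ' : Ren (V := V) Γ' Γ₂) (x : Simple V Γ₂ (some T)) (ε₂ : List (Elem C)),
      V.Typed Γ₂ ε₂ → σ'.Agrees ε' ε₂ → x.val ε₂ = t.val S ε → ((k Γ₂ σ' x).red X X ε₂ ↔ Q)) →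
    ((t.flat Γ' σ k).red X X ε' ↔ Q)
  | _, _, .var i h, _, _, Γ', σ, k, ε', Q, hε', hσ, hk =>
      hk _ _ _ _ hε' (Ren.agrees_id _ _) (by rw [Term.val]; exact hσ _ _ h)
  | _, _, .int n h, _, _, Γ', σ, k, ε', Q, hε', hσ, hk =>
      hk _ _ _ _ hε' (Ren.agrees_id _ _) (by rw [Term.val]; rfl)
  | _, _, .app F args, ε, hε, Γ', σ, k, ε', Q, hε', hσ, hk => by
      rw [Term.flat]
      refine flatTuple_red _ _ (fun i => (args i).val S ε) _
        (fun i Γ₁ σ₁ k₁ ε₁ Q₁ h₁ h₁' => (args i).flat_red hX hε Γ₁ σ₁ k₁ ε₁ Q₁ h₁ h₁')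
        _ _ _ _ _ hε' hσ fun Γ₂ σ₂ xs ε₂ hε₂ hσ₂ hxs => ?_
      have hty : V.Typed (V.funcArgs F) (List.ofFn fun i => (args i).val S ε) :=
        Vocabulary.typed_ofFn fun i => (args i).val_mem S hε
      have hfn : ∀ d, ((List.ofFn fun i => ((xs i).ren (Ren.shift (V.funcRes F) Γ₂)).val (d :: ε₂))
          = List.ofFn fun i => (args i).val S ε) := by
        intro d
        simp only [Simple.val_ren (Ren.agrees_shift (V.funcRes F) Γ₂ d ε₂)]
        exact congrArg List.ofFn hxs
      have key : ∀ d ∈ V.dom (V.funcRes F), S.app F (List.ofFn fun i => (args i).val S ε) = d →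
          ((k _ ((Ren.shift _ Γ₂).comp σ₂) (Simple.top _ Γ₂)).red X X (d :: ε₂) ↔ Q) := by
        intro d hd h
        refine hk _ _ _ _ (hε₂.cons hd) ((Ren.agrees_shift _ _ _ _).comp hσ₂) ?_
        rw [Term.val]
        exact h.symm
      simp only [NF.red, redLit, hfn]
      simp only [Simple.top, Simple.val, List.getD_cons_zero, hX.graph F _ _ hty]
      refine ⟨fun h => ?_, fun hQ d hd => or_iff_not_imp_left.2 fun h => ?_⟩
      · have hm := S.app_mem F hty
        exact (key _ hm rfl).1 ((h _ hm).resolve_left (fun h => h rfl))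
      · exact (key d hd (not_not.1 h)).2 hQ
  | _, T, .card Ts φ h, ε, hε, Γ', σ, k, ε', Q, hε', hσ, hk => by
      rw [Term.flat]
      have hcount : ∀ d ∈ V.dom T, {l : List (Elem C) | V.Typed Ts l ∧
          (φ.norm true _ (((Ren.shift T Γ').comp σ).lift Ts)).red X X (l ++ d :: ε')}.ncard =
          {l : List (Elem C) | V.Typed Ts l ∧ φ.sat S (l ++ ε)}.ncard := fun d hd =>
        Vocabulary.ncard_typed_sep_congr _ fun l hl =>
          (φ.norm_red hX (hl.append hε) true _ _ _ (hl.append (hε'.cons hd))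
            (((Ren.agrees_shift _ _ _ _).comp hσ).lift hl)).trans (by simp)
      have key : ∀ d ∈ V.dom T, (Term.card Ts φ h).val S ε = d →
          ((k _ (Ren.shift _ Γ') (Simple.top _ Γ')).red X X (d :: ε') ↔ Q) := by
        intro d hd h
        exact hk _ _ _ _ (hε'.cons hd) (Ren.agrees_shift _ _ _ _) h.symm
      simp only [NF.red]
      refine ⟨fun h' => ?_, fun hQ d hd => or_iff_not_imp_left.2 fun h' => ?_⟩
      · have hm := (Term.card Ts φ h).val_mem S hε
        refine (key _ hm rfl).1 ((h' _ hm).resolve_left (fun h'' => h''.1 ?_))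
        rw [hcount _ hm, Term.val]
        rfl
      · refine (key d hd ?_).2 hQ
        rw [hcount _ hd, and_self] at h'
        rw [Term.val]
        exact not_not.1 h'

theorem Formula.norm_red {S : Struc V} {X : Set (GFact V)} (hX : S.Represented X) :
    {Γ : List V.Ty} → (φ : Formula V Γ) → {ε : List (Elem C)} → V.Typed Γ ε → (b : Bool) →
    (Γ' : List V.Ty) → (σ : Ren (V := V) Γ Γ') → (ε' : List (Elem C)) → V.Typed Γ' ε' →
    σ.Agrees ε ε' → ((φ.norm b Γ' σ).red X X ε' ↔ (φ.sat S ε ↔ b = true))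
  | _, .pred P args, ε, hε, b, Γ', σ, ε', hε', hσ => by
      rw [Formula.norm]
      refine flatTuple_red _ _ (fun i => (args i).val S ε) _
        (fun i Γ₁ σ₁ k₁ ε₁ Q₁ h₁ h₁' => (args i).flat_red hX hε Γ₁ σ₁ k₁ ε₁ Q₁ h₁ h₁')
        _ _ _ _ _ hε' hσ fun Γ₂ σ₂ xs ε₂ hε₂ hσ₂ hxs => ?_
      rw [NF.red, redLit_self, Formula.sat, hxs]
      exact iff_congr (hX.pred _ _) Iff.rfl
  | _, .funEq F args u, ε, hε, b, Γ', σ, ε', hε', hσ => by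
      rw [Formula.norm]
      refine flatTuple_red _ _ (fun i => (args i).val S ε) _
        (fun i Γ₁ σ₁ k₁ ε₁ Q₁ h₁ h₁' => (args i).flat_red hX hε Γ₁ σ₁ k₁ ε₁ Q₁ h₁ h₁')
        _ _ _ _ _ hε' hσ fun Γ₂ σ₂ xs ε₂ hε₂ hσ₂ hxs => ?_
      refine u.flat_red hX hε _ _ _ _ _ hε₂ (hσ₂.comp hσ) fun Γ₃ σ₃ y ε₃ hε₃ hσ₃ hy => ?_
      rw [NF.red, redLit_self, Formula.sat, hy]
      simp only [Simple.val_ren hσ₃, hxs]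
      exact iff_congr (hX.graph _ _ _
        (Vocabulary.typed_ofFn fun i => (args i).val_mem S hε)) Iff.rfl
  | _, .cmp t op u, ε, hε, b, Γ', σ, ε', hε', hσ => by
      rw [Formula.norm]
      refine t.flat_red hX hε _ _ _ _ _ hε' hσ fun Γ₂ σ₂ x ε₂ hε₂ hσ₂ hx => ?_
      refine u.flat_red hX hε _ _ _ _ _ hε₂ (hσ₂.comp hσ) fun Γ₃ σ₃ y ε₃ hε₃ hσ₃ hy => ?_
      rw [NF.red, CmpOp.holds_signed, Formula.sat, Simple.val_ren hσ₃, hx, hy]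
  | _, .cmpInt t op k, ε, hε, b, Γ', σ, ε', hε', hσ => by
      rw [Formula.norm]
      refine t.flat_red hX hε _ _ _ _ _ hε' hσ fun Γ₂ σ₂ x ε₂ hε₂ hσ₂ hx => ?_
      rw [NF.red, CmpOp.holds_signed, Formula.sat, hx]
      rfl
  | _, .intInt k op k', ε, hε, b, _, _, _, _, _ => by
      rw [Formula.norm, NF.red, CmpOp.holds_signed, Formula.sat]
      rfl
  | _, .count Ts φ op u, ε, hε, b, Γ', σ, ε', hε', hσ => by
      rw [Formula.norm]
      refine u.flat_red hX hε _ _ _ _ _ hε' hσ fun Γ₂ σ₂ z ε₂ hε₂ hσ₂ hz => ?_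
      rw [NF.red, and_self, CmpOp.holds_signed, Formula.sat, hz]
      rw [Vocabulary.ncard_typed_sep_congr Ts (q := fun l => φ.sat S (l ++ ε)) fun l hl =>
        (φ.norm_red hX (hl.append hε) true _ _ _ (hl.append hε₂)
            ((hσ₂.comp hσ).lift hl)).trans (by simp)]
  | _, .countInt Ts φ op k, ε, hε, b, _, σ, ε', hε', hσ => by
      rw [Formula.norm, NF.red, and_self, CmpOp.holds_signed, Formula.sat]
      rw [Vocabulary.ncard_typed_sep_congr Ts (q := fun l => φ.sat S (l ++ ε)) fun l hl =>
        (φ.norm_red hX (hl.append hε) true _ _ _ (hl.append hε')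
            (hσ.lift hl)).trans (by simp)]
      rfl
  | _, .not φ, ε, hε, b, Γ', σ, ε', hε', hσ => by
      rw [Formula.norm, Formula.sat, φ.norm_red hX hε _ _ _ _ hε' hσ]
      cases b <;> simp
  | _, .and φ ψ, ε, hε, b, Γ', σ, ε', hε', hσ => by
      cases b <;> rw [Formula.norm, NF.red, Formula.sat, φ.norm_red hX hε _ _ _ _ hε' hσ,
        ψ.norm_red hX hε _ _ _ _ hε' hσ] <;> simp only [iff_true, Bool.false_eq_true, iff_false] <;>
        tauto
  | _, .or φ ψ, ε, hε, b, Γ', σ, ε', hε', hσ => by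
      cases b <;> rw [Formula.norm, NF.red, Formula.sat, φ.norm_red hX hε _ _ _ _ hε' hσ,
        ψ.norm_red hX hε _ _ _ _ hε' hσ] <;> simp only [iff_true, Bool.false_eq_true, iff_false] <;>
        tauto
  | _, .imp φ ψ, ε, hε, b, Γ', σ, ε', hε', hσ => by
      cases b <;> rw [Formula.norm, NF.red, Formula.sat, φ.norm_red hX hε _ _ _ _ hε' hσ,
        ψ.norm_red hX hε _ _ _ _ hε' hσ] <;> simp only [iff_true, Bool.false_eq_true, iff_false] <;>
        tauto
  | _, .iff φ ψ, ε, hε, b, Γ', σ, ε', hε', hσ => by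
      cases b <;> rw [Formula.norm, NF.red, NF.red, NF.red, Formula.sat,
        φ.norm_red hX hε _ _ _ _ hε' hσ, φ.norm_red hX hε _ _ _ _ hε' hσ,
        ψ.norm_red hX hε _ _ _ _ hε' hσ, ψ.norm_red hX hε _ _ _ _ hε' hσ] <;>
        simp only [iff_true, Bool.false_eq_true, iff_false] <;> tauto
  | _, .ex T φ, ε, hε, b, Γ', σ, ε', hε', hσ => by
      have key : ∀ b, ∀ d ∈ V.dom T, ((φ.norm b (T :: Γ') (σ.lift [T])).red X X (d :: ε') ↔
          (φ.sat S (d :: ε) ↔ b = true)) := fun b d hd =>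
        φ.norm_red hX (hε.cons hd) b _ _ _ (hε'.cons hd)
          (hσ.lift (l := [d]) (Vocabulary.typed_singleton_iff.2 ⟨d, hd, rfl⟩))
      have ht := key true
      have hf := key false
      simp only [iff_true, Bool.false_eq_true, iff_false] at ht hf
      cases b
      · simp only [Formula.norm, NF.red, Formula.sat, Bool.false_eq_true, iff_false, not_exists,
          not_and]
        exact forall₂_congr hf
      · simp only [Formula.norm, NF.red, Formula.sat, iff_true]
        exact exists_congr fun d => and_congr_right (ht d)
  | _, .all T φ, ε, hε, b, Γ', σ, ε', hε', hσ => by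
      have key : ∀ b, ∀ d ∈ V.dom T, ((φ.norm b (T :: Γ') (σ.lift [T])).red X X (d :: ε') ↔
          (φ.sat S (d :: ε) ↔ b = true)) := fun b d hd =>
        φ.norm_red hX (hε.cons hd) b _ _ _ (hε'.cons hd)
          (hσ.lift (l := [d]) (Vocabulary.typed_singleton_iff.2 ⟨d, hd, rfl⟩))
      have ht := key true
      have hf := key false
      simp only [iff_true, Bool.false_eq_true, iff_false] at ht hf
      cases b
      · simp only [Formula.norm, NF.red, Formula.sat, Bool.false_eq_true, iff_false, not_forall,
          exists_prop]
        exact exists_congr fun d => and_congr_right (hf d)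
      · simp only [Formula.norm, NF.red, Formula.sat, iff_true]
        exact forall₂_congr ht

end

theorem Formula.normalize_red {S : Struc V} {X : Set (GFact V)} (hX : S.Represented X)
    (φ : Formula V []) : φ.normalize.red X X [] ↔ φ.sat S [] := by
  have h : V.Typed [] [] := Vocabulary.typed_nil_iff.2 rfl
  rw [Formula.normalize, φ.norm_red hX h true _ _ _ h (Ren.agrees_id _ _)]
  simp

end Normalization

section Programs

variable {C : Type} [LinearOrder C] {V : Vocabulary.{u} C}

/-! ### Instances of the variables of a context -/

/-- The values of the variables of a context, named by `v`, under the substitution `θ`. -/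
def ctxVals {Z : Type} (θ : Z → Elem C) (v : ℕ → Z) (Γ : List V.Ty) : List (Elem C) :=
  (List.range Γ.length).map fun i => θ (v i)

theorem ctxVars_ground {Z : Type} (θ : Z → Elem C) (v : ℕ → Z) (Γ : List V.Ty) :
    (ctxVars (C := C) v Γ).map (ATerm.ground θ) = ctxVals θ v Γ := by
  simp [ctxVars, ctxVals, ATerm.ground, Function.comp_def]

theorem ctxVals_getD {Z : Type} (θ : Z → Elem C) (v : ℕ → Z) {Γ : List V.Ty} {i : ℕ}
    (hi : i < Γ.length) : (ctxVals θ v Γ).getD i (Elem.int 0) = θ (v i) := by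
  simp [ctxVals, hi]

theorem ctxVals_consVar {Z : Type} (θ : Z → Elem C) (v : ℕ → Z) (x : Z) (T : V.Ty)
    (Γ : List V.Ty) : ctxVals θ (consVar x v) (T :: Γ) = θ x :: ctxVals θ v Γ := by
  simp [ctxVals, List.range_succ_eq_map, consVar, Function.comp_def]

theorem ctxVals_localVar {Z : Type} (θ : Z → Elem C) (v : ℕ → Z) (Ts Γ : List V.Ty)
    (d : Fin Ts.length → Elem C) :
    ctxVals (Sum.elim θ d) (localVar Ts.length v) (Ts ++ Γ) = List.ofFn d ++ ctxVals θ v Γ := by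
  apply List.ext_getElem
  · simp [ctxVals]
  · intro i h1 h2
    by_cases hi : i < Ts.length
    · rw [List.getElem_append_left (by simpa using hi)]
      simp [ctxVals, localVar, hi]
    · rw [List.getElem_append_right (by simpa using hi)]
      simp [ctxVals, localVar, hi]

theorem ctxVals_of_length_eq {Z : Type} (θ : Z → Elem C) (v : ℕ → Z) {Γ : List V.Ty}
    {ρ : List (Elem C)} (h : ρ.length = Γ.length)
    (hθ : ∀ i, θ (v i) = ρ.getD i (Elem.int 0)) : ctxVals θ v Γ = ρ := by
  apply List.ext_getElem
  · simp [ctxVals, h]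
  · intro i h1 h2
    simp [ctxVals, hθ, h2]

theorem Simple.ground_tr {Z : Type} (θ : Z → Elem C) (v : ℕ → Z) {Γ : List V.Ty}
    {s : Option V.Ty} (x : Simple V Γ s) :
    (x.tr v).ground θ = x.val (ctxVals θ v Γ) := by
  cases x with
  | var i h =>
    rw [Simple.val, ctxVals_getD _ _ (List.getElem?_eq_some_iff.1 h).1]
    rfl
  | int k h => rfl
  | num k => rfl

/-! ### Type atoms -/

/-- The type atoms in `J` are the right ones. -/
def TypesExact (J : Set (GAtom C (ASym V))) : Prop :=
  ∀ T l, (ASym.ty T, l) ∈ J ↔ ∃ d ∈ V.dom T, l = [d]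

theorem TypesExact.singleton {J : Set (GAtom C (ASym V))} (hJ : TypesExact J) {T : V.Ty}
    {d : Elem C} : (ASym.ty T, [d]) ∈ J ↔ d ∈ V.dom T := by
  simp [hJ T]

theorem TypesExact.tyAtom {J : Set (GAtom C (ASym V))} (hJ : TypesExact J) {Z : Type}
    {θ : Z → Elem C} {T : V.Ty} {t : ATerm C Z} :
    (tyAtom T t).ground θ ∈ J ↔ t.ground θ ∈ V.dom T :=
  hJ.singleton

theorem guards_hold_iff {I J : Set (GAtom C (ASym V))} (hJ : TypesExact J) {Z : Type}
    {θ : Z → Elem C} {v : ℕ → Z} {Γ : List V.Ty} :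
    (∀ L ∈ guards v Γ, L.holdsReduct I J θ) ↔ V.Typed Γ (ctxVals θ v Γ) := by
  rw [Vocabulary.typed_iff_get]
  simp only [guards, List.forall_mem_map, Prod.forall, List.mem_zipIdx_iff_getElem?,
    ALit.holdsReduct, hJ.tyAtom, ATerm.ground]
  constructor
  · refine fun h => ⟨by simp [ctxVals], fun i T d hT hd => ?_⟩
    obtain ⟨hi, rfl⟩ := List.getElem?_eq_some_iff.1 hd
    simpa [ctxVals] using h T i hT
  · rintro ⟨-, h⟩ T i hT
    have hi := (List.getElem?_eq_some_iff.1 hT).1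
    exact h i T _ hT (by simp [ctxVals, hi])

theorem Simple.guard_holds {I J : Set (GAtom C (ASym V))} (hJ : TypesExact J) {Z : Type}
    {θ : Z → Elem C} {v : ℕ → Z} {Γ : List V.Ty} (hΓ : V.Typed Γ (ctxVals θ v Γ))
    {s : Option V.Ty} (x : Simple V Γ s) : ∀ L ∈ x.guard v, L.holdsReduct I J θ := by
  cases s with
  | none => simp [Simple.guard]
  | some T =>
    simp only [Simple.guard, List.mem_singleton, forall_eq, ALit.holdsReduct, hJ.tyAtom,
      Simple.ground_tr]
    exact x.val_mem hΓ

theorem litLits_hold {I J : Set (GAtom C (ASym V))} (hJ : TypesExact J) {Z : Type}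
    {θ : Z → Elem C} {b : Bool} {R : RelSym V} {Ts : List V.Ty} {args : List (ATerm C Z)}
    (hargs : V.Typed Ts (args.map (ATerm.ground θ)))
    (h : if b then (ASym.rel R, args.map (ATerm.ground θ)) ∈ J
      else (ASym.rel R, args.map (ATerm.ground θ)) ∉ I) :
    ∀ L ∈ litLits b R Ts args, L.holdsReduct I J θ := by
  simp only [litLits, List.forall_mem_cons, List.forall_mem_map, ALit.holdsReduct, hJ.tyAtom,
    Prod.forall]
  refine ⟨?_, fun T t ht => ?_⟩
  · cases b
    · exact h
    · exact h
  · have h' : List.Forall₂ (fun T t => ATerm.ground θ t ∈ V.dom T) Ts args := by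
      rw [Vocabulary.Typed, List.forall₂_map_left_iff] at hargs
      exact hargs.flip
    exact (List.forall₂_iff_zip.1 h').2 ht

theorem redLit_of_litLits {I J : Set (GAtom C (ASym V))} {X Y : Set (GFact V)}
    (relI : ∀ x : GFact V, (ASym.rel x.1, x.2) ∈ I ↔ x ∈ X)
    (relJ : ∀ x : GFact V, (ASym.rel x.1, x.2) ∈ J ↔ x ∈ Y) {Z : Type}
    {θ : Z → Elem C} {b : Bool} {R : RelSym V} {Ts : List V.Ty} {args : List (ATerm C Z)}
    (h : ∀ L ∈ litLits b R Ts args, L.holdsReduct I J θ) :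
    redLit X Y b (R, args.map (ATerm.ground θ)) := by
  have := h _ List.mem_cons_self
  cases b
  · exact fun h' => this ((relI (_, _)).2 h')
  · exact (relJ (_, _)).1 this

/-! ### Cardinality aggregates -/

theorem count_holds_iff {J : Set (GAtom C (ASym V))} (hJ : TypesExact J) {Z : Type}
    {θ : Z → Elem C} {v : ℕ → Z} {Γ Ts : List V.Ty} {φ : NF V (Ts ++ Γ)} {op : CmpOp}
    {z : ATerm C Z} :
    (ALit.count Ts.length
      ((true, ⟨.cond Ts φ, ctxVars (localVar Ts.length v) (Ts ++ Γ)⟩) ::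
        Ts.zipIdx.map fun p => (true, tyAtom p.1 (.var (localVar Ts.length v p.2))))
      op z).holds J θ ↔
    op.holds (Elem.int (({l | V.Typed Ts l ∧
      (ASym.cond Ts φ, l ++ ctxVals θ v Γ) ∈ J}.ncard : ℕ) : ℤ)) (z.ground θ) := by
  have himg : List.ofFn '' {d : Fin Ts.length → Elem C |
      ∀ c ∈ ((true, ⟨.cond Ts φ, ctxVars (localVar Ts.length v) (Ts ++ Γ)⟩) ::
        Ts.zipIdx.map fun p => (true, tyAtom p.1 (.var (localVar Ts.length v p.2))) :
          List (Bool × AAtom C (ASym V) (Z ⊕ Fin Ts.length))),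
        (c.1 = true ↔ c.2.ground (Sum.elim θ d) ∈ J)} =
      {l | V.Typed Ts l ∧ (ASym.cond Ts φ, l ++ ctxVals θ v Γ) ∈ J} := by
    have hd : ∀ d : Fin Ts.length → Elem C,
        (∀ c ∈ ((true, ⟨.cond Ts φ, ctxVars (localVar Ts.length v) (Ts ++ Γ)⟩) ::
          Ts.zipIdx.map fun p => (true, tyAtom p.1 (.var (localVar Ts.length v p.2))) :
            List (Bool × AAtom C (ASym V) (Z ⊕ Fin Ts.length))),
          (c.1 = true ↔ c.2.ground (Sum.elim θ d) ∈ J)) ↔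
        V.Typed Ts (List.ofFn d) ∧ (ASym.cond Ts φ, List.ofFn d ++ ctxVals θ v Γ) ∈ J := by
      intro d
      rw [Vocabulary.typed_iff_get]
      simp only [List.forall_mem_cons, List.forall_mem_map, hJ.tyAtom, Prod.forall, true_iff,
        List.mem_zipIdx_iff_getElem?]
      rw [AAtom.ground, ctxVars_ground, ctxVals_localVar, and_comm]
      refine and_congr_left fun _ => ?_
      constructor
      · refine fun h => ⟨by simp, fun i T x hT hx => ?_⟩
        have hi := (List.getElem?_eq_some_iff.1 hT).1
        have := h T i hT
        simp only [ATerm.ground, localVar, hi, dif_pos, Sum.elim_inr] at this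
        simp only [List.getElem?_ofFn, hi, dif_pos, Option.some.injEq] at hx
        rwa [← hx]
      · rintro ⟨-, h⟩ T i hT
        have hi := (List.getElem?_eq_some_iff.1 hT).1
        simp only [ATerm.ground, localVar, hi, dif_pos, Sum.elim_inr]
        exact h i T _ hT (by simp [hi])
    ext l
    constructor
    · rintro ⟨d, h, rfl⟩
      exact (hd d).1 h
    · intro h
      have hlen := h.1.length_eq
      have hl : List.ofFn (fun i : Fin Ts.length => l[i]) = l := by
        apply List.ext_getElem <;> simp [hlen]
      refine ⟨_, (hd _).2 ?_, hl⟩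
      rw [hl]
      exact h
  have hinj : Function.Injective (List.ofFn : (Fin Ts.length → Elem C) → List (Elem C)) :=
    List.ofFn_injective
  have hfin := Vocabulary.finite_typed_sep (V := V) Ts
    fun l => (ASym.cond Ts φ, l ++ ctxVals θ v Γ) ∈ J
  rw [ALit.holds, ← himg, Set.ncard_image_of_injective _ hinj]
  rw [← himg] at hfin
  exact and_iff_right (Set.Finite.of_finite_image hfin hinj.injOn)

theorem ncard_singleton_block (T : V.Ty) (p : List (Elem C) → Prop) :
    {l | V.Typed [T] l ∧ p l}.ncard = (V.dom T).card ↔ ∀ d ∈ V.dom T, p [d] := by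
  have hcard : {l | V.Typed [T] l}.ncard = (V.dom T).card := by simp [Vocabulary.ncard_typed]
  rw [← hcard]
  constructor
  · intro h d hd
    have hsub : {l | V.Typed [T] l ∧ p l} ⊆ {l | V.Typed [T] l} := fun _ h => h.1
    have := Set.eq_of_subset_of_ncard_le hsub h.ge (Vocabulary.finite_typed _)
    have hm : [d] ∈ {l | V.Typed [T] l} := Vocabulary.typed_singleton_iff.2 ⟨d, hd, rfl⟩
    rw [← this] at hm
    exact hm.2
  · intro h
    congr 1
    ext l
    refine and_iff_left_of_imp fun hl => ?_
    obtain ⟨d, hd, rfl⟩ := Vocabulary.typed_singleton_iff.1 hl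
    exact h d hd

theorem Elem.int_inj {k k' : ℤ} : (Elem.int k : Elem C) = Elem.int k' ↔ k = k' := by
  simp [Elem.int]

theorem ALit.holdsReduct_self_of_subset {Q : Type u} {Z : Type} {I J : Set (GAtom C Q)}
    (h : J ⊆ I) {θ : Z → Elem C} {L : ALit C Q Z} (hL : L.holdsReduct I J θ) :
    L.holdsReduct I I θ := by
  cases L with
  | pos a => exact h hL
  | naf a => exact hL
  | cmp s op t => exact hL
  | count m conds op t => exact ⟨hL.1, hL.1⟩

/-! ### Bodies that hold in the reduct -/

/-- The translation of `φ` holds in `J`, in the reduct with respect to `I`, for suitable values of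
the implicitly quantified variables. -/
def NF.Realized (I J : Set (GAtom C (ASym V))) {Γ : List V.Ty} (φ : NF V Γ)
    (ρ : List (Elem C)) : Prop :=
  ∃ η : φ.ExVar → Elem C, ∀ (Z : Type) (v : ℕ → Z) (e : φ.ExVar → Z) (θ : Z → Elem C),
    ctxVals θ v Γ = ρ → (∀ x, θ (e x) = η x) → ∀ L ∈ φ.conj v e, L.holdsReduct I J θ

section Realized

variable {I J : Set (GAtom C (ASym V))} {Γ : List V.Ty} {ρ : List (Elem C)}

theorem Simple.typed_args {Ts : List V.Ty} (hρ : V.Typed Γ ρ)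
    (args : ∀ i : Fin Ts.length, Simple V Γ (some (Ts.get i))) :
    V.Typed Ts (List.ofFn fun i => (args i).val ρ) :=
  Vocabulary.typed_ofFn fun i => (args i).val_mem hρ

theorem Simple.map_ground_ofFn {Z : Type} (θ : Z → Elem C) (v : ℕ → Z) {Ts : List V.Ty}
    (args : ∀ i : Fin Ts.length, Simple V Γ (some (Ts.get i))) :
    (List.ofFn fun i => (args i).tr v).map (ATerm.ground θ) =
      List.ofFn fun i => (args i).val (ctxVals θ v Γ) := by
  rw [List.map_ofFn]
  congr 1
  funext i
  exact (args i).ground_tr θ v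

theorem NF.realized_lit (hJ : TypesExact J) (hρ : V.Typed Γ ρ) {b r : Bool} {P : V.Pred}
    {args : ∀ i : Fin (V.predTy P).length, Simple V Γ (some ((V.predTy P).get i))}
    (h : if b then (ASym.rel (.of r P), List.ofFn fun i => (args i).val ρ) ∈ J
      else (ASym.rel (.of r P), List.ofFn fun i => (args i).val ρ) ∉ I) :
    (NF.lit b r P args).Realized I J ρ := by
  refine ⟨Empty.elim, ?_⟩
  rintro Z v e θ rfl -
  refine litLits_hold hJ ?_ ?_ <;> rw [Simple.map_ground_ofFn]
  · exact Simple.typed_args hρ args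
  · exact h

theorem NF.realized_fn (hJ : TypesExact J) (hρ : V.Typed Γ ρ) {b : Bool} {F : V.Func}
    {args : ∀ i : Fin (V.funcArgs F).length, Simple V Γ (some ((V.funcArgs F).get i))}
    {y : Simple V Γ (some (V.funcRes F))}
    (h : if b then (ASym.rel (.graph F), (List.ofFn fun i => (args i).val ρ) ++ [y.val ρ]) ∈ J
      else (ASym.rel (.graph F), (List.ofFn fun i => (args i).val ρ) ++ [y.val ρ]) ∉ I) :
    (NF.fn b F args y).Realized I J ρ := by
  refine ⟨Empty.elim, ?_⟩
  rintro Z v e θ rfl -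
  refine litLits_hold hJ ?_ ?_ <;>
    rw [List.map_append, Simple.map_ground_ofFn, List.map_singleton, Simple.ground_tr]
  · exact (Simple.typed_args hρ args).append
      (Vocabulary.typed_singleton_iff.2 ⟨_, y.val_mem hρ, rfl⟩)
  · exact h

theorem NF.realized_cmp (hJ : TypesExact J) (hρ : V.Typed Γ ρ) {s s' : Option V.Ty}
    {x : Simple V Γ s} {op : CmpOp} {y : Simple V Γ s'} (h : op.holds (x.val ρ) (y.val ρ)) :
    (NF.cmp x op y).Realized I J ρ := by
  refine ⟨Empty.elim, ?_⟩
  rintro Z v e θ rfl -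
  simp only [NF.conj, List.mem_cons, List.mem_append, forall_eq_or_imp, ALit.holdsReduct,
    Simple.ground_tr]
  exact ⟨h, fun L hL => hL.elim (x.guard_holds hJ hρ L) (y.guard_holds hJ hρ L)⟩

theorem countLits_hold (hI : TypesExact I) (hJ : TypesExact J) {Z : Type} {v : ℕ → Z}
    {θ : Z → Elem C} (hρ : V.Typed Γ (ctxVals θ v Γ)) {Ts : List V.Ty} {φ : NF V (Ts ++ Γ)}
    {op : CmpOp} {z : ATerm C Z} {g : List (ALit C (ASym V) Z)}
    (hg : ∀ L ∈ g, L.holdsReduct I J θ)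
    (hIc : op.holds (Elem.int (({l | V.Typed Ts l ∧
      (ASym.cond Ts φ, l ++ ctxVals θ v Γ) ∈ I}.ncard : ℕ) : ℤ)) (z.ground θ))
    (hJc : op.holds (Elem.int (({l | V.Typed Ts l ∧
      (ASym.cond Ts φ, l ++ ctxVals θ v Γ) ∈ J}.ncard : ℕ) : ℤ)) (z.ground θ)) :
    ∀ L ∈ countLits v Ts φ op z g, L.holdsReduct I J θ := by
  simp only [countLits, List.mem_cons, List.mem_append, forall_eq_or_imp]
  refine ⟨⟨(count_holds_iff hI).2 hIc, (count_holds_iff hJ).2 hJc⟩, fun L hL => hL.elim ?_ (hg L)⟩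
  exact (guards_hold_iff hJ).2 hρ L

theorem holds_of_countLits (hI : TypesExact I) (hJ : TypesExact J) {Z : Type} {v : ℕ → Z}
    {θ : Z → Elem C} {Ts : List V.Ty} {φ : NF V (Ts ++ Γ)}
    {op : CmpOp} {z : ATerm C Z} {g : List (ALit C (ASym V) Z)}
    (h : ∀ L ∈ countLits v Ts φ op z g, L.holdsReduct I J θ) :
    op.holds (Elem.int (({l | V.Typed Ts l ∧
      (ASym.cond Ts φ, l ++ ctxVals θ v Γ) ∈ I}.ncard : ℕ) : ℤ)) (z.ground θ) ∧
    op.holds (Elem.int (({l | V.Typed Ts l ∧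
      (ASym.cond Ts φ, l ++ ctxVals θ v Γ) ∈ J}.ncard : ℕ) : ℤ)) (z.ground θ) := by
  have := h _ List.mem_cons_self
  exact ⟨(count_holds_iff hI).1 this.1, (count_holds_iff hJ).1 this.2⟩

theorem NF.realized_count (hI : TypesExact I) (hJ : TypesExact J) (hρ : V.Typed Γ ρ)
    {s : Option V.Ty} {Ts : List V.Ty} {φ : NF V (Ts ++ Γ)} {op : CmpOp} {z : Simple V Γ s}
    (hIc : op.holds (Elem.int (({l | V.Typed Ts l ∧
      (ASym.cond Ts φ, l ++ ρ) ∈ I}.ncard : ℕ) : ℤ)) (z.val ρ))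
    (hJc : op.holds (Elem.int (({l | V.Typed Ts l ∧
      (ASym.cond Ts φ, l ++ ρ) ∈ J}.ncard : ℕ) : ℤ)) (z.val ρ)) :
    (NF.count Ts φ op z).Realized I J ρ := by
  refine ⟨Empty.elim, ?_⟩
  rintro Z v e θ rfl -
  rw [← Simple.ground_tr] at hIc hJc
  exact countLits_hold hI hJ hρ (z.guard_holds hJ hρ) hIc hJc

theorem NF.realized_all (hI : TypesExact I) (hJ : TypesExact J) (hρ : V.Typed Γ ρ)
    {T : V.Ty} {φ : NF V (T :: Γ)}
    (hIc : ∀ d ∈ V.dom T, (ASym.cond (Γ := Γ) [T] φ, d :: ρ) ∈ I)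
    (hJc : ∀ d ∈ V.dom T, (ASym.cond (Γ := Γ) [T] φ, d :: ρ) ∈ J) :
    (NF.all T φ).Realized I J ρ := by
  refine ⟨Empty.elim, ?_⟩
  rintro Z v e θ rfl -
  refine countLits_hold hI hJ hρ (by simp) ?_ ?_ <;>
    refine Elem.int_inj.2 (Nat.cast_inj.2 ((ncard_singleton_block T _).2 ?_))
  · exact hIc
  · exact hJc

theorem NF.realized_and {φ ψ : NF V Γ} (hφ : φ.Realized I J ρ) (hψ : ψ.Realized I J ρ) :
    (NF.and φ ψ).Realized I J ρ := by
  obtain ⟨η, hη⟩ := hφ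
  obtain ⟨η', hη'⟩ := hψ
  refine ⟨Sum.elim η η', fun Z v e θ hv he L hL => ?_⟩
  rcases List.mem_append.1 hL with hL | hL
  · exact hη Z v _ θ hv (fun x => he (.inl x)) L hL
  · exact hη' Z v _ θ hv (fun x => he (.inr x)) L hL

theorem NF.realized_or {φ ψ : NF V Γ} (h : (ASym.disj φ ψ, ρ) ∈ J) :
    (NF.or φ ψ).Realized I J ρ := by
  refine ⟨Empty.elim, ?_⟩
  rintro Z v e θ rfl -
  simpa [NF.conj, ALit.holdsReduct, AAtom.ground, ctxVars_ground] using h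

theorem NF.realized_ex (hJ : TypesExact J) {T : V.Ty} {φ : NF V (T :: Γ)} {d : Elem C}
    (hd : d ∈ V.dom T) (h : φ.Realized I J (d :: ρ)) : (NF.ex T φ).Realized I J ρ := by
  obtain ⟨η, hη⟩ := h
  refine ⟨fun x => x.elim d η, fun Z v e θ hv he L hL => ?_⟩
  have he0 : θ (e none) = d := he none
  rcases List.mem_append.1 hL with hL | hL
  · refine hη Z _ _ θ ?_ (fun x => he (some x)) L hL
    rw [ctxVals_consVar, he0, hv]
  · rw [List.mem_singleton] at hL
    subst hL
    refine hJ.tyAtom.2 ?_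
    rw [ATerm.ground, he0]
    exact hd

end Realized

/-! ### Auxiliary symbols and their rules -/

/-- The auxiliary symbol `s` is defined by a rule with body `φ`. -/
inductive ASym.Body : ASym V → (Γ : List V.Ty) → NF V Γ → Prop
  | disjLeft {Γ : List V.Ty} (φ ψ : NF V Γ) : ASym.Body (.disj φ ψ) Γ φ
  | disjRight {Γ : List V.Ty} (φ ψ : NF V Γ) : ASym.Body (.disj φ ψ) Γ ψ
  | cond {Γ : List V.Ty} (Ts : List V.Ty) (φ : NF V (Ts ++ Γ)) :
      ASym.Body (.cond (Γ := Γ) Ts φ) (Ts ++ Γ) φ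
  | reif (φ : NF V []) : ASym.Body (.reif φ) [] φ

/-- The auxiliary symbols. -/
def ASym.IsAux : ASym V → Prop
  | .ty _ => False
  | .rel _ => False
  | _ => True

/-- All rules on which an auxiliary symbol depends. -/
def ASym.rules : ASym V → Set (ARule C (ASym V))
  | .ty _ => ∅
  | .rel _ => ∅
  | .disj φ ψ => (NF.or φ ψ).auxRules
  | .cond Ts φ => {ruleFor (.cond Ts φ) φ} ∪ φ.auxRules
  | .reif φ => {ruleFor (.reif φ) φ} ∪ φ.auxRules

/-- The atom of an auxiliary symbol should hold. -/
def ASym.Holds (X Y : Set (GFact V)) (s : ASym V) (l : List (Elem C)) : Prop :=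
  ∃ Γ φ, s.Body Γ φ ∧ V.Typed Γ l ∧ φ.red X Y l

theorem ASym.Body.isAux {s : ASym V} {Γ : List V.Ty} {φ : NF V Γ} (h : s.Body Γ φ) : s.IsAux := by
  cases h <;> trivial

theorem ASym.Body.rule_mem {s : ASym V} {Γ : List V.Ty} {φ : NF V Γ} (h : s.Body Γ φ) :
    ruleFor s φ ∈ s.rules := by
  cases h <;> simp [ASym.rules, NF.auxRules]

theorem ASym.Body.auxRules_subset {s : ASym V} {Γ : List V.Ty} {φ : NF V Γ} (h : s.Body Γ φ) :
    φ.auxRules ⊆ s.rules := by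
  cases h <;> intro r hr <;> simp [ASym.rules, NF.auxRules, hr]

theorem ASym.holds_cond {X Y : Set (GFact V)} {Γ Ts : List V.Ty} {φ : NF V (Ts ++ Γ)}
    {l : List (Elem C)} :
    (ASym.cond Ts φ).Holds X Y l ↔ V.Typed (Ts ++ Γ) l ∧ φ.red X Y l := by
  constructor
  · rintro ⟨_, _, h, h'⟩
    cases h
    exact h'
  · exact fun h => ⟨_, _, .cond Ts φ, h⟩

theorem ASym.holds_disj {X Y : Set (GFact V)} {Γ : List V.Ty} {φ ψ : NF V Γ}
    {l : List (Elem C)} :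
    (ASym.disj φ ψ).Holds X Y l ↔ V.Typed Γ l ∧ (φ.red X Y l ∨ ψ.red X Y l) := by
  constructor
  · rintro ⟨_, _, h, h1, h2⟩
    cases h
    · exact ⟨h1, .inl h2⟩
    · exact ⟨h1, .inr h2⟩
  · rintro ⟨h1, h2 | h2⟩
    · exact ⟨_, _, .disjLeft φ ψ, h1, h2⟩
    · exact ⟨_, _, .disjRight φ ψ, h1, h2⟩

theorem ASym.holds_reif {X Y : Set (GFact V)} {φ : NF V []} {l : List (Elem C)} :
    (ASym.reif φ).Holds X Y l ↔ l = [] ∧ φ.red X Y [] := by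
  constructor
  · rintro ⟨_, _, h, h1, h2⟩
    cases h
    rw [Vocabulary.typed_nil_iff] at h1
    subst h1
    exact ⟨rfl, h2⟩
  · rintro ⟨rfl, h⟩
    exact ⟨_, _, .reif φ, Vocabulary.typed_nil_iff.2 rfl, h⟩

theorem NF.exists_body_of_mem_auxRules {Γ : List V.Ty} (φ : NF V Γ) :
    ∀ r ∈ φ.auxRules, ∃ (s : ASym V) (Γ' : List V.Ty) (ψ : NF V Γ'),
      s.Body Γ' ψ ∧ s.rules ⊆ φ.auxRules ∧ r = ruleFor s ψ := by
  induction φ with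
  | lit => simp [NF.auxRules]
  | fn => simp [NF.auxRules]
  | cmp => simp [NF.auxRules]
  | count Ts φ op z ih =>
    rintro r (rfl | hr)
    · exact ⟨_, _, _, .cond Ts φ, subset_rfl, rfl⟩
    · obtain ⟨s, Γ', ψ, h, h', h''⟩ := ih r hr
      exact ⟨s, Γ', ψ, h, h'.trans Set.subset_union_right, h''⟩
  | and φ ψ ih ih' =>
    rintro r (hr | hr)
    · obtain ⟨s, Γ', χ, h, h', h''⟩ := ih r hr
      exact ⟨s, Γ', χ, h, h'.trans Set.subset_union_left, h''⟩
    · obtain ⟨s, Γ', χ, h, h', h''⟩ := ih' r hr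
      exact ⟨s, Γ', χ, h, h'.trans Set.subset_union_right, h''⟩
  | or φ ψ ih ih' =>
    rintro r ((rfl | rfl) | hr | hr)
    · exact ⟨_, _, _, .disjLeft φ ψ, subset_rfl, rfl⟩
    · exact ⟨_, _, _, .disjRight φ ψ, subset_rfl, rfl⟩
    · obtain ⟨s, Γ', χ, h, h', h''⟩ := ih r hr
      exact ⟨s, Γ', χ, h,
        h'.trans (Set.subset_union_left.trans Set.subset_union_right), h''⟩
    · obtain ⟨s, Γ', χ, h, h', h''⟩ := ih' r hr
      exact ⟨s, Γ', χ, h,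
        h'.trans (Set.subset_union_right.trans Set.subset_union_right), h''⟩
  | ex T φ ih => exact ih
  | all T φ ih =>
    rintro r (rfl | hr)
    · exact ⟨_, _, _, .cond [T] φ, subset_rfl, rfl⟩
    · obtain ⟨s, Γ', ψ, h, h', h''⟩ := ih r hr
      exact ⟨s, Γ', ψ, h, h'.trans Set.subset_union_right, h''⟩

/-! ### The translation of a formula holds iff the formula does -/

/-- The translation of `φ` holds iff `φ` is true in the reduct. -/
def NF.Exact (I J : Set (GAtom C (ASym V))) (X Y : Set (GFact V)) {Γ : List V.Ty}
    (φ : NF V Γ) : Prop :=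
  ∀ ρ, V.Typed Γ ρ →
    (∀ (Z : Type) (v : ℕ → Z) (e : φ.ExVar → Z) (θ : Z → Elem C), ctxVals θ v Γ = ρ →
      (∀ L ∈ φ.conj v e, L.holdsReduct I J θ) → φ.red X Y ρ) ∧
    (φ.red X Y ρ → φ.Realized I J ρ)

theorem NF.red_mono {X Y : Set (GFact V)} (h : Y ⊆ X) {Γ : List V.Ty} (φ : NF V Γ) :
    ∀ {ρ : List (Elem C)}, φ.red X Y ρ → φ.red X X ρ := by
  have hlit : ∀ b x, redLit X Y b x → redLit X X b x := by
    intro b x hx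
    cases b
    · exact hx
    · exact h hx
  induction φ with
  | lit b r P args => exact hlit _ _
  | fn b F args y => exact hlit _ _
  | cmp x op y => exact id
  | count Ts φ op z ih => exact fun hx => ⟨hx.1, hx.1⟩
  | and φ ψ ih ih' => exact fun hx => ⟨ih hx.1, ih' hx.2⟩
  | or φ ψ ih ih' => exact fun hx => hx.imp ih ih'
  | ex T φ ih => exact fun ⟨d, hd, hx⟩ => ⟨d, hd, ih hx⟩
  | all T φ ih => exact fun hx d hd => ih (hx d hd)

theorem NF.exact_of_auxRules_subset {I J : Set (GAtom C (ASym V))} {X Y : Set (GFact V)}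
    {Pg : Set (ARule C (ASym V))} (hYX : Y ⊆ X) (hI : TypesExact I)
    (hJ : TypesExact J)
    (relI : ∀ x : GFact V, (ASym.rel x.1, x.2) ∈ I ↔ x ∈ X)
    (relJ : ∀ x : GFact V, (ASym.rel x.1, x.2) ∈ J ↔ x ∈ Y)
    (auxI : ∀ s : ASym V, s.IsAux → s.rules ⊆ Pg →
      (∀ Γ φ, s.Body Γ φ → φ.Exact I J X Y) → ∀ l, (s, l) ∈ I ↔ s.Holds X X l)
    (auxJ : ∀ s : ASym V, s.IsAux → s.rules ⊆ Pg →
      (∀ Γ φ, s.Body Γ φ → φ.Exact I J X Y) → ∀ l, (s, l) ∈ J ↔ s.Holds X Y l)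
    {Γ : List V.Ty} (φ : NF V Γ) : φ.auxRules ⊆ Pg → φ.Exact I J X Y := by
  induction φ with
  | lit b r P args =>
    intro _ ρ hρ
    refine ⟨?_, fun h => NF.realized_lit hJ hρ ?_⟩
    · rintro Z v e θ rfl h
      have := redLit_of_litLits relI relJ h
      rwa [Simple.map_ground_ofFn] at this
    · cases b
      · exact fun h' => h ((relI (_, _)).1 h')
      · exact (relJ (_, _)).2 h
  | fn b F args y =>
    intro _ ρ hρ
    refine ⟨?_, fun h => NF.realized_fn hJ hρ ?_⟩
    · rintro Z v e θ rfl h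
      have := redLit_of_litLits relI relJ h
      rwa [List.map_append, Simple.map_ground_ofFn, List.map_singleton, Simple.ground_tr] at this
    · cases b
      · exact fun h' => h ((relI (_, _)).1 h')
      · exact (relJ (_, _)).2 h
  | cmp x op y =>
    intro _ ρ hρ
    refine ⟨?_, fun h => NF.realized_cmp hJ hρ h⟩
    rintro Z v e θ rfl h
    have := h _ List.mem_cons_self
    rw [ALit.holdsReduct, Simple.ground_tr, Simple.ground_tr] at this
    exact this
  | @count Γ s Ts φ op z ih =>
    intro hPg ρ hρ
    have hex : ∀ Γ' φ', (ASym.cond (Γ := Γ) Ts φ).Body Γ' φ' → φ'.Exact I J X Y := by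
      intro Γ' φ' h
      cases h
      exact ih (Set.subset_union_right.trans hPg)
    have hcI : {l | V.Typed Ts l ∧ (ASym.cond Ts φ, l ++ ρ) ∈ I}.ncard =
        {l | V.Typed Ts l ∧ φ.red X X (l ++ ρ)}.ncard :=
      Vocabulary.ncard_typed_sep_congr _ fun l hl => by
        rw [auxI (.cond Ts φ) trivial hPg hex, ASym.holds_cond, and_iff_right (hl.append hρ)]
    have hcJ : {l | V.Typed Ts l ∧ (ASym.cond Ts φ, l ++ ρ) ∈ J}.ncard =
        {l | V.Typed Ts l ∧ φ.red X Y (l ++ ρ)}.ncard :=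
      Vocabulary.ncard_typed_sep_congr _ fun l hl => by
        rw [auxJ (.cond Ts φ) trivial hPg hex, ASym.holds_cond, and_iff_right (hl.append hρ)]
    refine ⟨?_, fun h => NF.realized_count hI hJ hρ ?_ ?_⟩
    · rintro Z v e θ rfl h
      have := holds_of_countLits hI hJ h
      rw [hcI, hcJ, Simple.ground_tr] at this
      exact this
    · rw [hcI]; exact h.1
    · rw [hcJ]; exact h.2
  | and φ ψ ih ih' =>
    intro hPg ρ hρ
    have h1 := ih (Set.subset_union_left.trans hPg) ρ hρ
    have h2 := ih' (Set.subset_union_right.trans hPg) ρ hρ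
    refine ⟨fun Z v e θ hv h => ⟨?_, ?_⟩, fun h => NF.realized_and (h1.2 h.1) (h2.2 h.2)⟩
    · exact h1.1 Z v _ θ hv fun L hL => h L (List.mem_append_left _ hL)
    · exact h2.1 Z v _ θ hv fun L hL => h L (List.mem_append_right _ hL)
  | @or Γ φ ψ ih ih' =>
    intro hPg ρ hρ
    have hex : ∀ Γ' φ', (ASym.disj φ ψ).Body Γ' φ' → φ'.Exact I J X Y := by
      intro Γ' φ' h
      cases h
      · exact ih ((Set.subset_union_left.trans Set.subset_union_right).trans hPg)
      · exact ih' ((Set.subset_union_right.trans Set.subset_union_right).trans hPg)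
    have hd : (ASym.disj φ ψ, ρ) ∈ J ↔ (NF.or φ ψ).red X Y ρ := by
      rw [auxJ (.disj φ ψ) trivial hPg hex, ASym.holds_disj, and_iff_right hρ]
      rfl
    refine ⟨?_, fun h => NF.realized_or (hd.2 h)⟩
    rintro Z v e θ rfl h
    have := h _ List.mem_cons_self
    rw [ALit.holdsReduct, AAtom.ground, ctxVars_ground] at this
    exact hd.1 this
  | ex T φ ih =>
    intro hPg ρ hρ
    refine ⟨fun Z v e θ hv h => ?_, fun ⟨d, hd, h⟩ =>
      NF.realized_ex hJ hd ((ih hPg _ (hρ.cons hd)).2 h)⟩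
    have hd : θ (e none) ∈ V.dom T :=
      hJ.tyAtom.1 (h (.pos (tyAtom T (.var (e none)))) (List.mem_append_right _ (by simp)))
    refine ⟨_, hd, (ih hPg _ (hρ.cons hd)).1 Z _ _ θ ?_ fun L hL =>
      h L (List.mem_append_left _ hL)⟩
    rw [ctxVals_consVar, hv]
  | @all Γ T φ ih =>
    intro hPg ρ hρ
    have hex : ∀ Γ' φ', (ASym.cond (Γ := Γ) [T] φ).Body Γ' φ' → φ'.Exact I J X Y := by
      intro Γ' φ' h
      cases h
      exact ih (Set.subset_union_right.trans hPg)
    have hcI : ∀ d ∈ V.dom T,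
        ((ASym.cond (Γ := Γ) [T] φ, d :: ρ) ∈ I ↔ φ.red X X (d :: ρ)) := fun d hd => by
      rw [auxI (.cond [T] φ) trivial hPg hex, ASym.holds_cond]
      exact and_iff_right (hρ.cons hd)
    have hcJ : ∀ d ∈ V.dom T,
        ((ASym.cond (Γ := Γ) [T] φ, d :: ρ) ∈ J ↔ φ.red X Y (d :: ρ)) := fun d hd => by
      rw [auxJ (.cond [T] φ) trivial hPg hex, ASym.holds_cond]
      exact and_iff_right (hρ.cons hd)
    refine ⟨?_, fun h => NF.realized_all hI hJ hρ
      (fun d hd => (hcI d hd).2 (φ.red_mono hYX (h d hd))) fun d hd => (hcJ d hd).2 (h d hd)⟩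
    rintro Z v e θ rfl h d hd
    have := (holds_of_countLits hI hJ h).2
    have := (ncard_singleton_block T _).1 (Nat.cast_inj.1 (Elem.int_inj.1 this)) d hd
    exact (hcJ d hd).1 this

/-! ### Rules that fire -/

theorem IsReductModel.rule_fires {I J : Set (GAtom C (ASym V))} {Pg : Set (ARule C (ASym V))}
    (h : IsReductModel Pg I J) (hJ : TypesExact J) {s : ASym V} {Γ : List V.Ty} {φ : NF V Γ}
    (hs : ruleFor s φ ∈ Pg) {ρ : List (Elem C)} (hρ : V.Typed Γ ρ) (hφ : φ.Realized I J ρ) :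
    (s, ρ) ∈ J := by
  obtain ⟨η, hη⟩ := hφ
  let θ : ℕ ⊕ φ.ExVar → Elem C := Sum.elim (fun i => ρ.getD i (Elem.int 0)) η
  have hθ : ctxVals θ Sum.inl Γ = ρ := ctxVals_of_length_eq _ _ hρ.length_eq fun _ => rfl
  have := h _ hs θ fun L hL => by
    rcases List.mem_append.1 hL with hL | hL
    · exact hη _ _ _ θ hθ (fun _ => rfl) L hL
    · exact (guards_hold_iff hJ).2 (hθ ▸ hρ) L hL
  simpa [ruleFor, AHead.holdsReduct, AAtom.ground, ctxVars_ground, hθ] using this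

/-- Formulas that are certain hold in all models of the reduct. -/
theorem NF.realized_of_certain {I J : Set (GAtom C (ASym V))} {X : Set (GFact V)}
    {Pg : Set (ARule C (ASym V))} (hI : TypesExact I) (hJ : TypesExact J) (hJI : J ⊆ I)
    (relI : ∀ x : GFact V, (ASym.rel x.1, x.2) ∈ I ↔ x ∈ X)
    (auxI : ∀ s : ASym V, s.IsAux → s.rules ⊆ Pg → ∀ l, (s, l) ∈ I ↔ s.Holds X X l)
    (hPg : IsReductModel Pg I J) {A : Approx V} (hA : A.Compat X {x | (ASym.rel x.1, x.2) ∈ J})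
    {Γ : List V.Ty} (φ : NF V Γ) :
    φ.auxRules ⊆ Pg → ∀ ρ, V.Typed Γ ρ → φ.ev A .certain ρ → φ.Realized I J ρ := by
  have hAX : A.Compat X X := hA.self fun x hx => (relI x).1 (hJI hx)
  have hlit : ∀ b (x : GFact V), A.lit .certain b x →
      if b then (ASym.rel x.1, x.2) ∈ J else (ASym.rel x.1, x.2) ∉ I := by
    intro b x hx
    cases b
    · exact fun h => hA.fa_disj x hx ((relI x).1 h)
    · exact hA.tr_sub hx
  induction φ with
  | lit b r P args => exact fun _ ρ hρ h => NF.realized_lit hJ hρ (hlit _ _ h)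
  | fn b F args y => exact fun _ ρ hρ h => NF.realized_fn hJ hρ (hlit _ _ h)
  | cmp x op y => exact fun _ ρ hρ h => NF.realized_cmp hJ hρ h
  | @count Γ s Ts φ op z ih =>
    intro hsub ρ hρ h
    have hfire : ∀ l, V.Typed Ts l → φ.ev A .certain (l ++ ρ) → (ASym.cond Ts φ, l ++ ρ) ∈ J :=
      fun l hl hc => hPg.rule_fires hJ (hsub (ASym.Body.cond Ts φ).rule_mem) (hl.append hρ)
        (ih (Set.subset_union_right.trans hsub) _ (hl.append hρ) hc)
    have hposs : ∀ l, V.Typed Ts l → (ASym.cond Ts φ, l ++ ρ) ∈ I →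
        φ.ev A (.possible ∅) (l ++ ρ) := fun l hl hl' => by
      rw [auxI (.cond Ts φ) trivial hsub, ASym.holds_cond] at hl'
      exact (φ.red_between subset_rfl hAX _).2 ∅ (by simp) hl'.2
    exact NF.realized_count hI hJ hρ
      (h _ (Vocabulary.ncard_typed_sep_mono _ fun l hl hc => hJI (hfire l hl hc))
        (Vocabulary.ncard_typed_sep_mono _ hposs))
      (h _ (Vocabulary.ncard_typed_sep_mono _ hfire)
        (Vocabulary.ncard_typed_sep_mono _ fun l hl hc => hposs l hl (hJI hc)))
  | and φ ψ ih ih' =>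
    exact fun hsub ρ hρ h => NF.realized_and (ih (Set.subset_union_left.trans hsub) ρ hρ h.1)
      (ih' (Set.subset_union_right.trans hsub) ρ hρ h.2)
  | or φ ψ ih ih' =>
    intro hsub ρ hρ h
    refine NF.realized_or ?_
    rcases h with h | h
    · exact hPg.rule_fires hJ (hsub (ASym.Body.disjLeft φ ψ).rule_mem) hρ
        (ih ((ASym.Body.disjLeft φ ψ).auxRules_subset.trans hsub) ρ hρ h)
    · exact hPg.rule_fires hJ (hsub (ASym.Body.disjRight φ ψ).rule_mem) hρ
        (ih' ((ASym.Body.disjRight φ ψ).auxRules_subset.trans hsub) ρ hρ h)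
  | ex T φ ih =>
    exact fun hsub ρ hρ ⟨d, hd, h⟩ => NF.realized_ex hJ hd (ih hsub _ (hρ.cons hd) h)
  | @all Γ T φ ih =>
    intro hsub ρ hρ h
    have hfire : ∀ d ∈ V.dom T, (ASym.cond (Γ := Γ) [T] φ, d :: ρ) ∈ J := fun d hd =>
      hPg.rule_fires hJ (hsub (ASym.Body.cond (Γ := Γ) [T] φ).rule_mem) (hρ.cons hd)
        (ih (Set.subset_union_right.trans hsub) _ (hρ.cons hd) (h d hd))
    exact NF.realized_all hI hJ hρ (fun d hd => hJI (hfire d hd)) hfire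

end Programs

section AnswerSets

variable {C : Type} [LinearOrder C] {V : Vocabulary.{u} C}

/-! ### Completing a set of facts by auxiliary atoms -/

/-- The type atoms, the facts in `Y`, and the atoms of the auxiliary symbols defined in `Pg` whose
defining formula is true in the reduct given by `X` and `Y`. -/
def completion (Pg : Set (ARule C (ASym V))) (X Y : Set (GFact V)) : Set (GAtom C (ASym V)) :=
  {a | (∃ T, ∃ d ∈ V.dom T, a = (.ty T, [d])) ∨ (∃ x ∈ Y, a = (.rel x.1, x.2)) ∨
    (a.1.rules ⊆ Pg ∧ a.1.Holds X Y a.2)}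

section Completion

variable {Pg : Set (ARule C (ASym V))} {X Y : Set (GFact V)}

theorem ASym.Holds.isAux {s : ASym V} {l : List (Elem C)} (h : s.Holds X Y l) : s.IsAux := by
  obtain ⟨Γ, φ, h, -⟩ := h
  exact h.isAux

theorem typesExact_completion : TypesExact (completion Pg X Y) := by
  intro T l
  constructor
  · rintro (⟨T', d, hd, h⟩ | ⟨x, hx, h⟩ | ⟨-, h⟩)
    · simp only [Prod.mk.injEq, ASym.ty.injEq] at h
      obtain ⟨rfl, rfl⟩ := h
      exact ⟨d, hd, rfl⟩
    · simp at h
    · exact h.isAux.elim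
  · rintro ⟨d, hd, rfl⟩
    exact .inl ⟨T, d, hd, rfl⟩

theorem rel_mem_completion {x : GFact V} :
    (ASym.rel x.1, x.2) ∈ completion Pg X Y ↔ x ∈ Y := by
  constructor
  · rintro (⟨T', d, hd, h⟩ | ⟨y, hy, h⟩ | ⟨-, h⟩)
    · simp at h
    · simp only [Prod.mk.injEq, ASym.rel.injEq] at h
      obtain rfl : x = y := Prod.ext h.1 h.2
      exact hy
    · exact h.isAux.elim
  · exact fun h => .inr (.inl ⟨x, h, rfl⟩)

theorem aux_mem_completion {s : ASym V} (hs : s.IsAux) {l : List (Elem C)} :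
    (s, l) ∈ completion Pg X Y ↔ s.rules ⊆ Pg ∧ s.Holds X Y l := by
  constructor
  · rintro (⟨T', d, hd, h⟩ | ⟨y, hy, h⟩ | h)
    · simp only [Prod.mk.injEq] at h
      obtain ⟨rfl, -⟩ := h
      exact hs.elim
    · simp only [Prod.mk.injEq] at h
      obtain ⟨rfl, -⟩ := h
      exact hs.elim
    · exact h
  · exact fun h => .inr (.inr h)

theorem NF.exact_completion (hYX : Y ⊆ X) {Γ : List V.Ty} {φ : NF V Γ} (hφ : φ.auxRules ⊆ Pg) :
    φ.Exact (completion Pg X X) (completion Pg X Y) X Y :=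
  NF.exact_of_auxRules_subset hYX typesExact_completion typesExact_completion
    (fun _ => rel_mem_completion) (fun _ => rel_mem_completion)
    (fun _ hs hr _ _ => (aux_mem_completion hs).trans (and_iff_right hr))
    (fun _ hs hr _ _ => (aux_mem_completion hs).trans (and_iff_right hr)) φ hφ

theorem completion_mono (hYX : Y ⊆ X) : completion Pg X Y ⊆ completion Pg X X := by
  rintro a (h | ⟨x, hx, h⟩ | ⟨hr, Γ, φ, hb, ht, h⟩)
  · exact .inl h
  · exact .inr (.inl ⟨x, hYX hx, h⟩)
  · exact .inr (.inr ⟨hr, Γ, φ, hb, ht, φ.red_mono hYX h⟩)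

end Completion

/-! ### The rules of the translation -/

/-- All sentences that are reified by the translation. -/
def Problem.reified (M : Problem.{u} C) : Set (NF M.voc []) :=
  M.normTheory ∪ M.defn.eqTheory

section Alpha

variable {M : Problem.{u} C}

theorem Problem.alpha_cases {r : ARule C (ASym M.voc)} (hr : r ∈ M.alpha) :
    (∃ P, M.predI P = none ∧ r = choiceRule (.pred P) (M.voc.predTy P)) ∨
    (∃ F, M.funcI F = none ∧
      r = choiceRule (.graph F) (M.voc.funcArgs F ++ [M.voc.funcRes F])) ∨
    (∃ T, ∃ d ∈ M.voc.dom T, r = factRule (.ty T) [d]) ∨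
    (∃ P Z, M.predI P = some Z ∧ ∃ l ∈ Z, r = factRule (.rel (.pred P)) l.1) ∨
    (∃ F f, M.funcI F = some f ∧ ∃ l, r = factRule (.rel (.graph F)) (l.1 ++ [(f l).1])) ∨
    (∃ φ ∈ M.reified, r = ⟨Empty, .none, [.naf ⟨.reif φ, []⟩]⟩) ∨
    (∃ (s : ASym M.voc) (Γ : List M.voc.Ty) (φ : NF M.voc Γ),
      s.Body Γ φ ∧ s.rules ⊆ M.alpha ∧ r = ruleFor s φ) ∨
    (∃ ρ ∈ M.defn, r = ruleFor (.rel (.copy ρ.head)) (M.defn.renamedBody ρ)) := by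
  have h3 : alpha3 M.reified ⊆ M.alpha := fun x hx => .inl (.inr hx)
  have h4 : M.defn.alpha4 ⊆ M.alpha := fun x hx => .inr hx
  have haux : ∀ {Γ : List M.voc.Ty} (χ : NF M.voc Γ), χ.auxRules ⊆ M.alpha → r ∈ χ.auxRules →
      ∃ (s : ASym M.voc) (Γ : List M.voc.Ty) (φ : NF M.voc Γ),
        s.Body Γ φ ∧ s.rules ⊆ M.alpha ∧ r = ruleFor s φ := by
    intro Γ χ hχ hr
    obtain ⟨s, Γ', φ, hb, hs, h⟩ := χ.exists_body_of_mem_auxRules r hr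
    exact ⟨s, Γ', φ, hb, hs.trans hχ, h⟩
  have hr' : ∀ φ ∈ M.reified, (ASym.reif φ).rules ⊆ M.alpha := by
    rintro φ hφ x (rfl | hx)
    · exact h3 (.inl (.inl ⟨φ, hφ, rfl⟩))
    · exact h3 (.inl (.inr ⟨φ, hφ, hx⟩))
  rcases hr with (((h | h) | (h | h) | h) | (⟨φ, hφ, rfl⟩ | ⟨φ, hφ, h⟩) | h) | h | ⟨ρ, hρ, h⟩
  · exact .inl h
  · exact .inr (.inl h)
  · exact .inr (.inr (.inl h))
  · exact .inr (.inr (.inr (.inl h)))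
  · exact .inr (.inr (.inr (.inr (.inl h))))
  · exact .inr (.inr (.inr (.inr (.inr (.inr (.inl ⟨_, _, φ, .reif φ, hr' φ hφ, rfl⟩))))))
  · exact .inr (.inr (.inr (.inr (.inr (.inr (.inl
      (haux φ (Set.subset_union_right.trans (hr' φ hφ)) h)))))))
  · exact .inr (.inr (.inr (.inr (.inr (.inl h)))))
  · exact .inr (.inr (.inr (.inr (.inr (.inr (.inr h))))))
  · exact .inr (.inr (.inr (.inr (.inr (.inr (.inl
      (haux _ (fun x hx => h4 (.inr ⟨ρ, hρ, hx⟩)) h)))))))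

theorem Problem.choice_pred_mem {P : M.voc.Pred} (h : M.predI P = none) :
    choiceRule (.pred P) (M.voc.predTy P) ∈ M.alpha :=
  .inl (.inl (.inl (.inl ⟨P, h, rfl⟩)))

theorem Problem.choice_graph_mem {F : M.voc.Func} (h : M.funcI F = none) :
    choiceRule (.graph F) (M.voc.funcArgs F ++ [M.voc.funcRes F]) ∈ M.alpha :=
  .inl (.inl (.inl (.inr ⟨F, h, rfl⟩)))

theorem Problem.fact_ty_mem {T : M.voc.Ty} {d : Elem C} (h : d ∈ M.voc.dom T) :
    factRule (.ty T) [d] ∈ M.alpha :=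
  .inl (.inl (.inr (.inl (.inl ⟨T, d, h, rfl⟩))))

theorem Problem.fact_pred_mem {P : M.voc.Pred} {Z : Set (M.voc.Tuple (M.voc.predTy P))}
    (h : M.predI P = some Z) {l : M.voc.Tuple (M.voc.predTy P)} (hl : l ∈ Z) :
    factRule (.rel (.pred P)) l.1 ∈ M.alpha :=
  .inl (.inl (.inr (.inl (.inr ⟨P, Z, h, l, hl, rfl⟩))))

theorem Problem.fact_graph_mem {F : M.voc.Func}
    {f : M.voc.Tuple (M.voc.funcArgs F) → {d : Elem C // d ∈ M.voc.dom (M.voc.funcRes F)}}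
    (h : M.funcI F = some f) (l : M.voc.Tuple (M.voc.funcArgs F)) :
    factRule (.rel (.graph F)) (l.1 ++ [(f l).1]) ∈ M.alpha :=
  .inl (.inl (.inr (.inr ⟨F, f, h, l, rfl⟩)))

theorem Problem.constraint_mem {φ : NF M.voc []} (h : φ ∈ M.reified) :
    (⟨Empty, .none, [.naf ⟨.reif φ, []⟩]⟩ : ARule C (ASym M.voc)) ∈ M.alpha :=
  .inl (.inr (.inr ⟨φ, h, rfl⟩))

theorem Problem.reif_rules_subset {φ : NF M.voc []} (h : φ ∈ M.reified) :
    (ASym.reif φ).rules ⊆ M.alpha := by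
  rintro x (rfl | hx)
  · exact .inl (.inr (.inl (.inl ⟨φ, h, rfl⟩)))
  · exact .inl (.inr (.inl (.inr ⟨φ, h, hx⟩)))

theorem Problem.copy_rule_mem {ρ : DefRule M.voc} (h : ρ ∈ M.defn) :
    ruleFor (.rel (.copy ρ.head)) (M.defn.renamedBody ρ) ∈ M.alpha :=
  .inr (.inl ⟨ρ, h, rfl⟩)

theorem Problem.renamedBody_auxRules_subset {ρ : DefRule M.voc} (h : ρ ∈ M.defn) :
    (M.defn.renamedBody ρ).auxRules ⊆ M.alpha :=
  fun _ hx => .inr (.inr ⟨ρ, h, hx⟩)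

end Alpha

/-! ### Facts, choices and constraints in models of a reduct -/

section Models

variable {I J : Set (GAtom C (ASym V))} {Pg : Set (ARule C (ASym V))}

theorem ctxAtom_ground {Z : Type} (s : ASym V) (θ : Z → Elem C) (v : ℕ → Z) (Γ : List V.Ty) :
    AAtom.ground θ ⟨s, ctxVars v Γ⟩ = (s, ctxVals θ v Γ) := by
  rw [AAtom.ground, ctxVars_ground]

theorem factRule_ground (s : ASym V) (l : List (Elem C)) (θ : Empty → Elem C) :
    AAtom.ground θ ⟨s, l.map .const⟩ = (s, l) := by
  simp [AAtom.ground, Function.comp_def, ATerm.ground]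

theorem IsReductModel.fact (h : IsReductModel Pg I J) {s : ASym V} {l : List (Elem C)}
    (hs : factRule s l ∈ Pg) : (s, l) ∈ J := by
  have := h _ hs (Empty.elim : Empty → Elem C) fun L hL => by cases hL
  rwa [← factRule_ground s l Empty.elim]

theorem IsReductModel.choice (h : IsReductModel Pg I J) (hJ : TypesExact J) {R : RelSym V}
    {Ts : List V.Ty} (hs : choiceRule R Ts ∈ Pg) {l : List (Elem C)} (hl : V.Typed Ts l)
    (hI : (ASym.rel R, l) ∈ I) : (ASym.rel R, l) ∈ J := by
  have hθ : ctxVals (fun i => l.getD i (Elem.int 0)) id Ts = l :=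
    ctxVals_of_length_eq _ _ hl.length_eq fun _ => rfl
  have := h _ hs (fun i => l.getD i (Elem.int 0)) ((guards_hold_iff hJ).2 (hθ.symm ▸ hl))
  simp only [choiceRule, AHead.holdsReduct, AAtom.ground, ctxVars_ground, hθ] at this
  exact this hI

/-- The head of a rule is an atom or a choice that is instantiated to `a`. -/
def ARule.Produces {Q : Type u} (r : ARule C Q) (θ : r.Var → Elem C) (a : GAtom C Q) : Prop :=
  ∃ b, (r.head = .atom b ∨ r.head = .choice b) ∧ b.ground θ = a

theorem exists_supporting_rule {Q : Type u} {Pg : Set (ARule C Q)} {I : Set (GAtom C Q)}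
    (hI : I ∈ answerSets Pg) {a : GAtom C Q} (ha : a ∈ I) :
    ∃ r ∈ Pg, ∃ θ, (∀ L ∈ r.body, L.holdsReduct I I θ) ∧ r.Produces θ a := by
  by_contra hno
  push Not at hno
  have hmod : IsReductModel Pg I (I \ {a}) := by
    intro r hr θ hbody
    have hb : ∀ L ∈ r.body, L.holdsReduct I I θ := fun L hL =>
      ALit.holdsReduct_self_of_subset Set.sdiff_subset (hbody L hL)
    have hhead := hI.1 r hr θ hb
    have hp := hno r hr θ hb
    cases hh : r.head with
    | none => rw [hh] at hhead; exact hhead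
    | atom b =>
      rw [hh] at hhead
      exact ⟨hhead, fun h => hp ⟨b, .inl hh, h⟩⟩
    | choice b =>
      rw [hh] at hhead
      exact fun h => ⟨hhead h, fun h => hp ⟨b, .inr hh, h⟩⟩
  have := hI.2 _ Set.sdiff_subset hmod
  rw [← this] at ha
  exact ha.2 rfl

end Models

/-- Sufficient conditions for a completion to be a model of the reduct. -/
theorem Problem.isReductModel_completion {M : Problem.{u} C} {X Y : Set (GFact M.voc)}
    (hYX : Y ⊆ X) (hbase : ∀ x ∈ X, x.1.IsBase → x ∈ Y)
    (hpred : ∀ P Z, M.predI P = some Z → ∀ l ∈ Z, (RelSym.pred P, l.1) ∈ X)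
    (hfunc : ∀ F f, M.funcI F = some f → ∀ l, (RelSym.graph F, l.1 ++ [(f l).1]) ∈ X)
    (hth : ∀ φ ∈ M.reified, φ.red X X [])
    (hcopy : ∀ ρ ∈ M.defn, ∀ l, M.voc.Typed (M.voc.predTy ρ.head) l →
      (M.defn.renamedBody ρ).red X Y l → (RelSym.copy ρ.head, l) ∈ Y) :
    IsReductModel M.alpha (completion M.alpha X X) (completion M.alpha X Y) := by
  have hchoice : ∀ (R : RelSym M.voc) (Ts : List M.voc.Ty), R.IsBase →
      ∀ θ, (choiceRule R Ts).head.holdsReduct (completion M.alpha X X)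
        (completion M.alpha X Y) θ :=
    fun R Ts hR θ h =>
      rel_mem_completion.2 (hbase (R, _) ((rel_mem_completion (x := (R, _))).1 h) hR)
  have hfact : ∀ (s : ASym M.voc) (l : List (Elem C)), (s, l) ∈ completion M.alpha X Y →
      ∀ θ, (factRule s l).head.holdsReduct (completion M.alpha X X)
        (completion M.alpha X Y) θ := by
    intro s l h θ
    rw [← factRule_ground s l θ] at h
    exact h
  have hsound : ∀ (s : ASym M.voc) (Γ : List M.voc.Ty) (φ : NF M.voc Γ), φ.auxRules ⊆ M.alpha →
      (∀ ρ, M.voc.Typed Γ ρ → φ.red X Y ρ → (s, ρ) ∈ completion M.alpha X Y) →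
      ∀ θ, (∀ L ∈ (ruleFor s φ).body, L.holdsReduct (completion M.alpha X X)
        (completion M.alpha X Y) θ) → (ruleFor s φ).head.holdsReduct (completion M.alpha X X)
        (completion M.alpha X Y) θ := by
    intro s Γ φ hφ h θ hbody
    have ht : M.voc.Typed Γ (ctxVals θ Sum.inl Γ) :=
      (guards_hold_iff typesExact_completion).1 fun L hL =>
        hbody L (List.mem_append_right _ hL)
    have hr := (NF.exact_completion hYX hφ _ ht).1 _ _ _ θ rfl fun L hL =>
      hbody L (List.mem_append_left _ hL)
    exact Set.mem_of_eq_of_mem (ctxAtom_ground s θ Sum.inl Γ) (h _ ht hr)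
  intro r hr θ hbody
  rcases Problem.alpha_cases hr with ⟨P, hP, rfl⟩ | ⟨F, hF, rfl⟩ | ⟨T, d, hd, rfl⟩ |
    ⟨P, Z, hP, l, hl, rfl⟩ | ⟨F, f, hF, l, rfl⟩ | ⟨φ, hφ, rfl⟩ | ⟨s, Γ, φ, hb, hs, rfl⟩ | ⟨ρ, hρ, rfl⟩
  · exact hchoice (.pred P) _ trivial θ
  · exact hchoice (.graph F) _ trivial θ
  · exact hfact _ _ (typesExact_completion.singleton.2 hd) θ
  · refine hfact _ _ ?_ θ
    exact rel_mem_completion.2 (hbase (.pred P, l.1) (hpred P Z hP l hl) trivial)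
  · refine hfact _ _ ?_ θ
    exact rel_mem_completion.2 (hbase (.graph F, l.1 ++ [(f l).1]) (hfunc F f hF l) trivial)
  · refine (hbody _ List.mem_cons_self ?_).elim
    exact (aux_mem_completion (s := .reif φ) trivial).2
      ⟨Problem.reif_rules_subset hφ, ASym.holds_reif.2 ⟨rfl, hth φ hφ⟩⟩
  · exact hsound s Γ φ (hb.auxRules_subset.trans hs) (fun ρ ht hr =>
      (aux_mem_completion hb.isAux).2 ⟨hs, Γ, φ, hb, ht, hr⟩) θ hbody
  · exact hsound _ _ _ (Problem.renamedBody_auxRules_subset hρ) (fun l ht hr =>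
      (rel_mem_completion (x := (RelSym.copy ρ.head, l))).2 (hcopy ρ hρ l ht hr)) θ hbody

/-! ### Facts of structures -/

theorem Struc.pred_mem_facts {S : Struc V} {P : V.Pred} {l : List (Elem C)} :
    (RelSym.pred P, l) ∈ S.facts ↔ S.Rel P l := by
  constructor
  · rintro (⟨P', t, ht, h⟩ | ⟨F, t, h⟩)
    · simp only [Prod.mk.injEq, RelSym.pred.injEq] at h
      obtain ⟨rfl, rfl⟩ := h
      exact ⟨t.2, ht⟩
    · simp at h
  · rintro ⟨h, h'⟩
    exact .inl ⟨P, _, h', rfl⟩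

theorem Struc.graph_mem_facts {S : Struc V} {F : V.Func} {l : List (Elem C)} :
    (RelSym.graph F, l) ∈ S.facts ↔ ∃ t, l = t.1 ++ [(S.func F t).1] := by
  constructor
  · rintro (⟨P', t, ht, h⟩ | ⟨F', t, h⟩)
    · simp at h
    · simp only [Prod.mk.injEq, RelSym.graph.injEq] at h
      obtain ⟨rfl, rfl⟩ := h
      exact ⟨t, rfl⟩
  · rintro ⟨t, rfl⟩
    exact .inr ⟨F, t, rfl⟩

theorem Struc.copy_notMem_facts {S : Struc V} {P : V.Pred} {l : List (Elem C)} :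
    (RelSym.copy P, l) ∉ S.facts := by
  rintro (⟨P', t, ht, h⟩ | ⟨F', t, h⟩) <;> simp at h

/-- The facts of a structure, together with the corresponding facts about the copies of the defined
predicates. -/
def Struc.factsWithCopies (Δ : Defn V) (S : Struc V) : Set (GFact V) :=
  S.facts ∪ {x | ∃ P l, Δ.Defines P ∧ S.Rel P l ∧ x = (.copy P, l)}

section Facts

variable {Δ : Defn V} {S : Struc V}

theorem Struc.mem_factsWithCopies_of_isBase {x : GFact V} (hx : x.1.IsBase) :
    x ∈ S.factsWithCopies Δ ↔ x ∈ S.facts := by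
  constructor
  · rintro (h | ⟨P, l, -, -, rfl⟩)
    · exact h
    · exact hx.elim
  · exact .inl

theorem Struc.copy_mem_factsWithCopies {P : V.Pred} {l : List (Elem C)} :
    (RelSym.copy P, l) ∈ S.factsWithCopies Δ ↔ Δ.Defines P ∧ S.Rel P l := by
  constructor
  · rintro (h | ⟨P', l', hP, hl, h⟩)
    · exact (Struc.copy_notMem_facts h).elim
    · simp only [Prod.mk.injEq, RelSym.copy.injEq] at h
      obtain ⟨rfl, rfl⟩ := h
      exact ⟨hP, hl⟩
  · exact fun h => .inr ⟨P, l, h.1, h.2, rfl⟩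

theorem Struc.rename_mem_factsWithCopies {R : RelSym V} (hR : R.IsBase) {l : List (Elem C)} :
    (R.rename Δ.Defines, l) ∈ S.factsWithCopies Δ ↔ (R, l) ∈ S.facts := by
  cases R with
  | pred P =>
    by_cases h : Δ.Defines P
    · simp only [RelSym.rename, if_pos h, Struc.copy_mem_factsWithCopies, Struc.pred_mem_facts]
      exact and_iff_right h
    · simp only [RelSym.rename, if_neg h]
      exact Struc.mem_factsWithCopies_of_isBase trivial
  | copy P => exact hR.elim
  | graph F => exact Struc.mem_factsWithCopies_of_isBase trivial

theorem Struc.graph_iff_app_eq {F : V.Func} {l : List (Elem C)} {d : Elem C}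
    (hl : V.Typed (V.funcArgs F) l) : (RelSym.graph F, l ++ [d]) ∈ S.facts ↔ S.app F l = d := by
  rw [Struc.graph_mem_facts, Struc.app, dif_pos hl]
  constructor
  · rintro ⟨t, ht⟩
    obtain ⟨h1, h2⟩ := List.append_inj' ht rfl
    subst h1
    exact (List.singleton_inj.1 h2).symm
  · rintro rfl
    exact ⟨⟨l, hl⟩, rfl⟩

theorem Struc.represented_factsWithCopies : S.Represented (S.factsWithCopies Δ) :=
  ⟨fun P l => (Struc.mem_factsWithCopies_of_isBase (x := (.pred P, l)) trivial).trans
    Struc.pred_mem_facts,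
    fun F l d hl => (Struc.mem_factsWithCopies_of_isBase (x := (.graph F, l ++ [d])) trivial).trans
      (Struc.graph_iff_app_eq hl)⟩

theorem Approx.compat_renamed {A : Approx V} {J : Set (GFact V)}
    (htr : ∀ x ∈ A.tr, x.1.IsBase → (x.1.rename Δ.Defines, x.2) ∈ J)
    (hfa : ∀ x ∈ A.fa, x ∉ S.facts) :
    (A.renamed Δ.Defines).Compat (S.factsWithCopies Δ) J := by
  constructor
  · rintro y ⟨x, hx, hb, rfl⟩
    exact htr x hx hb
  · rintro y ⟨x, hx, hb, rfl⟩ h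
    exact hfa x hx ((Struc.rename_mem_factsWithCopies hb).1 h)

theorem disjoint_renamedFacts {U : Set (GFact V)} (hU : ∀ x ∈ U, x ∉ S.facts) :
    Disjoint (renamedFacts Δ.Defines U) (S.factsWithCopies Δ) := by
  rw [Set.disjoint_left]
  rintro y ⟨x, hx, hb, rfl⟩ h
  exact hU x hx ((Struc.rename_mem_factsWithCopies hb).1 h)

theorem completion_inter_baseAtoms {Pg : Set (ARule C (ASym V))} {X : Set (GFact V)} :
    completion Pg X (S.factsWithCopies Δ) ∩ baseAtoms V = S.atoms := by
  ext ⟨s, l⟩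
  constructor
  · rintro ⟨h, hb⟩
    cases s with
    | ty T =>
      obtain ⟨d, hd, rfl⟩ := (typesExact_completion T l).1 h
      exact .inl ⟨T, d, hd, rfl⟩
    | rel R =>
      have h' := (rel_mem_completion (x := (R, l))).1 h
      refine .inr ⟨(R, l), (Struc.mem_factsWithCopies_of_isBase ?_).1 h', rfl⟩
      cases R with
      | copy P => simp [baseAtoms] at hb
      | pred P => trivial
      | graph F => trivial
    | disj φ ψ => simp [baseAtoms] at hb
    | cond Ts φ => simp [baseAtoms] at hb
    | reif φ => simp [baseAtoms] at hb
  · rintro (⟨T, d, hd, h⟩ | ⟨⟨R, l'⟩, hx, h⟩)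
    · rw [Prod.mk.injEq] at h
      obtain ⟨rfl, rfl⟩ := h
      exact ⟨typesExact_completion.singleton.2 hd, .inl ⟨T, rfl⟩⟩
    · rw [Prod.mk.injEq] at h
      obtain ⟨rfl, rfl⟩ := h
      refine ⟨rel_mem_completion.2 (.inl hx), ?_⟩
      cases R with
      | copy P => exact (Struc.copy_notMem_facts hx).elim
      | pred P => exact .inr (.inl ⟨P, rfl⟩)
      | graph F => exact .inr (.inr ⟨F, rfl⟩)

end Facts

theorem Struc.facts_injective : Function.Injective (Struc.facts (V := V)) := by
  intro S S' h
  have hrel : ∀ P l, S.Rel P l ↔ S'.Rel P l := fun P l => by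
    rw [← Struc.pred_mem_facts, h, Struc.pred_mem_facts]
  ext1
  · funext P
    ext t
    exact ⟨fun ht => ((hrel P t.1).1 ⟨t.2, ht⟩).2, fun ht => ((hrel P t.1).2 ⟨t.2, ht⟩).2⟩
  · funext F t
    have ht : (RelSym.graph F, t.1 ++ [(S.func F t).1]) ∈ S'.facts := by
      rw [← h]; exact Struc.graph_mem_facts.2 ⟨t, rfl⟩
    have := (Struc.graph_iff_app_eq t.2).1 ht
    rw [Struc.app, dif_pos t.2] at this
    exact (Subtype.ext this).symm

theorem Struc.atoms_injective : Function.Injective (Struc.atoms (V := V)) := by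
  intro S S' h
  apply Struc.facts_injective
  have key : ∀ (S : Struc V) (x : GFact V), (ASym.rel x.1, x.2) ∈ S.atoms ↔ x ∈ S.facts := by
    rintro S ⟨R, l⟩
    constructor
    · rintro (⟨T, d, hd, h⟩ | ⟨⟨R', l'⟩, hx, h⟩)
      · simp at h
      · simp only [Prod.mk.injEq, ASym.rel.injEq] at h
        obtain ⟨rfl, rfl⟩ := h
        exact hx
    · exact fun h => .inr ⟨_, h, rfl⟩
  ext x
  rw [← key, ← key, h]

/-! ### The sentences for the function symbols and the copies -/

theorem NF.close_red {X : Set (GFact V)} (Γ : List V.Ty) : ∀ (φ : NF V Γ),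
    (NF.close Γ φ).red X X [] ↔ ∀ ρ, V.Typed Γ ρ → φ.red X X ρ := by
  induction Γ with
  | nil =>
    intro φ
    simp [NF.close, Vocabulary.typed_nil_iff]
  | cons T Γ ih =>
    intro φ
    rw [NF.close, ih]
    constructor
    · intro h ρ hρ
      obtain ⟨d, hd, l, hl, rfl⟩ := Vocabulary.typed_cons_iff.1 hρ
      exact h l hl d hd
    · exact fun h ρ hρ d hd => h _ (hρ.cons hd)

theorem ofFn_getD {n : ℕ} {l : List (Elem C)} (h : l.length = n) :
    (List.ofFn fun i : Fin n => l.getD i.1 (Elem.int 0)) = l := by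
  subst h
  simp

theorem eqSentence_red {X : Set (GFact V)} {P : V.Pred} :
    (eqSentence P).red X X [] ↔ ∀ ρ, V.Typed (V.predTy P) ρ →
      ((RelSym.pred P, ρ) ∈ X ↔ (RelSym.copy P, ρ) ∈ X) := by
  rw [eqSentence, NF.close_red]
  refine forall₂_congr fun ρ hρ => ?_
  simp only [NF.red, NF.predLit, redLit, RelSym.of, Simple.val, ofFn_getD hρ.length_eq, if_true]
  simp only [Bool.false_eq_true, if_false]
  tauto

theorem funcSentence_red {X : Set (GFact V)} {F : V.Func} :
    (funcSentence F).red X X [] ↔ ∀ ρ, V.Typed (V.funcArgs F) ρ →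
      ∃! d, d ∈ V.dom (V.funcRes F) ∧ (RelSym.graph F, ρ ++ [d]) ∈ X := by
  rw [funcSentence, NF.close_red]
  refine forall₂_congr fun ρ hρ => ?_
  have hlit : ∀ d, (NF.fn (Γ := V.funcRes F :: V.funcArgs F) true F
      (fun i => .var (i.1 + 1) (by simp)) (Simple.top _ _)).red X X (d :: ρ) ↔
      (RelSym.graph F, ρ ++ [d]) ∈ X := by
    intro d
    change (RelSym.graph F, (List.ofFn fun i : Fin (V.funcArgs F).length =>
      (d :: ρ).getD (i.1 + 1) (Elem.int 0)) ++ [d]) ∈ X ↔ _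
    simp only [List.getD_cons_succ, ofFn_getD hρ.length_eq]
  have hset : {l | V.Typed [V.funcRes F] l ∧
      (NF.fn (Γ := V.funcRes F :: V.funcArgs F) true F (fun i => .var (i.1 + 1) (by simp))
        (Simple.top _ _)).red X X (l ++ ρ)} =
      (fun d => [d]) '' {d | d ∈ V.dom (V.funcRes F) ∧ (RelSym.graph F, ρ ++ [d]) ∈ X} := by
    ext l
    constructor
    · rintro ⟨hl, h⟩
      obtain ⟨d, hd, rfl⟩ := Vocabulary.typed_singleton_iff.1 hl
      exact ⟨d, ⟨hd, (hlit d).1 h⟩, rfl⟩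
    · rintro ⟨d, ⟨hd, h⟩, rfl⟩
      exact ⟨Vocabulary.typed_singleton_iff.2 ⟨d, hd, rfl⟩, (hlit d).2 h⟩
  have hinj : Function.Injective fun d : Elem C => [d] := List.singleton_injective
  rw [NF.red, and_self]
  refine Elem.int_inj.trans (Nat.cast_eq_one.trans ?_)
  refine Iff.trans (b := {d | d ∈ V.dom (V.funcRes F) ∧
    (RelSym.graph F, ρ ++ [d]) ∈ X}.ncard = 1) ?_ ?_
  · rw [← Set.ncard_image_of_injective _ hinj, ← hset]
    rfl
  · rw [Set.ncard_eq_one]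
    constructor
    · rintro ⟨d, hd⟩
      have h : ∀ d', (d' ∈ V.dom (V.funcRes F) ∧ (RelSym.graph F, ρ ++ [d']) ∈ X) ↔ d' = d :=
        fun d' => by
          have := Set.ext_iff.1 hd d'
          simpa using this
      exact ⟨d, (h d).2 rfl, fun d' hd' => (h d').1 hd'⟩
    · rintro ⟨d, hd, h⟩
      refine ⟨d, Set.ext fun d' => ⟨fun hd' => h d' hd', ?_⟩⟩
      rintro rfl
      exact hd

end AnswerSets

section Correspondence

variable {C : Type} [LinearOrder C]

/-! ### Solutions yield answer sets -/

section Wfm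

variable {V : Vocabulary.{u} C} {Δ : Defn V} {S : Struc V}

/-- The stages of the well-founded iteration. -/
def Defn.stage (Δ : Defn V) (S : Struc V) (n : ℕ) : Approx V :=
  Δ.step^[n] (Δ.start S)

theorem Defn.stage_succ (n : ℕ) : Δ.stage S (n + 1) = Δ.step (Δ.stage S n) :=
  Function.iterate_succ_apply' _ _ _

theorem Defn.stage_tr_subset (n : ℕ) : (Δ.stage S n).tr ⊆ (Δ.wfm S).tr :=
  Set.subset_iUnion (fun n => (Δ.stage S n).tr) n

theorem Defn.stage_fa_subset (n : ℕ) : (Δ.stage S n).fa ⊆ (Δ.wfm S).fa :=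
  Set.subset_iUnion (fun n => (Δ.stage S n).fa) n

theorem Defn.mem_wfm_tr {x : GFact V} : x ∈ (Δ.wfm S).tr ↔ ∃ n, x ∈ (Δ.stage S n).tr :=
  Set.mem_iUnion

theorem Defn.mem_wfm_fa {x : GFact V} : x ∈ (Δ.wfm S).fa ↔ ∃ n, x ∈ (Δ.stage S n).fa :=
  Set.mem_iUnion

theorem Defn.exists_unfounded {x : GFact V} (hx : x ∈ Δ.definedFacts)
    (h : x ∈ (Δ.wfm S).fa) :
    ∃ n U, Δ.Unfounded (Δ.stage S n) U ∧ x ∈ U ∧ U ⊆ (Δ.wfm S).fa := by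
  obtain ⟨n, hn⟩ := Defn.mem_wfm_fa.1 h
  induction n with
  | zero => exact (hn.1 hx).elim
  | succ n ih =>
    have hsub := Defn.stage_fa_subset (Δ := Δ) (S := S) (n + 1)
    rw [Defn.stage_succ] at hn hsub
    rcases hn with hn | ⟨U, hU, hxU⟩
    · exact ih hn
    · exact ⟨n, U, hU, hxU, fun y hy => hsub (.inr ⟨U, hU, hy⟩)⟩

theorem RelSym.rename_of_notMem_definedFacts {x : GFact V} (hx : x ∉ Δ.definedFacts) :
    x.1.rename Δ.Defines = x.1 := by
  obtain ⟨R, l⟩ := x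
  cases R with
  | pred P => exact if_neg fun h => hx ⟨P, h, rfl⟩
  | copy P => rfl
  | graph F => rfl

theorem RelSym.rename_pred {P : V.Pred} (h : Δ.Defines P) :
    (RelSym.pred P).rename Δ.Defines = .copy P :=
  if_pos h

end Wfm

theorem Defn.ev_renamedBody {V : Vocabulary.{u} C} {Δ : Defn V} (A : Approx V) (m : Mode V)
    (r : DefRule V) (l : List (Elem C)) :
    (Δ.renamedBody r).ev (A.renamed Δ.Defines) (m.renamed Δ.Defines) l ↔
      r.body.normalize.ev A m l :=
  NF.ev_rename _ _ _ r.body.normalize_plain _ _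

/-- A body that is true in the reduct is possible without the support of an unfounded set. -/
theorem Defn.possible_of_red {V : Vocabulary.{u} C} {Δ : Defn V} {X Y : Set (GFact V)}
    (hYX : Y ⊆ X) {A : Approx V} (hA : (A.renamed Δ.Defines).Compat X Y) {U : Set (GFact V)}
    (hU : Disjoint (renamedFacts Δ.Defines U) Y) {r : DefRule V} {l : List (Elem C)}
    (h : (Δ.renamedBody r).red X Y l) : r.body.normalize.ev A (.possible U) l :=
  (Defn.ev_renamedBody A (.possible U) r l).1
    (((Δ.renamedBody r).red_between hYX hA l).2 _ hU h)

variable {M : Problem.{u} C} {S : Struc M.voc}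

theorem Problem.reified_red (hS : S ∈ M.solutions) :
    ∀ φ ∈ M.reified, φ.red (S.factsWithCopies M.defn) (S.factsWithCopies M.defn) [] := by
  rintro φ ((⟨χ, hχ, rfl⟩ | ⟨F, rfl⟩) | ⟨P, hP, rfl⟩)
  · exact (Formula.normalize_red Struc.represented_factsWithCopies χ).2 (hS.2.1 χ hχ)
  · refine funcSentence_red.2 fun ρ hρ => ⟨S.app F ρ, ⟨S.app_mem F hρ, ?_⟩, ?_⟩
    · exact (Struc.represented_factsWithCopies.graph F ρ _ hρ).2 rfl
    · rintro d ⟨-, hd⟩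
      exact ((Struc.represented_factsWithCopies.graph F ρ _ hρ).1 hd).symm
  · refine eqSentence_red.2 fun ρ hρ => ?_
    rw [Struc.copy_mem_factsWithCopies, Struc.represented_factsWithCopies.pred, and_iff_right hP]

theorem Problem.interpreted_pred_mem (hS : M.Expands S) {P : M.voc.Pred}
    {Z : Set (M.voc.Tuple (M.voc.predTy P))} (hP : M.predI P = some Z)
    {l : M.voc.Tuple (M.voc.predTy P)} : l ∈ Z ↔ S.Rel P l.1 := by
  rw [← hS.1 P Z hP]
  exact ⟨fun h => ⟨l.2, h⟩, fun h => h.2⟩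

theorem Problem.isReductModel_of_solution (hS : S ∈ M.solutions) :
    IsReductModel M.alpha
      (completion M.alpha (S.factsWithCopies M.defn) (S.factsWithCopies M.defn))
      (completion M.alpha (S.factsWithCopies M.defn) (S.factsWithCopies M.defn)) := by
  refine Problem.isReductModel_completion subset_rfl (fun _ h _ => h) ?_ ?_
    (Problem.reified_red hS) ?_
  · intro P Z hP l hl
    exact (Struc.represented_factsWithCopies.pred _ _).2
      ((Problem.interpreted_pred_mem hS.1 hP).1 hl)
  · intro F f hF l
    rw [← hS.1.2 F f hF]
    exact .inl (Struc.graph_mem_facts.2 ⟨l, rfl⟩)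
  · intro r hr l hl hred
    have hdef : M.defn.Defines r.head := ⟨r, hr, rfl⟩
    refine Struc.copy_mem_factsWithCopies.2 ⟨hdef, ?_⟩
    by_contra hnot
    rw [← Struc.pred_mem_facts] at hnot
    obtain ⟨htr, hfa⟩ := hS.2.2
    have hfa' : (RelSym.pred r.head, l) ∈ (M.defn.wfm S).fa := by rw [hfa]; exact hnot
    obtain ⟨n, U, hU, hxU, hUfa⟩ := Defn.exists_unfounded ⟨_, hdef, rfl⟩ hfa'
    rw [hfa] at hUfa
    refine ((hU _ hxU).2.2 r hr l hl rfl) (Defn.possible_of_red subset_rfl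
      (Approx.compat_renamed (fun x hx hb => (Struc.rename_mem_factsWithCopies hb).2 ?_)
        fun x hx => ?_) (disjoint_renamedFacts fun x hx => hUfa hx) hred)
    · exact htr ▸ Defn.stage_tr_subset n hx
    · have := Defn.stage_fa_subset n hx
      rw [hfa] at this
      exact this

theorem Problem.completion_mem_answerSets (hS : S ∈ M.solutions) :
    completion M.alpha (S.factsWithCopies M.defn) (S.factsWithCopies M.defn) ∈
      answerSets M.alpha := by
  refine ⟨Problem.isReductModel_of_solution hS, fun J hJI hJ => hJI.antisymm ?_⟩
  obtain ⟨hexp, -, hwtr, hwfa⟩ := hS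
  set X := S.factsWithCopies M.defn with hX
  have hJt : TypesExact J := fun T l =>
    ⟨fun h => (typesExact_completion T l).1 (hJI h), by
      rintro ⟨d, hd, rfl⟩
      exact hJ.fact (Problem.fact_ty_mem hd)⟩
  have hbase : ∀ x ∈ S.facts, (ASym.rel x.1, x.2) ∈ J := by
    rintro ⟨R, l⟩ hx
    have hxI : (ASym.rel R, l) ∈ completion M.alpha X X :=
      (rel_mem_completion (x := (R, l))).2 (.inl hx)
    cases R with
    | pred P =>
      obtain ⟨hl, hl'⟩ := Struc.pred_mem_facts.1 hx
      cases hP : M.predI P with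
      | none => exact hJ.choice hJt (Problem.choice_pred_mem hP) hl hxI
      | some Z =>
        rw [hexp.1 P Z hP] at hl'
        exact hJ.fact (Problem.fact_pred_mem hP hl')
    | copy P => exact (Struc.copy_notMem_facts hx).elim
    | graph F =>
      obtain ⟨t, rfl⟩ := Struc.graph_mem_facts.1 hx
      cases hF : M.funcI F with
      | none =>
        exact hJ.choice hJt (Problem.choice_graph_mem hF)
          (t.2.append (Vocabulary.typed_singleton_iff.2 ⟨_, (S.func F t).2, rfl⟩)) hxI
      | some f =>
        rw [hexp.2 F f hF]
        exact hJ.fact (Problem.fact_graph_mem hF t)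
  have hreal : ∀ {A : Approx M.voc}, A.Compat X {x | (ASym.rel x.1, x.2) ∈ J} →
      ∀ {Γ : List M.voc.Ty} (φ : NF M.voc Γ), φ.auxRules ⊆ M.alpha → ∀ ρ, M.voc.Typed Γ ρ →
        φ.ev A .certain ρ → φ.Realized (completion M.alpha X X) J ρ := fun hA _ φ =>
    φ.realized_of_certain typesExact_completion hJt hJI (fun _ => rel_mem_completion)
      (fun _ hs hr _ => (aux_mem_completion hs).trans (and_iff_right hr)) hJ hA
  have hstage : ∀ n, ∀ x ∈ (M.defn.stage S n).tr, x.1.IsBase →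
      (ASym.rel (x.1.rename M.defn.Defines), x.2) ∈ J := by
    intro n
    induction n with
    | zero =>
      rintro x ⟨hx, hxS⟩ -
      rw [RelSym.rename_of_notMem_definedFacts hx]
      exact hbase x hxS
    | succ n ih =>
      rw [Defn.stage_succ]
      rintro x (hx | ⟨r, hr, l, hl, rfl, hev⟩) hb
      · exact ih x hx hb
      · have hA : ((M.defn.stage S n).renamed M.defn.Defines).Compat X
            {x | (ASym.rel x.1, x.2) ∈ J} := Approx.compat_renamed ih fun x hx => by
          have := Defn.stage_fa_subset n hx
          rw [hwfa] at this
          exact this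
        have := hJ.rule_fires hJt (Problem.copy_rule_mem hr) hl
          (hreal hA _ (Problem.renamedBody_auxRules_subset hr) l hl
            ((Defn.ev_renamedBody _ .certain r l).2 hev))
        rw [RelSym.rename_pred ⟨r, hr, rfl⟩]
        exact this
  have hrel : ∀ x ∈ X, (ASym.rel x.1, x.2) ∈ J := by
    rintro x (hx | ⟨P, l, hP, hl, rfl⟩)
    · exact hbase x hx
    · rw [← Struc.pred_mem_facts, ← hwtr] at hl
      obtain ⟨n, hn⟩ := Defn.mem_wfm_tr.1 hl
      have := hstage n _ hn trivial
      rwa [RelSym.rename_pred hP] at this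
  rintro a (⟨T, d, hd, rfl⟩ | ⟨x, hx, rfl⟩ | ⟨hr, Γ, φ, hb, ht, hφ⟩)
  · exact hJ.fact (Problem.fact_ty_mem hd)
  · exact hrel x hx
  · exact hJ.rule_fires hJt (hr hb.rule_mem) ht
      (hreal (A := Approx.total X) ⟨hrel, fun _ h => h⟩ φ (hb.auxRules_subset.trans hr) _ ht
        ((φ.ev_total_iff X _).1.2 hφ))

/-! ### Answer sets yield solutions -/

section Answer

variable {I : Set (GAtom C (ASym M.voc))}

theorem Problem.support_cases (hI : I ∈ answerSets M.alpha) {a : GAtom C (ASym M.voc)}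
    (ha : a ∈ I) :
    (∃ (P : M.voc.Pred) (θ : ℕ → Elem C), M.predI P = none ∧
      (∀ L ∈ guards id (M.voc.predTy P), L.holdsReduct I I θ) ∧
      (.rel (.pred P), ctxVals θ id (M.voc.predTy P)) = a) ∨
    (∃ (F : M.voc.Func) (θ : ℕ → Elem C), M.funcI F = none ∧
      (∀ L ∈ guards id (M.voc.funcArgs F ++ [M.voc.funcRes F]), L.holdsReduct I I θ) ∧
      (.rel (.graph F), ctxVals θ id (M.voc.funcArgs F ++ [M.voc.funcRes F])) = a) ∨
    (∃ T, ∃ d ∈ M.voc.dom T, (.ty T, [d]) = a) ∨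
    (∃ P Z, M.predI P = some Z ∧ ∃ l ∈ Z, (.rel (.pred P), l.1) = a) ∨
    (∃ F f, M.funcI F = some f ∧ ∃ l, (.rel (.graph F), l.1 ++ [(f l).1]) = a) ∨
    (∃ (s : ASym M.voc) (Γ : List M.voc.Ty) (φ : NF M.voc Γ) (θ : ℕ ⊕ φ.ExVar → Elem C),
      s.Body Γ φ ∧ s.rules ⊆ M.alpha ∧
      (∀ L ∈ φ.conj Sum.inl Sum.inr ++ guards Sum.inl Γ, L.holdsReduct I I θ) ∧
      (s, ctxVals θ Sum.inl Γ) = a) ∨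
    (∃ ρ ∈ M.defn, ∃ θ : ℕ ⊕ (M.defn.renamedBody ρ).ExVar → Elem C,
      (∀ L ∈ guards Sum.inl (M.voc.predTy ρ.head), L.holdsReduct I I θ) ∧
      (.rel (.copy ρ.head), ctxVals θ Sum.inl (M.voc.predTy ρ.head)) = a) := by
  obtain ⟨r, hr, θ, hbody, b, hb, hba⟩ := exists_supporting_rule hI ha
  have hatom : ∀ {Z : Type} {b b' : AAtom C (ASym M.voc) Z},
      AHead.atom b' = .atom b ∨ AHead.atom b' = .choice b → b = b' := by
    rintro Z b b' (h | h)
    · exact (AHead.atom.inj h).symm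
    · cases h
  have hchoice : ∀ {Z : Type} {b b' : AAtom C (ASym M.voc) Z},
      AHead.choice b' = .atom b ∨ AHead.choice b' = .choice b → b = b' := by
    rintro Z b b' (h | h)
    · cases h
    · exact (AHead.choice.inj h).symm
  rcases Problem.alpha_cases hr with ⟨P, hP, rfl⟩ | ⟨F, hF, rfl⟩ | ⟨T, d, hd, rfl⟩ |
    ⟨P, Z, hP, l, hl, rfl⟩ | ⟨F, f, hF, l, rfl⟩ | ⟨φ, hφ, rfl⟩ | ⟨s, Γ, φ, hb', hs, rfl⟩ | ⟨ρ, hρ, rfl⟩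
  · obtain rfl := hchoice hb
    exact .inl ⟨P, θ, hP, hbody, (ctxAtom_ground _ θ _ _).symm.trans hba⟩
  · obtain rfl := hchoice hb
    exact .inr (.inl ⟨F, θ, hF, hbody, (ctxAtom_ground _ θ _ _).symm.trans hba⟩)
  · obtain rfl := hatom hb
    exact .inr (.inr (.inl ⟨T, d, hd, (factRule_ground _ _ θ).symm.trans hba⟩))
  · obtain rfl := hatom hb
    exact .inr (.inr (.inr (.inl ⟨P, Z, hP, l, hl, (factRule_ground _ _ θ).symm.trans hba⟩)))
  · obtain rfl := hatom hb
    exact .inr (.inr (.inr (.inr (.inl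
      ⟨F, f, hF, l, (factRule_ground _ _ θ).symm.trans hba⟩))))
  · rcases hb with hb | hb <;> cases hb
  · obtain rfl := hatom hb
    exact .inr (.inr (.inr (.inr (.inr (.inl
      ⟨s, Γ, φ, θ, hb', hs, hbody, (ctxAtom_ground _ θ _ _).symm.trans hba⟩)))))
  · obtain rfl := hatom hb
    exact .inr (.inr (.inr (.inr (.inr (.inr
      ⟨ρ, hρ, θ, fun L hL => hbody L (List.mem_append_right _ hL),
        (ctxAtom_ground _ θ _ _).symm.trans hba⟩)))))

end Answer

end Correspondence

section Answer

variable {C : Type} [LinearOrder C] {M : Problem.{u} C} {I : Set (GAtom C (ASym M.voc))}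

theorem Problem.typesExact_of_answerSet (hI : I ∈ answerSets M.alpha) : TypesExact I := by
  intro T l
  constructor
  · intro h
    rcases Problem.support_cases hI h with ⟨P, θ, -, -, h⟩ | ⟨F, θ, -, -, h⟩ | ⟨T', d, hd, h⟩ |
      ⟨P, Z, -, l', -, h⟩ | ⟨F, f, -, l', h⟩ | ⟨s, Γ, φ, θ, hb, -, -, h⟩ | ⟨ρ, -, θ, -, h⟩
    all_goals rw [Prod.mk.injEq] at h; obtain ⟨h, hl⟩ := h
    · cases h
    · cases h
    · cases h; exact ⟨d, hd, hl.symm⟩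
    · cases h
    · cases h
    · cases h; exact hb.isAux.elim
    · cases h
  · rintro ⟨d, hd, rfl⟩
    exact hI.1.fact (Problem.fact_ty_mem hd)

/-- The facts about predicates, copies and graphs in a set of ground atoms. -/
def relFacts {V : Vocabulary.{u} C} (I : Set (GAtom C (ASym V))) : Set (GFact V) :=
  {x | (.rel x.1, x.2) ∈ I}

theorem Problem.pred_of_mem_answerSet (hI : I ∈ answerSets M.alpha) {P : M.voc.Pred}
    {l : List (Elem C)} (h : (RelSym.pred P, l) ∈ relFacts I) :
    ∃ hl : M.voc.Typed (M.voc.predTy P) l, ∀ Z, M.predI P = some Z → ⟨l, hl⟩ ∈ Z := by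
  rcases Problem.support_cases hI h with ⟨P', θ, hP, hg, h⟩ | ⟨F, θ, -, -, h⟩ | ⟨T', d, hd, h⟩ |
    ⟨P', Z, hZ, t, ht, h⟩ | ⟨F, f, -, l', h⟩ | ⟨s, Γ, φ, θ, hb, -, -, h⟩ | ⟨ρ, -, θ, -, h⟩
  all_goals rw [Prod.mk.injEq] at h; obtain ⟨h, hl⟩ := h
  · cases h
    cases hl
    exact ⟨(guards_hold_iff (Problem.typesExact_of_answerSet hI)).1 hg,
      fun Z hZ => by rw [hP] at hZ; cases hZ⟩
  · cases h
  · cases h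
  · cases h
    cases hl
    exact ⟨t.2, fun Z' hZ' => by rw [hZ] at hZ'; cases hZ'; exact ht⟩
  · cases h
  · cases h; exact hb.isAux.elim
  · cases h

theorem Problem.graph_of_mem_answerSet (hI : I ∈ answerSets M.alpha) {F : M.voc.Func}
    {l : List (Elem C)} (h : (RelSym.graph F, l) ∈ relFacts I) :
    M.voc.Typed (M.voc.funcArgs F ++ [M.voc.funcRes F]) l ∧
      ∀ f, M.funcI F = some f → ∃ t, l = t.1 ++ [(f t).1] := by
  rcases Problem.support_cases hI h with ⟨P', θ, hP, hg, h⟩ | ⟨F', θ, hF, hg, h⟩ |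
    ⟨T', d, hd, h⟩ | ⟨P', Z, hZ, t, ht, h⟩ | ⟨F', f, hF, t, h⟩ | ⟨s, Γ, φ, θ, hb, -, -, h⟩ |
    ⟨ρ, -, θ, -, h⟩
  all_goals rw [Prod.mk.injEq] at h; obtain ⟨h, hl⟩ := h
  · cases h
  · cases h
    cases hl
    exact ⟨(guards_hold_iff (Problem.typesExact_of_answerSet hI)).1 hg,
      fun Z hZ => by rw [hF] at hZ; cases hZ⟩
  · cases h
  · cases h
  · cases h
    cases hl
    exact ⟨t.2.append (Vocabulary.typed_singleton_iff.2 ⟨_, (f t).2, rfl⟩),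
      fun f' hf' => by rw [hF] at hf'; cases hf'; exact ⟨t, rfl⟩⟩
  · cases h; exact hb.isAux.elim
  · cases h

theorem Problem.copy_of_mem_answerSet (hI : I ∈ answerSets M.alpha) {P : M.voc.Pred}
    {l : List (Elem C)} (h : (RelSym.copy P, l) ∈ relFacts I) :
    M.defn.Defines P ∧ M.voc.Typed (M.voc.predTy P) l := by
  rcases Problem.support_cases hI h with ⟨P', θ, hP, hg, h⟩ | ⟨F', θ, hF, hg, h⟩ |
    ⟨T', d, hd, h⟩ | ⟨P', Z, hZ, t, ht, h⟩ | ⟨F', f, hF, t, h⟩ | ⟨s, Γ, φ, θ, hb, -, -, h⟩ |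
    ⟨ρ, hρ, θ, hg, h⟩
  all_goals rw [Prod.mk.injEq] at h; obtain ⟨h, hl⟩ := h
  · cases h
  · cases h
  · cases h
  · cases h
  · cases h
  · cases h; exact hb.isAux.elim
  · cases h
    cases hl
    exact ⟨⟨ρ, hρ, rfl⟩, (guards_hold_iff (Problem.typesExact_of_answerSet hI)).1 hg⟩

theorem Problem.aux_of_mem_answerSet (hI : I ∈ answerSets M.alpha) {s : ASym M.voc} (hs : s.IsAux)
    {l : List (Elem C)} (h : (s, l) ∈ I) :
    s.rules ⊆ M.alpha ∧ ∃ (Γ : List M.voc.Ty) (φ : NF M.voc Γ) (θ : ℕ ⊕ φ.ExVar → Elem C),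
      s.Body Γ φ ∧ M.voc.Typed Γ l ∧ ctxVals θ Sum.inl Γ = l ∧
      ∀ L ∈ φ.conj Sum.inl Sum.inr, L.holdsReduct I I θ := by
  rcases Problem.support_cases hI h with ⟨P', θ, hP, hg, h⟩ | ⟨F', θ, hF, hg, h⟩ |
    ⟨T', d, hd, h⟩ | ⟨P', Z, hZ, t, ht, h⟩ | ⟨F', f, hF, t, h⟩ | ⟨s, Γ, φ, θ, hb, hr, hg, h⟩ |
    ⟨ρ, hρ, θ, hg, h⟩
  all_goals rw [Prod.mk.injEq] at h; obtain ⟨h, hl⟩ := h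
  · cases h; exact hs.elim
  · cases h; exact hs.elim
  · cases h; exact hs.elim
  · cases h; exact hs.elim
  · cases h; exact hs.elim
  · subst h
    subst hl
    exact ⟨hr, Γ, φ, θ, hb, (guards_hold_iff (Problem.typesExact_of_answerSet hI)).1
      fun L hL => hg L (List.mem_append_right _ hL), rfl,
      fun L hL => hg L (List.mem_append_left _ hL)⟩
  · cases h; exact hs.elim

theorem Problem.aux_mem_answerSet_iff (hI : I ∈ answerSets M.alpha) {s : ASym M.voc}
    (hs : s.IsAux) (hr : s.rules ⊆ M.alpha)
    (hex : ∀ Γ φ, s.Body Γ φ → φ.Exact I I (relFacts I) (relFacts I)) (l : List (Elem C)) :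
    (s, l) ∈ I ↔ s.Holds (relFacts I) (relFacts I) l := by
  constructor
  · intro h
    obtain ⟨-, Γ, φ, θ, hb, ht, hl, hbody⟩ := Problem.aux_of_mem_answerSet hI hs h
    exact ⟨Γ, φ, hb, ht, (hex Γ φ hb l ht).1 _ _ _ θ hl hbody⟩
  · rintro ⟨Γ, φ, hb, ht, hφ⟩
    exact hI.1.rule_fires (Problem.typesExact_of_answerSet hI) (hr hb.rule_mem) ht
      ((hex Γ φ hb l ht).2 hφ)

theorem Problem.exact_of_answerSet (hI : I ∈ answerSets M.alpha) {Γ : List M.voc.Ty}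
    {φ : NF M.voc Γ} (hφ : φ.auxRules ⊆ M.alpha) : φ.Exact I I (relFacts I) (relFacts I) :=
  NF.exact_of_auxRules_subset subset_rfl (Problem.typesExact_of_answerSet hI)
    (Problem.typesExact_of_answerSet hI) (fun _ => Iff.rfl) (fun _ => Iff.rfl)
    (fun _ => Problem.aux_mem_answerSet_iff hI) (fun _ => Problem.aux_mem_answerSet_iff hI) φ hφ

theorem Problem.answerSet_eq_completion (hI : I ∈ answerSets M.alpha) :
    I = completion M.alpha (relFacts I) (relFacts I) := by
  have haux : ∀ s : ASym M.voc, s.IsAux → ∀ l,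
      ((s, l) ∈ I ↔ (s, l) ∈ completion M.alpha (relFacts I) (relFacts I)) := by
    intro s hs l
    have hiff : s.rules ⊆ M.alpha → ((s, l) ∈ I ↔ s.Holds (relFacts I) (relFacts I) l) :=
      fun hr => Problem.aux_mem_answerSet_iff hI hs hr
        (fun Γ φ hb => Problem.exact_of_answerSet hI (hb.auxRules_subset.trans hr)) l
    rw [aux_mem_completion hs]
    exact ⟨fun h => have hr := (Problem.aux_of_mem_answerSet hI hs h).1
      ⟨hr, (hiff hr).1 h⟩, fun h => (hiff h.1).2 h.2⟩
  ext ⟨s, l⟩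
  cases s with
  | ty T => exact (Problem.typesExact_of_answerSet hI T l).trans (typesExact_completion T l).symm
  | rel R => exact (rel_mem_completion (x := (R, l)) (Y := relFacts I)).symm
  | disj φ ψ => exact haux (.disj φ ψ) trivial l
  | cond Ts φ => exact haux (.cond Ts φ) trivial l
  | reif φ => exact haux (.reif φ) trivial l

theorem Problem.reified_red_of_answerSet (hI : I ∈ answerSets M.alpha) {φ : NF M.voc []}
    (hφ : φ ∈ M.reified) : φ.red (relFacts I) (relFacts I) [] := by
  have h : (ASym.reif φ, []) ∈ I := by
    by_contra hno
    refine hI.1 _ (Problem.constraint_mem hφ) (Empty.elim : Empty → Elem C) fun L hL => ?_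
    rw [List.mem_singleton] at hL
    subst hL
    exact hno
  rw [Problem.answerSet_eq_completion hI] at h
  exact (ASym.holds_reif.1 ((aux_mem_completion (s := .reif φ) trivial).1 h).2).2

theorem Problem.copy_mem_of_red (hI : I ∈ answerSets M.alpha) {r : DefRule M.voc}
    (hr : r ∈ M.defn) {l : List (Elem C)} (hl : M.voc.Typed (M.voc.predTy r.head) l)
    (h : (M.defn.renamedBody r).red (relFacts I) (relFacts I) l) :
    (RelSym.copy r.head, l) ∈ relFacts I :=
  hI.1.rule_fires (Problem.typesExact_of_answerSet hI) (Problem.copy_rule_mem hr) hl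
    ((Problem.exact_of_answerSet hI (Problem.renamedBody_auxRules_subset hr) l hl).2 h)

theorem Problem.exists_struc_of_answerSet (hI : I ∈ answerSets M.alpha) :
    ∃ S : Struc M.voc, M.Expands S ∧ relFacts I = S.factsWithCopies M.defn := by
  have hfun : ∀ F (t : M.voc.Tuple (M.voc.funcArgs F)), ∃! d, d ∈ M.voc.dom (M.voc.funcRes F) ∧
      (RelSym.graph F, t.1 ++ [d]) ∈ relFacts I := fun F t =>
    funcSentence_red.1 (Problem.reified_red_of_answerSet hI (.inl (.inr ⟨F, rfl⟩))) t.1 t.2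
  choose g hg hg' using hfun
  let S : Struc M.voc := ⟨fun P => {t | (RelSym.pred P, t.1) ∈ relFacts I},
    fun F t => ⟨g F t, (hg F t).1⟩⟩
  have hrel : ∀ P l, S.Rel P l ↔ (RelSym.pred P, l) ∈ relFacts I := fun P l =>
    ⟨fun h => h.2, fun h => ⟨(Problem.pred_of_mem_answerSet hI h).1, h⟩⟩
  refine ⟨S, ⟨fun P Z hP => ?_, fun F f hF => ?_⟩, ?_⟩
  · ext t
    refine ⟨fun h => ?_, fun h => hI.1.fact (Problem.fact_pred_mem hP h)⟩
    obtain ⟨hl, hZ⟩ := Problem.pred_of_mem_answerSet hI h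
    exact hZ Z hP
  · funext t
    exact Subtype.ext (hg' F t _ ⟨(f t).2, hI.1.fact (Problem.fact_graph_mem hF t)⟩).symm
  · ext ⟨R, l⟩
    cases R with
    | pred P =>
      rw [← hrel]
      exact (Struc.represented_factsWithCopies.pred P l).symm
    | copy P =>
      rw [Struc.copy_mem_factsWithCopies, hrel]
      have heq : M.defn.Defines P → ∀ l, M.voc.Typed (M.voc.predTy P) l →
          ((RelSym.pred P, l) ∈ relFacts I ↔ (RelSym.copy P, l) ∈ relFacts I) := fun hP =>
        eqSentence_red.1 (Problem.reified_red_of_answerSet hI (.inr ⟨P, hP, rfl⟩))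
      constructor
      · intro h
        obtain ⟨hP, hl⟩ := Problem.copy_of_mem_answerSet hI h
        exact ⟨hP, (heq hP l hl).2 h⟩
      · rintro ⟨hP, h⟩
        exact (heq hP l (Problem.pred_of_mem_answerSet hI h).1).1 h
    | graph F =>
      rw [Struc.mem_factsWithCopies_of_isBase (x := (.graph F, l)) trivial, Struc.graph_mem_facts]
      constructor
      · intro h
        have ht := (Problem.graph_of_mem_answerSet hI h).1
        obtain ⟨l₁, l₂, h₁, h₂, rfl⟩ : ∃ l₁ l₂, M.voc.Typed (M.voc.funcArgs F) l₁ ∧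
            M.voc.Typed [M.voc.funcRes F] l₂ ∧ l = l₁ ++ l₂ := by
          refine ⟨_, _, List.forall₂_take_append _ _ _ ht, List.forall₂_drop_append _ _ _ ht, ?_⟩
          simp
        obtain ⟨d, hd, rfl⟩ := Vocabulary.typed_singleton_iff.1 h₂
        refine ⟨⟨l₁, h₁⟩, ?_⟩
        rw [hg' F ⟨l₁, h₁⟩ d ⟨hd, h⟩]
      · rintro ⟨t, rfl⟩
        exact (hg F t).2

theorem Problem.disjoint_of_unfounded (hI : I ∈ answerSets M.alpha) {S : Struc M.voc}
    (hS : M.Expands S) (hX : relFacts I = S.factsWithCopies M.defn) {A : Approx M.voc}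
    (htr : ∀ x ∈ A.tr, x ∈ S.facts) (hfa : ∀ x ∈ A.fa, x ∉ S.facts) {U : Set (GFact M.voc)}
    (hU : M.defn.Unfounded A U) : ∀ x ∈ U, x ∉ S.facts := by
  set X := S.factsWithCopies M.defn with hXdef
  set U' := renamedFacts M.defn.Defines U with hU'
  have hIX : I = completion M.alpha X X := by
    rw [← hX]; exact Problem.answerSet_eq_completion hI
  have hYX : X \ U' ⊆ X := Set.sdiff_subset
  have hbase : ∀ x : GFact M.voc, x.1.IsBase → x ∉ U' := by
    rintro _ hb ⟨⟨R, l⟩, hx, -, rfl⟩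
    obtain ⟨P, hP, hR⟩ := (hU _ hx).1
    obtain rfl : R = .pred P := hR
    rw [RelSym.rename_pred hP] at hb
    exact hb
  have hmod : IsReductModel M.alpha I (completion M.alpha X (X \ U')) := by
    rw [hIX]
    refine Problem.isReductModel_completion hYX (fun x hx hb => ⟨hx, hbase x hb⟩) ?_ ?_ ?_ ?_
    · intro P Z hP l hl
      rw [← hX]
      exact hI.1.fact (Problem.fact_pred_mem hP hl)
    · intro F f hF l
      rw [← hX]
      exact hI.1.fact (Problem.fact_graph_mem hF l)
    · intro φ hφ
      rw [← hX]
      exact Problem.reified_red_of_answerSet hI hφ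
    · intro r hr l hl hred
      refine ⟨?_, ?_⟩
      · rw [← hX]
        refine Problem.copy_mem_of_red hI hr hl ?_
        rw [hX]
        exact NF.red_mono hYX _ hred
      · intro hmem
        have hdef : M.defn.Defines r.head := ⟨r, hr, rfl⟩
        rw [← RelSym.rename_pred hdef, hU',
          mem_renamedFacts (R := .pred r.head) trivial] at hmem
        refine (hU _ hmem).2.2 r hr l hl rfl (Defn.possible_of_red hYX ?_
          Set.disjoint_sdiff_right hred)
        refine Approx.compat_renamed (fun x hx hb => ?_) hfa
        refine ⟨(Struc.rename_mem_factsWithCopies hb).2 (htr x hx), fun h => ?_⟩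
        rw [hU', mem_renamedFacts hb] at h
        exact (hU x h).2.1 hx
  have hJI : completion M.alpha X (X \ U') = I :=
    hI.2 _ (by rw [hIX]; exact completion_mono hYX) hmod
  rintro ⟨R, l⟩ hx hxS
  obtain ⟨P, hP, hR⟩ := (hU _ hx).1
  obtain rfl : R = .pred P := hR
  have hcopy : (RelSym.copy P, l) ∈ X :=
    Struc.copy_mem_factsWithCopies.2 ⟨hP, Struc.pred_mem_facts.1 hxS⟩
  have hmem : (RelSym.copy P, l) ∈ X \ U' := by
    rw [← rel_mem_completion (x := (RelSym.copy P, l)) (Pg := M.alpha) (X := X), hJI]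
    rw [← hX] at hcopy
    exact hcopy
  refine hmem.2 ?_
  rw [← RelSym.rename_pred hP, hU', mem_renamedFacts (R := .pred P) trivial]
  exact hx

theorem Problem.stage_sound (hI : I ∈ answerSets M.alpha) {S : Struc M.voc}
    (hS : M.Expands S) (hX : relFacts I = S.factsWithCopies M.defn) (n : ℕ) :
    (∀ x ∈ (M.defn.stage S n).tr, x ∈ S.facts) ∧ ∀ x ∈ (M.defn.stage S n).fa, x ∉ S.facts := by
  induction n with
  | zero => exact ⟨fun x hx => hx.2, fun x hx => hx.2⟩
  | succ n ih =>
    rw [Defn.stage_succ]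
    refine ⟨?_, ?_⟩
    · rintro x (hx | ⟨r, hr, l, hl, rfl, hev⟩)
      · exact ih.1 x hx
      · have hA : ((M.defn.stage S n).renamed M.defn.Defines).Compat
            (S.factsWithCopies M.defn) (S.factsWithCopies M.defn) :=
          Approx.compat_renamed
            (fun x hx hb => (Struc.rename_mem_factsWithCopies hb).2 (ih.1 x hx)) ih.2
        have hred := ((M.defn.renamedBody r).red_between subset_rfl hA l).1
          ((Defn.ev_renamedBody _ .certain r l).2 hev)
        rw [← hX] at hred
        have := Problem.copy_mem_of_red hI hr hl hred
        rw [hX] at this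
        exact Struc.pred_mem_facts.2 (Struc.copy_mem_factsWithCopies.1 this).2
    · rintro x (hx | ⟨U, hU, hxU⟩)
      · exact ih.2 x hx
      · exact Problem.disjoint_of_unfounded hI hS hX ih.1 ih.2 hU x hxU

theorem Problem.exists_solution_of_answerSet (hvalid : M.defn.Valid)
    (hI : I ∈ answerSets M.alpha) :
    ∃ S ∈ M.solutions,
      I = completion M.alpha (S.factsWithCopies M.defn) (S.factsWithCopies M.defn) := by
  obtain ⟨S, hS, hX⟩ := Problem.exists_struc_of_answerSet hI
  refine ⟨S, ⟨hS, fun φ hφ => ?_, ?_⟩, ?_⟩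
  · have := Problem.reified_red_of_answerSet hI (.inl (.inl ⟨φ, hφ, rfl⟩))
    rw [hX] at this
    exact (Formula.normalize_red Struc.represented_factsWithCopies φ).1 this
  · have htr : ∀ x ∈ (M.defn.wfm S).tr, x ∈ S.facts := fun x hx => by
      obtain ⟨n, hn⟩ := Defn.mem_wfm_tr.1 hx
      exact (Problem.stage_sound hI hS hX n).1 x hn
    have hfa : ∀ x ∈ (M.defn.wfm S).fa, x ∉ S.facts := fun x hx => by
      obtain ⟨n, hn⟩ := Defn.mem_wfm_fa.1 hx
      exact (Problem.stage_sound hI hS hX n).2 x hn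
    exact ⟨Set.Subset.antisymm htr fun x hx => (hvalid S x).resolve_right fun h => hfa x h hx,
      Set.Subset.antisymm hfa fun x hx => (hvalid S x).resolve_left fun h => hx (htr x h)⟩
  · rw [← hX]
    exact Problem.answerSet_eq_completion hI

end Answer

/-- Restricting answer sets to the original vocabulary is a one-to-one correspondence between the
answer sets of the translation and the solutions, seen as sets of ground atoms; and a structure is
determined by its set of atoms. -/
theorem theorem5 {C : Type} [LinearOrder C] (M : Problem.{u} C) (hvalid : M.defn.Valid) :
    Function.Injective (Struc.atoms (V := M.voc)) ∧
      Set.BijOn (fun A : Set (GAtom C (ASym M.voc)) => A ∩ baseAtoms M.voc)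
        (answerSets M.alpha) (Struc.atoms '' M.solutions) := by
  refine ⟨Struc.atoms_injective, ?_, ?_, ?_⟩
  · intro I hI
    obtain ⟨S, hS, rfl⟩ := Problem.exists_solution_of_answerSet hvalid hI
    exact ⟨S, hS, completion_inter_baseAtoms.symm⟩
  · intro I hI I' hI' h
    obtain ⟨S, hS, rfl⟩ := Problem.exists_solution_of_answerSet hvalid hI
    obtain ⟨S', hS', rfl⟩ := Problem.exists_solution_of_answerSet hvalid hI'
    have h' : S.atoms = S'.atoms := by
      rw [← completion_inter_baseAtoms (S := S), ← completion_inter_baseAtoms (S := S')]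
      exact h
    rw [Struc.atoms_injective h']
  · rintro _ ⟨S, hS, rfl⟩
    exact ⟨_, Problem.completion_mem_answerSets hS, completion_inter_baseAtoms⟩
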